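/- Let $p$ be a prime, $k$ a perfect field of characteristic $p$, $W=W(k)$, and let $\mathcal O_K$ be a complete discrete valuation ring of mixed characteristic $(0,p)$ with residue field $k$, with uniformizer $\varpi$ and $E=E(u)\in W[u]$ the Eisenstein polynomial of $\varpi$. Let $R_0$ be a $p$-torsion free $W$-algebra with a lift $\varphi$ of Frobenius, and $R=R_0\otimes_W\mathcal O_K$. Assume that $R_0$ and $R$ are $p$-adically complete integral domains, that $R_0/pR_0$ is an integral domain, and that there is, for some $m\ge 0$, a $W$-algebra map $W\langle t_1,\dots,t_m\rangle\to R_0$ that is formally étale for the $p$-adic topology and compatible with $\varphi$ and with some lift of Frobenius on $W\langle t_1,\dots,t_m\rangle$ (the $p$-adic completion of $W[t_1,\dots,t_m]$). Let $A=R_0[[u]]$ with $\varphi(u)=u^p$ and write $x=u$. Put $$A^{\hat\otimes 2}=A[[y-x,\;s_j-t_j : 1\le j\le m]],\qquad A^{\hat\otimes 3}=A[[y-x,\;w-x,\;s_j-t_j,\;r_j-t_j : 1\le j\le m]],$$ with the Frobenius extending that of $A$ such that $\varphi(y)=y^p$, $\varphi(w)=w^p$ and $\varphi(s_j)$, $\varphi(r_j)$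 are obtained from $\varphi(t_j)\in W\langle t_1,\dots,t_m\rangle$ by substituting $s=(s_1,\dots,s_m)$, resp. $r=(r_1,\dots,r_m)$, for $t=(t_1,\dots,t_m)$. Let $\widetilde A^{(2)}$ be the $\delta$-$A^{\hat\otimes 2}$-algebra freely generated by elements $z_0,\dots,z_m$ subject to $Ez_0=y-x$ and $Ez_j=s_j-t_j$ $(1\le j\le m)$, that is, $\widetilde A^{(2)}=A^{\hat\otimes 2}[\delta^n(z_j):n\ge 0]$, and let $A^{(2)}$ be its $(p,E)$-adic completion. Define $A^{(3)}$ in the same way from $A^{\hat\otimes 3}$, adjoining the quotients by $E$ of all the variables $y-x$, $w-x$, $s_j-t_j$, $r_j-t_j$. Write $\gamma_i(z)=z^i/i!$. Let $R[\gamma_i(z_j)]\subset R[1/p][z_0,\dots,z_m]$ be the $R$-subalgebra generated by all $\gamma_i(z_j)$, $i\ge0$, $0\le j\le m$, and $D_z$ its $p$-adic completion. Let $A^{(2)}_{\max}$ be the $p$-adic completion of the $A$-subalgebra of $A[1/p][z_0,\dots,z_m]$ generated by $E/p$ and all $\gamma_i(z_j)$. Then: 1. There are ring isomorphisms $\widetilde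 A^{(2)}/E\cong R[\gamma_i(z_j):i\ge0,\,0\le j\le m]$ and $A^{(2)}/E\cong D_z$ which are compatible with the maps from $R_0$ and send $u\mapsto\varpi$, $z_j\mapsto z_j$. 2. There is a unique $A$-algebra homomorphism $\iota:A^{(2)}\to A^{(2)}_{\max}$ with $\iota(z_j)=z_j$ for all $j$, and $\iota$ is injective. 3. For all $i\ge 0$, $\mathrm{Fil}^iA^{(2)}:=A^{(2)}\cap E^iA^{(2)}_{\max}[1/p]=E^iA^{(2)}$ (intersection taken via $\iota$). 4. For $i=2,3$ there is a $\delta$-structure on $A^{(i)}$, compatible with the Frobenius of $A^{\hat\otimes i}$ and extending the operation $\delta^n(z)\mapsto\delta^{n+1}(z)$ on the adjoined generators, for which $(A^{(i)},(E))$ is a bounded prism. 5. If $R_0$ is noetherian, $A^{(2)}$ and $A^{(3)}$ are flat over $A$. -/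

import Mathlib

open scoped TensorProduct

universe u v w

noncomputable section

namespace PrismaticEnvelope

/-! ### Frobenius lifts, delta-rings, prisms -/

/-- A ring endomorphism lifting the `p`-power map modulo `p`. -/
def IsFrobeniusLift (p : ℕ) {S : Type*} [CommRing S] (φ : S →+* S) : Prop :=
  ∀ x : S, (p : S) ∣ φ x - x ^ p

/-- A `δ`-structure (with respect to the prime `p`) on a commutative ring. -/
structure DeltaStructure (p : ℕ) (S : Type*) [CommRing S] where
  δ : S → S
  map_zero : δ 0 = 0
  map_one : δ 1 = 0
  map_mul : ∀ x y, δ (x * y) = x ^ p * δ y + y ^ p * δ x + (p : S) * δ x * δ y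
  map_add : ∀ x y, δ (x + y) = δ x + δ y -
    ∑ i ∈ Finset.Ioo 0 p, ((p.choose i / p : ℕ) : S) * x ^ i * y ^ (p - i)

/-- The Frobenius `x ↦ x ^ p + p δ(x)` of a `δ`-ring. -/
def DeltaStructure.frob {p : ℕ} {S : Type*} [CommRing S] (D : DeltaStructure p S) (x : S) : S :=
  x ^ p + (p : S) * D.δ x

/-- `S` is derived `I`-complete: for every `f ∈ I` the derived limit of
`⋯ → S → S → S` (multiplication by `f`) vanishes, i.e. the map
`(aₙ) ↦ (aₙ - f aₙ₊₁)` on `∏_ℕ S`, whose kernel and cokernel are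
`Hom(S[1/f], S)` and `Ext¹(S[1/f], S)`, is bijective. -/
def IsDerivedComplete {S : Type*} [CommRing S] (I : Ideal S) : Prop :=
  ∀ f ∈ I, Function.Bijective (fun (a : ℕ → S) (n : ℕ) => a n - f * a (n + 1))

/-- `(S, I)` is a prism: `I` is an invertible ideal (a Cartier divisor), `S` is derived
`(p, I)`-complete, and `p ∈ I + φ(I) S`. -/
structure IsPrism {p : ℕ} {S : Type*} [CommRing S] (D : DeltaStructure p S) (I : Ideal S) :
    Prop where
  invertible : Module.Invertible S I
  derivedComplete : IsDerivedComplete (Ideal.span {(p : S)} ⊔ I)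
  mem : (p : S) ∈ I ⊔ Ideal.span (D.frob '' (I : Set S))

/-- A prism is bounded if the `p`-power torsion of `S / I` is killed by a single power of `p`. -/
structure IsBoundedPrism {p : ℕ} {S : Type*} [CommRing S] (D : DeltaStructure p S)
    (I : Ideal S) : Prop extends IsPrism D I where
  bounded : ∃ N : ℕ, ∀ (x : S ⧸ I) (n : ℕ),
    (p : S ⧸ I) ^ n * x = 0 → (p : S ⧸ I) ^ N * x = 0

/-- `f : S → T` is formally étale for the `p`-adic topologies: unique lifting along
square-zero ideals of rings in which `p` is nilpotent. -/
def IsPadicFormallyEtale (p : ℕ) {S : Type u} {T : Type v} [CommRing S] [CommRing T]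
    (f : S →+* T) : Prop :=
  ∀ (C : Type (max u v)) [CommRing C] (I : Ideal C), IsNilpotent (p : C) → I ^ 2 = ⊥ →
    ∀ (g : S →+* C) (h : T →+* C ⧸ I), h.comp f = (Ideal.Quotient.mk I).comp g →
      ∃! l : T →+* C, l.comp f = g ∧ (Ideal.Quotient.mk I).comp l = h

/-! ### `p`-adic completeness of power series rings -/

section Complete

variable {S : Type*} [CommRing S] (p : ℕ)

theorem smodEq_span_natCast_iff {M : Type*} [AddCommGroup M] [Module S M] (n : ℕ) (x y : M) :
    x ≡ y [SMOD ((Ideal.span {(p : S)}) ^ n • ⊤ : Submodule S M)] ↔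
      ∃ z : M, x - y = ((p : S) ^ n) • z := by
  rw [SModEq.sub_mem, Ideal.span_singleton_pow, Submodule.ideal_span_singleton_smul]
  constructor
  · rintro h
    obtain ⟨z, -, hz⟩ := (Submodule.mem_smul_pointwise_iff_exists _ _ _).1 h
    exact ⟨z, hz.symm⟩
  · rintro ⟨z, hz⟩
    exact (Submodule.mem_smul_pointwise_iff_exists _ _ _).2 ⟨z, trivial, hz.symm⟩

instance isAdicComplete_mvPowerSeries {σ : Type*} [IsAdicComplete (Ideal.span {(p : S)}) S] :
    IsAdicComplete (Ideal.span {(p : MvPowerSeries σ S)}) (MvPowerSeries σ S) where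
  haus' := by
    intro x hx
    ext d
    refine IsHausdorff.haus (I := Ideal.span {(p : S)}) inferInstance _ fun n => ?_
    obtain ⟨z, hz⟩ := (smodEq_span_natCast_iff p n x 0).1 (hx n)
    refine (smodEq_span_natCast_iff p n _ _).2 ⟨MvPowerSeries.coeff d z, ?_⟩
    have h : (p : MvPowerSeries σ S) ^ n = MvPowerSeries.C ((p : S) ^ n) := by simp
    rw [sub_zero, smul_eq_mul, h] at hz
    rw [hz, MvPowerSeries.coeff_C_mul, sub_zero, smul_eq_mul]
  prec' := by
    intro f hf
    have key : ∀ d : σ →₀ ℕ, ∃ L : S, ∀ n,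
        MvPowerSeries.coeff d (f n) ≡ L [SMOD ((Ideal.span {(p : S)}) ^ n • ⊤ : Ideal S)] := by
      intro d
      refine IsPrecomplete.prec (I := Ideal.span {(p : S)}) inferInstance fun {m n} hmn => ?_
      obtain ⟨z, hz⟩ := (smodEq_span_natCast_iff p m _ _).1 (hf hmn)
      refine (smodEq_span_natCast_iff p m _ _).2 ⟨MvPowerSeries.coeff d z, ?_⟩
      have h : (p : MvPowerSeries σ S) ^ m = MvPowerSeries.C ((p : S) ^ m) := by simp
      rw [← map_sub, hz, smul_eq_mul, h, MvPowerSeries.coeff_C_mul, smul_eq_mul]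
    choose L hL using key
    obtain ⟨M, hM⟩ : ∃ M : MvPowerSeries σ S, ∀ d, MvPowerSeries.coeff d M = L d :=
      ⟨fun d => L d, fun d => rfl⟩
    refine ⟨M, fun n => ?_⟩
    have h1 : ∀ d, ∃ z : S, MvPowerSeries.coeff d (f n) - L d = ((p : S) ^ n) • z :=
      fun d => (smodEq_span_natCast_iff p n _ _).1 (hL d n)
    choose z hz using h1
    obtain ⟨N, hN⟩ : ∃ N : MvPowerSeries σ S, ∀ d, MvPowerSeries.coeff d N = z d :=
      ⟨fun d => z d, fun d => rfl⟩
    refine (smodEq_span_natCast_iff p n _ _).2 ⟨N, ?_⟩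
    have h : (p : MvPowerSeries σ S) ^ n = MvPowerSeries.C ((p : S) ^ n) := by simp
    rw [smul_eq_mul, h]
    ext d
    rw [MvPowerSeries.coeff_C_mul, map_sub, hM, hN]
    exact hz d

instance isAdicComplete_powerSeries [IsAdicComplete (Ideal.span {(p : S)}) S] :
    IsAdicComplete (Ideal.span {(p : PowerSeries S)}) (PowerSeries S) :=
  isAdicComplete_mvPowerSeries p

end Complete

/-! ### The `p`-adic Tate algebra `W(k)⟨t₁, …, t_m⟩` -/

section Tate

variable (p : ℕ) [Fact p.Prime] (k : Type*) [CommRing k] (m : ℕ)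

/-- `W(k)⟨t₁, …, t_m⟩`, the `p`-adic completion of `W(k)[t₁, …, t_m]`. -/
abbrev Tate : Type _ :=
  AdicCompletion (Ideal.span {(p : MvPolynomial (Fin m) (WittVector p k))})
    (MvPolynomial (Fin m) (WittVector p k))

/-- The variable `t_j`. -/
def Tate.t (j : Fin m) : Tate p k m :=
  algebraMap (MvPolynomial (Fin m) (WittVector p k)) (Tate p k m) (MvPolynomial.X j)

variable {k m}
variable {S : Type*} [CommRing S] [Algebra (WittVector p k) S]

theorem tate_aux (s : Fin m → S) (n : ℕ) :
    (Ideal.span {(p : MvPolynomial (Fin m) (WittVector p k))}) ^ n ≤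
      ((Ideal.span {(p : S)}) ^ n).comap (MvPolynomial.aeval (R := WittVector p k) s).toRingHom := by
  rw [← Ideal.map_le_iff_le_comap, Ideal.map_pow, Ideal.map_span]
  simp

theorem tate_compat (s : Fin m → S) {a b : ℕ} (hab : a ≤ b) :
    (Ideal.Quotient.factorPow (Ideal.span {(p : S)}) hab).comp
      ((Ideal.quotientMap ((Ideal.span {(p : S)}) ^ b)
        (MvPolynomial.aeval (R := WittVector p k) s).toRingHom (tate_aux p s b)).comp
          (AdicCompletion.evalₐ (Ideal.span {(p : MvPolynomial (Fin m) (WittVector p k))})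
            b).toRingHom) =
      (Ideal.quotientMap ((Ideal.span {(p : S)}) ^ a)
        (MvPolynomial.aeval (R := WittVector p k) s).toRingHom (tate_aux p s a)).comp
          (AdicCompletion.evalₐ (Ideal.span {(p : MvPolynomial (Fin m) (WittVector p k))})
            a).toRingHom := by
  ext x
  induction x using AdicCompletion.induction_on with
  | _ x =>
    simp only [RingHom.comp_apply, AlgHom.toRingHom_eq_coe, RingHom.coe_coe,
      AdicCompletion.evalₐ_mk, Ideal.quotientMap_mk]
    rw [Ideal.Quotient.factorPow, Ideal.Quotient.factor_mk, ← sub_eq_zero, ← map_sub,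
      ← map_sub, Ideal.Quotient.eq_zero_iff_mem]
    refine tate_aux p s a ?_
    have h := x.property hab
    rw [SModEq.sub_mem, smul_eq_mul, Ideal.mul_top] at h
    rw [← neg_sub]
    exact neg_mem h

/-- The homomorphism `W(k)⟨t₁, …, t_m⟩ → S` with `t_j ↦ s_j`, for a `p`-adically complete
`W(k)`-algebra `S`. -/
def Tate.eval [IsAdicComplete (Ideal.span {(p : S)}) S] (s : Fin m → S) : Tate p k m →+* S :=
  IsAdicComplete.liftRingHom (Ideal.span {(p : S)})
    (fun n => (Ideal.quotientMap ((Ideal.span {(p : S)}) ^ n)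
      (MvPolynomial.aeval (R := WittVector p k) s).toRingHom (tate_aux p s n)).comp
        (AdicCompletion.evalₐ (Ideal.span {(p : MvPolynomial (Fin m) (WittVector p k))})
          n).toRingHom)
    (tate_compat p s)

theorem Tate.eval_algebraMap [IsAdicComplete (Ideal.span {(p : S)}) S] (s : Fin m → S)
    (x : MvPolynomial (Fin m) (WittVector p k)) :
    Tate.eval p s (algebraMap _ (Tate p k m) x) = MvPolynomial.aeval s x := by
  rw [IsHausdorff.eq_iff_smodEq (I := Ideal.span {(p : S)})]
  intro n
  rw [SModEq.sub_mem, smul_eq_mul, Ideal.mul_top, ← Ideal.Quotient.eq_zero_iff_mem, map_sub,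
    Tate.eval, IsAdicComplete.mk_liftRingHom _ _ (tate_compat p s),
    AdicCompletion.algebraMap_apply]
  simp

theorem Tate.hom_ext {T : Type*} [CommRing T] [IsAdicComplete (Ideal.span {(p : T)}) T]
    {g h : Tate p k m →+* T}
    (H : ∀ x : MvPolynomial (Fin m) (WittVector p k),
      g (algebraMap _ (Tate p k m) x) = h (algebraMap _ (Tate p k m) x)) : g = h := by
  ext x
  rw [IsHausdorff.eq_iff_smodEq (I := Ideal.span {(p : T)})]
  intro n
  have key : ∃ (y : MvPolynomial (Fin m) (WittVector p k)) (w : Tate p k m),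
      x = algebraMap _ (Tate p k m) y + (p : Tate p k m) ^ n * w := by
    obtain ⟨y, hy⟩ := Ideal.Quotient.mk_surjective (AdicCompletion.evalₐ
      (Ideal.span {(p : MvPolynomial (Fin m) (WittVector p k))}) n x)
    have hker : x - algebraMap _ (Tate p k m) y ∈ (AdicCompletion.eval
        (Ideal.span {(p : MvPolynomial (Fin m) (WittVector p k))})
        (MvPolynomial (Fin m) (WittVector p k)) n).ker := by
      rw [LinearMap.mem_ker, ← AdicCompletion.factor_evalₐ_eq_eval _ _ (by simp), map_sub, ← hy,
        AdicCompletion.algebraMap_apply, AdicCompletion.evalₐ_of]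
      simp
    rw [← AdicCompletion.pow_smul_top_eq_ker_eval 
      ⟨{(p : MvPolynomial (Fin m) (WittVector p k))}, by simp⟩] at hker
    have hker' : x - algebraMap _ (Tate p k m) y ≡ 0 [SMOD
        ((Ideal.span {(p : MvPolynomial (Fin m) (WittVector p k))}) ^ n • ⊤ :
          Submodule (MvPolynomial (Fin m) (WittVector p k)) (Tate p k m))] := by
      rw [SModEq.sub_mem, sub_zero]
      exact hker
    obtain ⟨w, hw⟩ := (smodEq_span_natCast_iff p n _ _).1 hker'
    refine ⟨y, w, ?_⟩
    rw [sub_zero, Algebra.smul_def, map_pow, map_natCast] at hw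
    rw [← hw]
    ring
  obtain ⟨y, w, rfl⟩ := key
  refine (smodEq_span_natCast_iff p n _ _).2 ⟨g w - h w, ?_⟩
  simp only [map_add, map_mul, map_pow, map_natCast, H, smul_eq_mul]
  ring

end Tate

/-! ### The rings `A = R₀⟦u⟧`, `A^⊗̂(r+1)` and their Frobenius -/

section Product

variable (p : ℕ) [Fact p.Prime] {k : Type*} [CommRing k] {m : ℕ}
variable {R₀ : Type*} [CommRing R₀] [Algebra (WittVector p k) R₀]

/-- The Frobenius on `A = R₀⟦u⟧` extending `φ` on `R₀` with `u ↦ u ^ p`. -/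
def frobA (φ : R₀ →+* R₀) : PowerSeries R₀ →+* PowerSeries R₀ :=
  (PowerSeries.expand p (Fact.out : p.Prime).ne_zero).toRingHom.comp (PowerSeries.map φ)

/-- The image of `E ∈ W(k)[u]` in `A = R₀⟦u⟧`. -/
def eisA (R₀ : Type*) [CommRing R₀] [Algebra (WittVector p k) R₀]
    (E : Polynomial (WittVector p k)) : PowerSeries R₀ :=
  ((E.map (algebraMap (WittVector p k) R₀) : Polynomial R₀) : PowerSeries R₀)

/-- The completed `(r+1)`-fold self-product
`A^⊗̂(r+1) = A⟦y_i - x, s_{i,j} - t_j : i < r, j < m⟧`. The variable `(i, none)` is `y_i - x`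
and `(i, some j)` is `s_{i,j} - t_j`, where `x = u` and `y_i`, `s_{i,j}` are the copies of `u`,
`t_j` in the `i`-th additional factor (so for `r = 2`, `y_0 = y`, `y_1 = w`, `s_0 = s`,
`s_1 = r`). It is an `A`-algebra through the first factor. -/
abbrev AProd (R₀ : Type*) [CommRing R₀] (m r : ℕ) : Type _ :=
  MvPowerSeries (Fin r × Option (Fin m)) (PowerSeries R₀)

variable {r : ℕ}
variable [IsAdicComplete (Ideal.span {(p : R₀)}) R₀]
variable (f : Tate p k m →ₐ[WittVector p k] R₀)

/-- The homomorphism `W(k)⟨t₁, …, t_m⟩ → A^⊗̂(r+1)`, `t_j ↦ s_{i,j} = t_j + (s_{i,j} - t_j)`. -/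
def copyHom (i : Fin r) : Tate p k m →+* AProd R₀ m r :=
  Tate.eval p fun j =>
    MvPowerSeries.C (PowerSeries.C (f (Tate.t p k m j))) + MvPowerSeries.X (i, some j)

/-- The value of the Frobenius of `A^⊗̂(r+1)` on the variables:
`φ(y_i - x) = y_i ^ p - x ^ p` and `φ(s_{i,j} - t_j) = φ(t_j)(s_i) - φ(t_j)`, where
`φ(t_j)(s_i)` is the image of `φ(t_j) ∈ W(k)⟨t₁, …, t_m⟩` in the `i`-th additional factor. -/
def frobVar (φt : Tate p k m →+* Tate p k m) : Fin r × Option (Fin m) → AProd R₀ m r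
  | (i, none) => (MvPowerSeries.C PowerSeries.X + MvPowerSeries.X (i, none)) ^ p
      - MvPowerSeries.C (PowerSeries.X ^ p)
  | (i, some j) => copyHom p f i (φt (Tate.t p k m j))
      - MvPowerSeries.C (PowerSeries.C (f (φt (Tate.t p k m j))))

theorem constantCoeff_copyHom (i : Fin r) (x : Tate p k m) :
    MvPowerSeries.constantCoeff (copyHom p f i x) = PowerSeries.C (f x) := by
  have : (MvPowerSeries.constantCoeff (σ := Fin r × Option (Fin m))
      (R := PowerSeries R₀)).comp (copyHom p f i) =
      (PowerSeries.C (R := R₀)).comp (f : Tate p k m →+* R₀) := by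
    refine Tate.hom_ext p fun y => ?_
    simp only [RingHom.comp_apply, copyHom, Tate.eval_algebraMap]
    induction y using MvPolynomial.induction_on with
    | C a =>
      have h1 : (algebraMap (MvPolynomial (Fin m) (WittVector p k)) (Tate p k m))
          (MvPolynomial.C a) = algebraMap (WittVector p k) (Tate p k m) a := rfl
      rw [h1, ← MvPolynomial.algebraMap_eq, AlgHom.commutes, RingHom.coe_coe, AlgHom.commutes,
        MvPowerSeries.algebraMap_apply, MvPowerSeries.constantCoeff_C,
        PowerSeries.algebraMap_apply]
    | add a b ha hb => simp only [map_add, ha, hb]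
    | mul_X a j ha =>
      simp only [map_mul, ha]
      congr 1
      simp [Tate.t]
  exact congrArg (fun g => g x) this

theorem hasSubst_frobVar (φt : Tate p k m →+* Tate p k m) :
    MvPowerSeries.HasSubst (frobVar (r := r) p f φt) := by
  refine MvPowerSeries.hasSubst_of_constantCoeff_zero ?_
  rintro ⟨i, _ | j⟩
  · simp [frobVar]
  · simp [frobVar, constantCoeff_copyHom]

/-- The Frobenius of `A^⊗̂(r+1)`, extending that of `A`. -/
def frobProd (φ : R₀ →+* R₀) (φt : Tate p k m →+* Tate p k m) : AProd R₀ m r →+* AProd R₀ m r :=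
  (MvPowerSeries.substAlgHom (R := PowerSeries R₀) (hasSubst_frobVar p f φt)).toRingHom.comp
    (MvPowerSeries.map (frobA p φ))

end Product

/-! ### The `δ`-envelope `B{y/E}` and its completion -/

section Envelope

/-- The quotient of `x` by `p` (`0` if `x` is not divisible by `p`). -/
def divP (p : ℕ) {S : Type*} [CommRing S] (x : S) : S :=
  open Classical in if h : (p : S) ∣ x then h.choose else 0

variable (p : ℕ) {B : Type*} [CommRing B] (φ : B →+* B) (C : Type*)

/-- The Frobenius of the free `δ`-`B`-algebra `B{z_c : c ∈ C} = B[δⁿ(z_c)]`, which is the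
polynomial ring in the variables `(c, n) = δⁿ(z_c)`. -/
def freeFrob : MvPolynomial (C × ℕ) B →+* MvPolynomial (C × ℕ) B :=
  MvPolynomial.eval₂Hom (MvPolynomial.C.comp φ)
    fun c => MvPolynomial.X c ^ p + (p : MvPolynomial (C × ℕ) B) * MvPolynomial.X (c.1, c.2 + 1)

/-- The operation `δ(g) = (φ(g) - g ^ p) / p` of the free `δ`-algebra (for `B` a `p`-torsion free
ring with the Frobenius lift `φ`). -/
def freeDelta (g : MvPolynomial (C × ℕ) B) : MvPolynomial (C × ℕ) B :=
  divP p (freeFrob p φ C g - g ^ p)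

variable {C}

/-- The `δ`-ideal generated by the elements `E z_c - y_c`, i.e. the ideal generated by all
`δⁿ(E z_c - y_c)`. -/
def deltaRel (E : B) (y : C → B) : Ideal (MvPolynomial (C × ℕ) B) :=
  Ideal.span (Set.range fun cn : C × ℕ => (freeDelta p φ C)^[cn.2]
    (MvPolynomial.C E * MvPolynomial.X (cn.1, 0) - MvPolynomial.C (y cn.1)))

/-- The `δ`-`B`-algebra `B{y_c / E : c ∈ C}_δ = B[δⁿ(z_c)]` freely generated by elements `z_c`
with `E z_c = y_c`. -/
abbrev DeltaEnv (E : B) (y : C → B) : Type _ :=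
  MvPolynomial (C × ℕ) B ⧸ deltaRel p φ E y

/-- The element `δⁿ(z_c)` of the envelope. -/
def DeltaEnv.z (E : B) (y : C → B) (c : C) (n : ℕ) : DeltaEnv p φ E y :=
  Ideal.Quotient.mk _ (MvPolynomial.X (c, n))

/-- The `(p, E)`-adic completion of the `δ`-envelope. -/
abbrev ComplEnv (E : B) (y : C → B) : Type _ :=
  AdicCompletion (Ideal.span {(p : DeltaEnv p φ E y), algebraMap B (DeltaEnv p φ E y) E})
    (DeltaEnv p φ E y)

/-- The element `δⁿ(z_c)` of the completed envelope. -/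
def ComplEnv.z (E : B) (y : C → B) (c : C) (n : ℕ) : ComplEnv p φ E y :=
  algebraMap (DeltaEnv p φ E y) (ComplEnv p φ E y) (DeltaEnv.z p φ E y c n)

end Envelope

section Env

variable (p : ℕ) [Fact p.Prime] {k : Type*} [CommRing k] {m : ℕ}
variable {R₀ : Type*} [CommRing R₀] [Algebra (WittVector p k) R₀]
variable [IsAdicComplete (Ideal.span {(p : R₀)}) R₀]
variable (f : Tate p k m →ₐ[WittVector p k] R₀) (φ : R₀ →+* R₀) (φt : Tate p k m →+* Tate p k m)
variable (E : Polynomial (WittVector p k)) (r : ℕ)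

/-- `Ã^(r+1) = A^⊗̂(r+1)[δⁿ(z_c)]`, `z_c` being the quotient of the variable `c` of
`A^⊗̂(r+1)` by `E`. -/
abbrev ATilde : Type _ :=
  DeltaEnv p (frobProd (r := r) p f φ φt)
    (algebraMap (PowerSeries R₀) (AProd R₀ m r) (eisA p R₀ E)) MvPowerSeries.X

/-- `A^(r+1) = A^⊗̂(r+1){J/E}_δ^∧` with `J` generated by `E` and the variables: the
`(p, E)`-adic completion of `Ã^(r+1)`. -/
abbrev AEnv : Type _ :=
  ComplEnv p (frobProd (r := r) p f φ φt)
    (algebraMap (PowerSeries R₀) (AProd R₀ m r) (eisA p R₀ E)) MvPowerSeries.X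

/-- The element `δⁿ(z_c)` of `Ã^(r+1)`. -/
def ATilde.z (c : Fin r × Option (Fin m)) (n : ℕ) : ATilde p f φ φt E r :=
  DeltaEnv.z _ _ _ _ c n

/-- The element `δⁿ(z_c)` of `A^(r+1)`. -/
def AEnv.z (c : Fin r × Option (Fin m)) (n : ℕ) : AEnv p f φ φt E r :=
  ComplEnv.z _ _ _ _ c n

/-- There is a `δ`-structure on `A^(r+1)`, compatible with the Frobenius of `A^⊗̂(r+1)` and with
`δ(δⁿ(z_c)) = δⁿ⁺¹(z_c)`, which makes `(A^(r+1), (E))` a bounded prism. -/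
def AEnv.IsBoundedPrism : Prop :=
  ∃ D : DeltaStructure p (AEnv p f φ φt E r),
    (∀ b : AProd R₀ m r, D.frob (algebraMap (AProd R₀ m r) (AEnv p f φ φt E r) b) =
      algebraMap (AProd R₀ m r) (AEnv p f φ φt E r) (frobProd p f φ φt b)) ∧
    (∀ c n, D.δ (AEnv.z p f φ φt E r c n) = AEnv.z p f φ φt E r c (n + 1)) ∧
    PrismaticEnvelope.IsBoundedPrism D
      (Ideal.span {algebraMap (PowerSeries R₀) (AEnv p f φ φt E r) (eisA p R₀ E)})

end Env

/-! ### Divided power polynomial rings, `D_z` and `A_max` -/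

section DividedPowers

variable (p : ℕ) (S : Type*) [CommRing S] {C : Type*}

/-- `S[1/p]`. -/
abbrev InvP : Type _ := Localization.Away (p : S)

/-- The divided power `γ_i(z_c) = z_c ^ i / i!` in `S[1/p][z_c : c ∈ C]`, for rings `S` in which
the integers prime to `p` are invertible. -/
def gam (c : C) (i : ℕ) : MvPolynomial C (InvP p S) :=
  MvPolynomial.C (Ring.inverse ((i.factorial : ℕ) : InvP p S)) * MvPolynomial.X c ^ i

variable (C) in
/-- The subring `S[γ_i(z_c) : i ≥ 0, c ∈ C]` of `S[1/p][z_c : c ∈ C]`. -/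
def pdSubalgebra : Subalgebra S (MvPolynomial C (InvP p S)) :=
  Algebra.adjoin S (Set.range fun ci : C × ℕ => gam p S ci.1 ci.2)

variable (C) in
/-- `S[γ_i(z_c) : i ≥ 0, c ∈ C]` as a ring. -/
def PdPoly : Type _ := pdSubalgebra p S C

instance : CommRing (PdPoly p S C) := inferInstanceAs (CommRing (pdSubalgebra p S C))

instance : Algebra S (PdPoly p S C) := inferInstanceAs (Algebra S (pdSubalgebra p S C))

theorem X_eq_gam (c : C) : (MvPolynomial.X c : MvPolynomial C (InvP p S)) = gam p S c 1 := by
  simp [gam]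

/-- The element `z_c` of `S[γ_i(z_c)]`. -/
def PdPoly.z (c : C) : PdPoly p S C :=
  (⟨MvPolynomial.X c, by
    rw [X_eq_gam]
    exact Algebra.subset_adjoin ⟨(c, 1), rfl⟩⟩ : pdSubalgebra p S C)

variable (C) in
/-- The `p`-adic completion of `S[γ_i(z_c)]`; this is `D_z` for `S = R`. -/
abbrev ComplPdPoly : Type _ :=
  AdicCompletion (Ideal.span {(p : PdPoly p S C)}) (PdPoly p S C)

/-- The element `z_c` of the `p`-adic completion of `S[γ_i(z_c)]`. -/
def ComplPdPoly.z (c : C) : ComplPdPoly p S C :=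
  algebraMap (PdPoly p S C) (ComplPdPoly p S C) (PdPoly.z p S c)

variable {S}
variable (E : S)

variable (C) in
/-- The `S`-subalgebra of `S[1/p][z_c : c ∈ C]` generated by `E/p` and the `γ_i(z_c)`. -/
def maxSubalgebra : Subalgebra S (MvPolynomial C (InvP p S)) :=
  Algebra.adjoin S
    ({MvPolynomial.C (algebraMap S (InvP p S) E * Ring.inverse (p : InvP p S))} ∪
      Set.range fun ci : C × ℕ => gam p S ci.1 ci.2)

variable (C) in
/-- `S[E/p, γ_i(z_c) : i ≥ 0, c ∈ C]` as a ring. -/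
def PreMax : Type _ := maxSubalgebra p C E

instance : CommRing (PreMax p C E) := inferInstanceAs (CommRing (maxSubalgebra p C E))

instance : Algebra S (PreMax p C E) := inferInstanceAs (Algebra S (maxSubalgebra p C E))

/-- The element `z_c` of `S[E/p, γ_i(z_c)]`. -/
def PreMax.z (c : C) : PreMax p C E :=
  (⟨MvPolynomial.X c, by
    rw [X_eq_gam]
    exact Algebra.subset_adjoin (Or.inr ⟨(c, 1), rfl⟩)⟩ : maxSubalgebra p C E)

variable (C) in
/-- The `p`-adic completion of `S[E/p, γ_i(z_c)]`; this is `A_max^(2)` for `S = A`. -/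
abbrev RingMax : Type _ :=
  AdicCompletion (Ideal.span {(p : PreMax p C E)}) (PreMax p C E)

/-- The element `z_c` of the `p`-adic completion of `S[E/p, γ_i(z_c)]`. -/
def RingMax.z (c : C) : RingMax p C E :=
  algebraMap (PreMax p C E) (RingMax p C E) (PreMax.z p E c)

/-- For an `S`-algebra homomorphism `ι : T → M` (an inclusion) and `E ∈ S`, the filtration
`Filⁱ T = T ∩ Eⁱ M[1/p]`. -/
def filtration {T M : Type*} [CommRing T] [CommRing M] [Algebra S T] [Algebra S M]
    (ι : T →ₐ[S] M) (i : ℕ) : Ideal T :=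
  (Ideal.span {algebraMap M (InvP p M) (algebraMap S M E) ^ i}).comap
    ((algebraMap M (InvP p M)).comp (ι : T →+* M))

end DividedPowers

end PrismaticEnvelope

end

/-! Everything rests on the shape of the relations `ρ_{c,n} = δⁿ(E z_c - y_c)` defining the
envelope, `y_c` being the variables of the self-product. Since `φ(E) = E^p + p·unit`, each `φⁿ(E)`
with `n ≥ 1` is `p` times a unit modulo `E`. By induction `ρ_{c,n}` is `φⁿ(E) δⁿ(z_c)` plus a
polynomial in the lower `δⁱ(z_c)` (`exists_rel_eq`), while modulo `(p, E)` the relation `ρ_{c,n+1}`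
has degree `p` in `δⁿ(z_c)` with unit leading coefficient (`exists_rel_sub_mem`). So the relations,
ordered by `n`, stay regular after `E` and after `E, p`. Moving `E`, respectively `p`, past them
shows that `E` is regular on the envelope and `p` is regular modulo `E` (`EnvHyp.nzdMod_E`,
`EnvHyp.nzdMod_p`).

Modulo `E` one may put `y = 0`. Then Frobenius kills `z_c`, so `δⁿ(z_c)` becomes `ζ_n` with `ζ_{n+1}
= -ζ_n^p / p`. The `ζ_n` are integer multiples of `γ_{p^n}(z_c)` and conversely generate all divided
powers. The kernel of the resulting map to the divided power ring is `(E)`: up to a power of `p`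
every element is a polynomial in the `z_c`, and `p` is regular (`ResidueHyp.exists_envToPd`). All
this survives completion because `E t ∈ (p, E)^(n+1)` forces `t ∈ (p, E)^n`. As `D_z` has no
`p`-torsion, the completed envelope has none either and `(p)` is closed in it, so the completed
Frobenius yields the `δ`-structure and the bounded prism.

In `A_max` one has `φ(E) = p·unit`, so Frobenius extends by `z_c ↦ φ(y_c)/φ(E)`. This is not a
Frobenius lift, as `E/p` goes to a unit. But on the ideal `z = 0` both `φ(x)` and `x^p` are
divisible by `p`, which is enough to iterate `δ` on the `z_c` and to obtain `ι`. Sending `E/p` to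
`0` gives a map `A_max → D_z` whose composite with `ι` is reduction modulo `E`. Hence an element
that becomes divisible by `E` in `A_max[1/p]` was already divisible by `E`. Induction gives the
filtration, and `E`-adic separatedness gives injectivity.

For flatness, lifts of the divided power monomials are a basis modulo every power of `(p, E)`. Over
a noetherian ring the equational criterion is then checked by successive approximation with
Artin–Rees (`flat_of_forall_linearCombination`). -/

namespace PrismaticEnvelope

/-! ### Nonzerodivisors modulo ideals -/

/-- `e` is a nonzerodivisor modulo the ideal `I`. -/
def NZDMod {R : Type*} [CommRing R] (I : Ideal R) (e : R) : Prop :=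
  ∀ x, e * x ∈ I → x ∈ I

section NZD

variable {R : Type*} [CommRing R]

theorem NZDMod.of_sub_mem {I : Ideal R} {e e' : R} (h : NZDMod I e) (he : e - e' ∈ I) :
    NZDMod I e' := fun x hx => h x (by
  have : e * x = (e - e') * x + e' * x := by ring
  rw [this]
  exact I.add_mem (I.mul_mem_right _ he) hx)

theorem NZDMod.unit_mul {I : Ideal R} {e u : R} (h : NZDMod I e) (hu : IsUnit u) :
    NZDMod I (u * e) := fun x hx => h x (by
  obtain ⟨v, hv⟩ := hu.exists_left_inv
  have : e * x = v * (u * e * x) := by linear_combination (-(e * x)) * hv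
  rw [this]
  exact I.mul_mem_left _ hx)

theorem NZDMod.pow {I : Ideal R} {e : R} (h : NZDMod I e) (n : ℕ) : NZDMod I (e ^ n) := by
  induction n with
  | zero => intro x hx; simpa using hx
  | succ n ih => intro x hx; exact h x (ih _ (by rwa [← mul_assoc, ← pow_succ]))

theorem nzdMod_unit {I : Ideal R} {u : R} (hu : IsUnit u) : NZDMod I u := by
  have : NZDMod I (1 : R) := fun x hx => by simpa using hx
  simpa using this.unit_mul hu

/-- Exchange in a regular sequence: if `a` is regular and `b` is regular modulo `a`, then `a` is
regular modulo `b`. No noetherian or local hypothesis enters, because nothing is claimed about the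
`g i` after `e` has moved behind them. The rank fixes the order in which the `g i` are added. -/
theorem nzdMod_sup_span_image {ι : Type*} (rk : ι → ℕ) (e : R) (I : Ideal R) (g : ι → R)
    (h0 : NZDMod I e)
    (hg : ∀ (i : ι) (S : Finset ι), i ∉ S → (∀ j ∈ S, rk j ≤ rk i) →
      NZDMod (I ⊔ Ideal.span {e} ⊔ Ideal.span (g '' S)) (g i)) (S : Finset ι) :
    NZDMod (I ⊔ Ideal.span (g '' S)) e := by
  classical
  induction S using Finset.induction_on_max_value rk with
  | empty => simpa using h0
  | insert i S hi hmax ih =>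
    intro x hx
    rw [Finset.coe_insert, Set.image_insert_eq, Ideal.span_insert, sup_comm (Ideal.span {g i}),
      ← sup_assoc] at hx ⊢
    obtain ⟨a, ha, b, hb, hab⟩ := Submodule.mem_sup.1 hx
    obtain ⟨y, rfl⟩ := Ideal.mem_span_singleton'.1 hb
    have hle : I ⊔ Ideal.span (g '' (S : Set ι)) ≤
        I ⊔ Ideal.span {e} ⊔ Ideal.span (g '' (S : Set ι)) :=
      sup_le_sup_right le_sup_left _
    have he : e ∈ I ⊔ Ideal.span {e} ⊔ Ideal.span (g '' (S : Set ι)) :=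
      Ideal.mem_sup_left (Ideal.mem_sup_right (Ideal.mem_span_singleton_self e))
    -- From `e x = a + y g_i` the product `g_i y` vanishes modulo `e` and the earlier generators. So
    -- `y = e y' + d` with `d` in the ideal of the earlier generators, and `x - g_i y'` falls under
    -- the induction hypothesis.
    have hy := hg i S hi hmax y (by
      have : g i * y = e * x - a := by rw [← hab]; ring
      rw [this]
      exact Ideal.sub_mem _ (Ideal.mul_mem_right _ _ he) (hle ha))
    rw [sup_right_comm, sup_comm _ (Ideal.span {e})] at hy
    obtain ⟨c, hc, d, hd, hcd⟩ := Submodule.mem_sup.1 hy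
    obtain ⟨y', rfl⟩ := Ideal.mem_span_singleton'.1 hc
    have h1 := ih (x - g i * y') (by
      have : e * (x - g i * y') = a + d * g i := by
        linear_combination (-1 : R) * hab - g i * hcd
      rw [this]
      exact Ideal.add_mem _ ha (Ideal.mul_mem_right _ _ hd))
    have h2 : x = (x - g i * y') + g i * y' := by ring
    rw [h2]
    exact Ideal.add_mem _ (Ideal.mem_sup_left h1)
      (Ideal.mem_sup_right (Ideal.mul_mem_right _ _ (Ideal.mem_span_singleton_self _)))

theorem exists_finset_of_mem_sup_span_range {ι : Type*} {I : Ideal R} {g : ι → R} {x : R}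
    (hx : x ∈ I ⊔ Ideal.span (Set.range g)) :
    ∃ S : Finset ι, x ∈ I ⊔ Ideal.span (g '' S) := by
  classical
  obtain ⟨a, ha, b, hb, rfl⟩ := Submodule.mem_sup.1 hx
  obtain ⟨T, hT, hbT⟩ := Submodule.mem_span_finite_of_mem_span hb
  obtain ⟨S, rfl⟩ : ∃ S : Finset ι, S.image g = T := by
    rw [← Set.image_univ] at hT
    obtain ⟨S, -, h⟩ := Finset.subset_set_image_iff.1 hT
    exact ⟨S, h⟩
  refine ⟨S, Submodule.add_mem_sup ha ?_⟩
  rw [Finset.coe_image] at hbT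
  exact hbT

theorem NZDMod.span_range {ι : Type*} {e : R} {I : Ideal R} {g : ι → R}
    (h : ∀ S : Finset ι, NZDMod (I ⊔ Ideal.span (g '' S)) e) :
    NZDMod (I ⊔ Ideal.span (Set.range g)) e := fun x hx => by
  obtain ⟨S, hS⟩ := exists_finset_of_mem_sup_span_range hx
  have hle : I ⊔ Ideal.span (g '' (S : Set ι)) ≤ I ⊔ Ideal.span (Set.range g) :=
    sup_le_sup le_rfl (Ideal.span_mono (Set.image_subset_range _ _))
  exact hle (h S x hS)

end NZD

/-! ### Regularity from the leading coefficient in one variable -/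

section Lead

open MvPolynomial

variable {σ B : Type*} [CommRing B]

open Classical in
/-- The isolation of the variable `X i` as the variable of a polynomial ring. -/
noncomputable def isolate (i : σ) : MvPolynomial σ B →ₐ[B] Polynomial (MvPolynomial σ B) :=
  aeval fun j => if j = i then Polynomial.X else Polynomial.C (X j)

theorem isolate_X (i : σ) : isolate (B := B) i (X i) = Polynomial.X := by simp [isolate]

theorem isolate_of_mem_supported {i : σ} {q : MvPolynomial σ B} (hq : q ∈ supported B {i}ᶜ) :
    isolate i q = Polynomial.C q := by
  induction hq using Algebra.adjoin_induction with
  | mem x hx =>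
    obtain ⟨j, hj, rfl⟩ := hx
    have : j ≠ i := hj
    simp [isolate, this]
  | algebraMap r => simp [isolate, Polynomial.algebraMap_apply]
  | add x y _ _ hx hy => simp [hx, hy]
  | mul x y _ _ hx hy => simp [hx, hy]

/-- The coefficient ring still contains `X i`, so `isolate` is not an isomorphism; evaluation at `X
i` is only a left inverse. The other composite is the identity on polynomials with coefficients free
of `X i`, by `isolate_eval`. -/
theorem eval_isolate (i : σ) (q : MvPolynomial σ B) : (isolate i q).eval (X i) = q := by
  induction q using MvPolynomial.induction_on with
  | C a => simp [isolate, Polynomial.algebraMap_apply, MvPolynomial.algebraMap_eq]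
  | add p q hp hq => simp [hp, hq]
  | mul_X p j hp =>
    rw [map_mul, Polynomial.eval_mul, hp]
    congr 1
    by_cases h : j = i
    · subst h; simp [isolate]
    · simp [isolate, h]

theorem isolate_eval {i : σ} {H : Polynomial (MvPolynomial σ B)}
    (hH : ∀ k, H.coeff k ∈ supported B {i}ᶜ) : isolate i (H.eval (X i)) = H := by
  rw [Polynomial.eval_eq_sum_range, map_sum]
  conv_rhs => rw [H.as_sum_range_C_mul_X_pow]
  refine Finset.sum_congr rfl fun k _ => ?_
  rw [map_mul, map_pow, isolate_X, isolate_of_mem_supported (hH k)]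

/-- Generators free of `X i` are constants for the isolated variable, and an ideal generated by
constants is detected on coefficients. -/
theorem mem_span_iff_coeff_isolate {i : σ} {G : Set (MvPolynomial σ B)}
    (hG : ∀ q ∈ G, q ∈ supported B {i}ᶜ) (x : MvPolynomial σ B) :
    x ∈ Ideal.span G ↔ ∀ k, (isolate i x).coeff k ∈ Ideal.span G := by
  rw [← Ideal.mem_map_C_iff]
  constructor
  · intro hx
    have h1 := Ideal.mem_map_of_mem (isolate (B := B) i) hx
    rw [Ideal.map_span] at h1 ⊢
    refine Ideal.span_mono ?_ h1
    rintro _ ⟨q, hq, rfl⟩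
    exact ⟨q, hq, (isolate_of_mem_supported (hG q hq)).symm⟩
  · intro hx
    have h1 := Ideal.mem_map_of_mem (Polynomial.evalRingHom (X i)) hx
    rw [Ideal.map_map] at h1
    have : (Polynomial.evalRingHom (X i)).comp (Polynomial.C) =
      RingHom.id (MvPolynomial σ B) := by ext <;> simp
    rw [this, Ideal.map_id] at h1
    simpa [eval_isolate] using h1

/-- Top coefficient argument over the quotient by `G`: if `H y = 0` there, the coefficient in degree
`d + deg y` says that `h_d` kills the leading coefficient of `y`. -/
theorem nzdMod_eval_of_coeff {i : σ} {G : Set (MvPolynomial σ B)}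
    (hG : ∀ q ∈ G, q ∈ supported B {i}ᶜ) {H : Polynomial (MvPolynomial σ B)}
    (hH : ∀ k, H.coeff k ∈ supported B {i}ᶜ) {d : ℕ} (hd : H.natDegree ≤ d)
    (hlead : NZDMod (Ideal.span G) (H.coeff d)) :
    NZDMod (Ideal.span G) (H.eval (X i)) := by
  intro x hx
  rw [mem_span_iff_coeff_isolate hG] at hx ⊢
  rw [map_mul, isolate_eval hH] at hx
  set y := isolate i x
  set π := Ideal.Quotient.mk (Ideal.span G)
  have h0 : H.map π * y.map π = 0 := by
    rw [← Polynomial.map_mul]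
    ext k
    rw [Polynomial.coeff_map, Polynomial.coeff_zero, Ideal.Quotient.eq_zero_iff_mem]
    exact hx k
  suffices y.map π = 0 by
    intro k
    rw [← Ideal.Quotient.eq_zero_iff_mem, ← Polynomial.coeff_map, this, Polynomial.coeff_zero]
  by_contra hne
  apply hne
  rw [← Polynomial.leadingCoeff_eq_zero, Polynomial.leadingCoeff]
  set m := (y.map π).natDegree
  have h1 := Polynomial.coeff_mul_add_eq_of_natDegree_le
    (Polynomial.natDegree_map_le.trans hd : (H.map π).natDegree ≤ d)
    (le_refl m : (y.map π).natDegree ≤ m)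
  rw [h0, Polynomial.coeff_zero, Polynomial.coeff_map, Polynomial.coeff_map, ← map_mul] at h1
  rw [Polynomial.coeff_map]
  exact Ideal.Quotient.eq_zero_iff_mem.2 (hlead _ (Ideal.Quotient.eq_zero_iff_mem.1 h1.symm))

theorem nzdMod_map_C {I : Ideal B} {b : B} (h : NZDMod I b) :
    NZDMod (I.map (C : B →+* MvPolynomial σ B)) (C b) := by
  intro x hx
  rw [MvPolynomial.mem_map_C_iff] at hx ⊢
  intro m
  exact h _ (by simpa using hx m)

end Lead

end PrismaticEnvelope

namespace PrismaticEnvelope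

/-! ### Frobenius lifts and `δ`-structures on `p`-torsion free rings -/

section Lift

variable {p : ℕ} {T : Type*} [CommRing T]

theorem mul_divP {x : T} (h : (p : T) ∣ x) : (p : T) * divP p x = x := by
  rw [divP, dif_pos h, ← h.choose_spec]

theorem dvd_frob_sub_pow_add (hp : p.Prime) {T' : Type*} [CommRing T'] (ψ : T →+* T')
    (ι : T →+* T') {x y : T} (hx : (p : T') ∣ ψ x - ι x ^ p) (hy : (p : T') ∣ ψ y - ι y ^ p) :
    (p : T') ∣ ψ (x + y) - ι (x + y) ^ p := by
  obtain ⟨r, hr⟩ := exists_add_pow_prime_eq hp (ι x) (ι y)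
  have : ψ (x + y) - ι (x + y) ^ p =
      (ψ x - ι x ^ p) + (ψ y - ι y ^ p) - p * (ι x * ι y * r) := by
    rw [map_add, map_add, hr]; ring
  rw [this]
  exact dvd_sub (dvd_add hx hy) (dvd_mul_right _ _)

theorem dvd_frob_sub_pow_mul {T' : Type*} [CommRing T'] (ψ : T →+* T')
    (ι : T →+* T') {x y : T} (hx : (p : T') ∣ ψ x - ι x ^ p) (hy : (p : T') ∣ ψ y - ι y ^ p) :
    (p : T') ∣ ψ (x * y) - ι (x * y) ^ p := by
  have : ψ (x * y) - ι (x * y) ^ p =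
      (ψ x - ι x ^ p) * ψ y + ι x ^ p * (ψ y - ι y ^ p) := by
    rw [map_mul, map_mul]; ring
  rw [this]
  exact dvd_add (Dvd.dvd.mul_right hx _) (Dvd.dvd.mul_left hy _)

theorem natCast_mul_choose_div (hp : p.Prime) {i : ℕ} (hi : i ∈ Finset.Ioo 0 p) :
    p * (p.choose i / p) = p.choose i := by
  rw [Finset.mem_Ioo] at hi
  exact Nat.mul_div_cancel' (hp.dvd_choose_self hi.1.ne' hi.2)

theorem add_pow_eq_add_sum_Ioo (hp : p.Prime) (x y : T) :
    (x + y) ^ p = x ^ p + y ^ p + (p : T) *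
      ∑ i ∈ Finset.Ioo 0 p, ((p.choose i / p : ℕ) : T) * x ^ i * y ^ (p - i) := by
  rw [add_pow, Finset.sum_range_succ, Finset.range_eq_Ico, Finset.sum_eq_sum_Ico_succ_bot hp.pos,
    Finset.mul_sum]
  have h1 : Finset.Ico (0 + 1) p = Finset.Ioo 0 p := by ext; simp [Nat.succ_le_iff]
  have h2 : ∑ k ∈ Finset.Ioo 0 p, x ^ k * y ^ (p - k) * (p.choose k : T) =
      ∑ i ∈ Finset.Ioo 0 p, (p : T) * (((p.choose i / p : ℕ) : T) * x ^ i * y ^ (p - i)) := by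
    refine Finset.sum_congr rfl fun i hi => ?_
    rw [← natCast_mul_choose_div hp hi, Nat.mul_div_cancel_left _ hp.pos]
    push_cast
    ring
  rw [h1, h2]
  simp
  ring

/-- The `δ`-structure of a Frobenius lift on a `p`-torsion free ring. -/
noncomputable def deltaOfLift (hp : p.Prime) (htf : ∀ x : T, (p : T) * x = 0 → x = 0)
    (ψ : T →+* T) (hψ : IsFrobeniusLift p ψ) : DeltaStructure p T :=
  have hcancel : ∀ x y : T, (p : T) * x = p * y → x = y := fun x y h =>
    sub_eq_zero.1 (htf _ (by rw [mul_sub, h, sub_self]))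
  have hδ : ∀ x, (p : T) * divP p (ψ x - x ^ p) = ψ x - x ^ p := fun x => mul_divP (hψ x)
  { δ := fun x => divP p (ψ x - x ^ p)
    map_zero := hcancel _ _ (by rw [hδ]; simp [hp.ne_zero])
    map_one := hcancel _ _ (by rw [hδ]; simp)
    map_mul := fun x y => hcancel _ _ (by
      have h1 := hδ x
      have h2 := hδ y
      have h3 := hδ (x * y)
      rw [map_mul] at h3
      rw [map_mul, h3]
      have e1 : ψ x = x ^ p + p * divP p (ψ x - x ^ p) := by rw [h1]; ring
      have e2 : ψ y = y ^ p + p * divP p (ψ y - y ^ p) := by rw [h2]; ring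
      generalize divP p (ψ x - x ^ p) = dx at *
      generalize divP p (ψ y - y ^ p) = dy at *
      rw [e1, e2]
      ring)
    map_add := fun x y => hcancel _ _ (by
      rw [hδ, mul_sub, mul_add, hδ, hδ, map_add, add_pow_eq_add_sum_Ioo hp]
      ring) }

theorem deltaOfLift_spec (hp : p.Prime) (htf : ∀ x : T, (p : T) * x = 0 → x = 0)
    (ψ : T →+* T) (hψ : IsFrobeniusLift p ψ) (x : T) :
    (p : T) * (deltaOfLift hp htf ψ hψ).δ x = ψ x - x ^ p := mul_divP (hψ x)

theorem deltaOfLift_frob (hp : p.Prime) (htf : ∀ x : T, (p : T) * x = 0 → x = 0)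
    (ψ : T →+* T) (hψ : IsFrobeniusLift p ψ) (x : T) :
    (deltaOfLift hp htf ψ hψ).frob x = ψ x := by
  rw [DeltaStructure.frob, deltaOfLift_spec]; ring

end Lift

/-! ### The free `δ`-algebra -/

section Free

open MvPolynomial

variable {p : ℕ} {B : Type*} [CommRing B] {φ : B →+* B} {C : Type*}

theorem freeFrob_C (b : B) : freeFrob p φ C (MvPolynomial.C b) = MvPolynomial.C (φ b) := by
  simp [freeFrob]

theorem freeFrob_X (c : C × ℕ) : freeFrob p φ C (X c) = X c ^ p + (p : MvPolynomial _ B) *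
    X (c.1, c.2 + 1) := by
  simp [freeFrob]

theorem isFrobeniusLift_freeFrob (hp : p.Prime) (hφ : IsFrobeniusLift p φ) :
    IsFrobeniusLift p (freeFrob p φ C) := by
  intro x
  induction x using MvPolynomial.induction_on with
  | C a =>
    obtain ⟨b, hb⟩ := hφ a
    rw [freeFrob_C, ← map_pow, ← map_sub, hb, map_mul, map_natCast]
    exact dvd_mul_right _ _
  | add x y hx hy => exact dvd_frob_sub_pow_add hp _ (RingHom.id _) hx hy
  | mul_X x i hx =>
    refine dvd_frob_sub_pow_mul _ (RingHom.id _) hx ?_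
    rw [freeFrob_X, RingHom.id_apply, add_sub_cancel_left]
    exact dvd_mul_right _ _

theorem mvPolynomial_natCast_torsionFree {σ : Type*} (htf : ∀ b : B, (p : B) * b = 0 → b = 0)
    (x : MvPolynomial σ B) (h : (p : MvPolynomial σ B) * x = 0) : x = 0 := by
  ext m
  refine htf _ ?_
  rw [← MvPolynomial.coeff_C_mul, map_natCast, h, MvPolynomial.coeff_zero]

/-- The `δ`-structure of the free `δ`-algebra. -/
noncomputable def freeDeltaStructure (C : Type*) (hp : p.Prime)
    (htf : ∀ b : B, (p : B) * b = 0 → b = 0)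
    (hφ : IsFrobeniusLift p φ) : DeltaStructure p (MvPolynomial (C × ℕ) B) :=
  deltaOfLift hp (mvPolynomial_natCast_torsionFree htf) (freeFrob p φ C)
    (isFrobeniusLift_freeFrob hp hφ)

theorem freeDelta_eq (hp : p.Prime) (htf : ∀ b : B, (p : B) * b = 0 → b = 0)
    (hφ : IsFrobeniusLift p φ) (x : MvPolynomial (C × ℕ) B) :
    freeDelta p φ C x = (freeDeltaStructure C hp htf hφ).δ x := rfl

theorem natCast_mul_freeDelta (hp : p.Prime) (hφ : IsFrobeniusLift p φ)
    (x : MvPolynomial (C × ℕ) B) :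
    (p : MvPolynomial (C × ℕ) B) * freeDelta p φ C x = freeFrob p φ C x - x ^ p :=
  mul_divP (isFrobeniusLift_freeFrob hp hφ x)

theorem freeDelta_X (hp : p.Prime) (htf : ∀ b : B, (p : B) * b = 0 → b = 0)
    (hφ : IsFrobeniusLift p φ) (c : C × ℕ) :
    freeDelta p φ C (X c) = X (c.1, c.2 + 1) := by
  refine sub_eq_zero.1 (mvPolynomial_natCast_torsionFree (p := p) htf _ ?_)
  rw [mul_sub, natCast_mul_freeDelta hp hφ, freeFrob_X]
  ring

theorem freeDelta_C (hp : p.Prime) (htf : ∀ b : B, (p : B) * b = 0 → b = 0)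
    (hφ : IsFrobeniusLift p φ) {b w : B} (hb : φ b = b ^ p + p * w) :
    freeDelta p φ C (MvPolynomial.C b) = MvPolynomial.C w := by
  refine sub_eq_zero.1 (mvPolynomial_natCast_torsionFree (p := p) htf _ ?_)
  rw [mul_sub, natCast_mul_freeDelta hp hφ, freeFrob_C, hb]
  simp

variable (B) in
/-- The polynomials in the `δⁱ(z_c)`, `i < n`. -/
noncomputable abbrev lowerVars (c : C) (n : ℕ) : Subalgebra B (MvPolynomial (C × ℕ) B) :=
  supported B {j : C × ℕ | j.1 = c ∧ j.2 < n}

theorem lowerVars_mono (c : C) {m n : ℕ} (h : m ≤ n) : lowerVars B c m ≤ lowerVars B c n :=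
  supported_mono fun _ hj => ⟨hj.1, hj.2.trans_le h⟩

theorem X_mem_lowerVars (c : C) {m n : ℕ} (h : m < n) :
    (X (c, m) : MvPolynomial (C × ℕ) B) ∈ lowerVars B c n :=
  Algebra.subset_adjoin ⟨(c, m), ⟨rfl, h⟩, rfl⟩

theorem C_mem_lowerVars (c : C) (n : ℕ) (b : B) :
    (MvPolynomial.C b : MvPolynomial (C × ℕ) B) ∈ lowerVars B c n :=
  (lowerVars B c n).algebraMap_mem b

/-- Modulo `p` the product rule for `δ` is that of a derivation twisted by Frobenius, and the
correction in `δ(x + y)` brings in no new variable. So the new variable `δⁿ(z_c)` occurs only to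
first order modulo `p`. -/
theorem freeDelta_mem_lowerVars (hp : p.Prime) (htf : ∀ b : B, (p : B) * b = 0 → b = 0)
    (hφ : IsFrobeniusLift p φ) {c : C} {n : ℕ} {q : MvPolynomial (C × ℕ) B}
    (hq : q ∈ lowerVars B c n) :
    freeDelta p φ C q ∈ lowerVars B c (n + 1) ∧ ∃ r ∈ lowerVars B c n, ∃ s ∈ lowerVars B c n,
      ∃ t, freeDelta p φ C q = r * X (c, n) + s + (p : MvPolynomial (C × ℕ) B) * t := by
  have hle := lowerVars_mono (B := B) c n.le_succ
  have hnat : ∀ (a n : ℕ), (a : MvPolynomial (C × ℕ) B) ∈ lowerVars B c n :=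
    fun a n => natCast_mem _ a
  induction hq using Algebra.adjoin_induction with
  | mem x hx =>
    obtain ⟨⟨c', i⟩, ⟨rfl, hi : i < n⟩, rfl⟩ := hx
    rw [freeDelta_X hp htf hφ]
    refine ⟨X_mem_lowerVars _ (by omega), ?_⟩
    rcases (Nat.succ_le_iff.2 hi).lt_or_eq with h | h
    · exact ⟨0, zero_mem _, X (c', i + 1), X_mem_lowerVars _ h, 0, by simp⟩
    · exact ⟨1, one_mem _, 0, zero_mem _, 0, by simp [← h]⟩
  | algebraMap b =>
    obtain ⟨w, hw⟩ := hφ b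
    rw [MvPolynomial.algebraMap_eq,
      freeDelta_C hp htf hφ (w := w) (by rw [← hw]; ring)]
    exact ⟨C_mem_lowerVars _ _ _, 0, zero_mem _, _, C_mem_lowerVars _ _ w, 0, by simp⟩
  | add x y hx hy ihx ihy =>
    obtain ⟨hx1, r, hr, s, hs, t, h1⟩ := ihx
    obtain ⟨hy1, r', hr', s', hs', t', h2⟩ := ihy
    have hsum : ∀ m, n ≤ m → ∑ i ∈ Finset.Ioo 0 p, ((p.choose i / p : ℕ) :
        MvPolynomial (C × ℕ) B) * x ^ i * y ^ (p - i) ∈ lowerVars B c m := fun m hm =>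
      sum_mem fun i _ => mul_mem (mul_mem (hnat _ _) (pow_mem (lowerVars_mono c hm hx) _))
        (pow_mem (lowerVars_mono c hm hy) _)
    rw [freeDelta_eq hp htf hφ, DeltaStructure.map_add, ← freeDelta_eq, ← freeDelta_eq]
    refine ⟨sub_mem (add_mem hx1 hy1) (hsum _ n.le_succ), r + r', add_mem hr hr', _,
      sub_mem (add_mem hs hs') (hsum n le_rfl), t + t', ?_⟩
    rw [h1, h2]
    ring
  | mul x y hx hy ihx ihy =>
    obtain ⟨hx1, r, hr, s, hs, t, h1⟩ := ihx
    obtain ⟨hy1, r', hr', s', hs', t', h2⟩ := ihy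
    rw [freeDelta_eq hp htf hφ, DeltaStructure.map_mul, ← freeDelta_eq, ← freeDelta_eq]
    refine ⟨add_mem (add_mem (mul_mem (pow_mem (hle hx) _) hy1)
      (mul_mem (pow_mem (hle hy) _) hx1)) (mul_mem (mul_mem (hnat _ _) hx1) hy1),
      x ^ p * r' + y ^ p * r, add_mem (mul_mem (pow_mem hx _) hr') (mul_mem (pow_mem hy _) hr),
      x ^ p * s' + y ^ p * s, add_mem (mul_mem (pow_mem hx _) hs') (mul_mem (pow_mem hy _) hs),
      x ^ p * t' + y ^ p * t + freeDelta p φ C x * freeDelta p φ C y, ?_⟩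
    rw [mul_assoc (p : MvPolynomial (C × ℕ) B) (freeDelta p φ C x)]
    generalize freeDelta p φ C x * freeDelta p φ C y = d
    rw [h1, h2]
    ring

/-- The passage from one relation to the next, with `b = φⁿ(E)` and `w = δ(b)`. The product rule
`δ(bX) = b^p δ(X) + w X^p + p w δ(X)` gives the new variable the coefficient `b^p + p w = φ(b)`, and
the term `w X^p` is what remains of it modulo `(p, b)`. -/
theorem freeDelta_linear (hp : p.Prime) (htf : ∀ b : B, (p : B) * b = 0 → b = 0)
    (hφ : IsFrobeniusLift p φ) {c : C} {n : ℕ} {q : MvPolynomial (C × ℕ) B}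
    (hq : q ∈ lowerVars B c n) {b w : B} (hb : φ b = b ^ p + p * w) :
    ∃ q' ∈ lowerVars B c (n + 1), freeDelta p φ C (MvPolynomial.C b * X (c, n) + q) =
        MvPolynomial.C (φ b) * X (c, n + 1) + q' ∧
      ∃ r ∈ lowerVars B c n, ∃ s ∈ lowerVars B c n, ∃ t t',
        q' = MvPolynomial.C w * X (c, n) ^ p + r * X (c, n) + s +
          (p : MvPolynomial (C × ℕ) B) * t + MvPolynomial.C b * t' := by
  have hle := lowerVars_mono (B := B) c n.le_succ
  obtain ⟨hq1, r, hr, s, hs, t, h1⟩ := freeDelta_mem_lowerVars hp htf hφ hq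
  have hX : (X (c, n) : MvPolynomial (C × ℕ) B) ∈ lowerVars B c (n + 1) :=
    X_mem_lowerVars _ n.lt_succ_self
  -- Every cross term of `δ(bX + q)` contains `bX` with exponent `i ≥ 1`, so one factor `b` splits
  -- off; the remaining sum is the last witness.
  refine ⟨MvPolynomial.C w * X (c, n) ^ p + freeDelta p φ C q -
    ∑ i ∈ Finset.Ioo 0 p, ((p.choose i / p : ℕ) : MvPolynomial (C × ℕ) B) *
      (MvPolynomial.C b * X (c, n)) ^ i * q ^ (p - i), ?_, ?_, r, hr, s, hs, t,
    -∑ i ∈ Finset.Ioo 0 p, ((p.choose i / p : ℕ) : MvPolynomial (C × ℕ) B) *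
      (MvPolynomial.C b ^ (i - 1) * X (c, n) ^ i) * q ^ (p - i), ?_⟩
  · refine sub_mem (add_mem (mul_mem (C_mem_lowerVars _ _ _) (pow_mem hX _)) hq1)
      (sum_mem fun i _ => mul_mem (mul_mem (natCast_mem _ _) (pow_mem (mul_mem
        (C_mem_lowerVars _ _ _) hX) _)) (pow_mem (hle hq) _))
  · rw [freeDelta_eq hp htf hφ, DeltaStructure.map_add, DeltaStructure.map_mul,
      ← freeDelta_eq, ← freeDelta_eq, ← freeDelta_eq, freeDelta_X hp htf hφ,
      freeDelta_C hp htf hφ hb, hb, map_add, map_mul, map_pow, map_natCast]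
    ring
  · rw [h1, mul_neg, Finset.mul_sum, sub_eq_add_neg]
    congr 1
    · ring
    · congr 1
      refine Finset.sum_congr rfl fun i hi => ?_
      rw [mul_pow, ← mul_pow_sub_one (Finset.mem_Ioo.1 hi).1.ne' (MvPolynomial.C b)]
      ring

end Free

end PrismaticEnvelope

namespace PrismaticEnvelope

/-! ### Regularity of `E, p` on the `δ`-envelope -/

theorem sup_span_image_congr {R ι : Type*} [CommRing R] {I : Ideal R} {S : Set ι} {g g' : ι → R}
    (h : ∀ j ∈ S, g j - g' j ∈ I) : I ⊔ Ideal.span (g '' S) = I ⊔ Ideal.span (g' '' S) := by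
  have key : ∀ {g g' : ι → R}, (∀ j ∈ S, g j - g' j ∈ I) →
      I ⊔ Ideal.span (g '' S) ≤ I ⊔ Ideal.span (g' '' S) := by
    intro g g' h
    refine sup_le le_sup_left (Ideal.span_le.2 ?_)
    rintro _ ⟨j, hj, rfl⟩
    have : g j = (g j - g' j) + g' j := by ring
    rw [SetLike.mem_coe, this]
    exact Submodule.add_mem_sup (h j hj) (Ideal.subset_span ⟨j, hj, rfl⟩)
  refine le_antisymm (key h) (key fun j hj => ?_)
  rw [← neg_sub]
  exact I.neg_mem (h j hj)

/-- The hypotheses on a ring `B` with a Frobenius lift `φ`, an element `E` and a family `y`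
under which the `δ`-envelope `B{y/E}` is well behaved. -/
structure EnvHyp (p : ℕ) {B : Type*} [CommRing B] (φ : B →+* B) {C : Type*} (E : B)
    (y : C → B) : Prop where
  prime : p.Prime
  torsionFree : ∀ b : B, (p : B) * b = 0 → b = 0
  frobeniusLift : IsFrobeniusLift p φ
  jacobson : (p : B) ∈ Ideal.jacobson (⊥ : Ideal B)
  distinguished : ∃ ε, IsUnit ε ∧ φ E = E ^ p + p * ε
  nzd_E : NZDMod (⊥ : Ideal B) E
  nzd_p : NZDMod (Ideal.span {E}) (p : B)
  nzd_y : ∀ (S : Finset C) (c : C), c ∉ S → NZDMod (Ideal.span {E} ⊔ Ideal.span (y '' S)) (y c)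
  nzd_y_mod_p : ∀ (S : Finset C) (c : C), c ∉ S →
    NZDMod (Ideal.span {E} ⊔ Ideal.span {(p : B)} ⊔ Ideal.span (y '' S)) (y c)

namespace EnvHyp

open MvPolynomial

variable {p : ℕ} {B : Type*} [CommRing B] {φ : B →+* B} {C : Type*} {E : B} {y : C → B}

theorem isUnit_add_natCast_mul (H : EnvHyp p φ E y) {u : B} (hu : IsUnit u) (x : B) :
    IsUnit (u + p * x) := by
  obtain ⟨v, hv⟩ := hu.exists_right_inv
  have h1 : IsUnit ((p : B) * (x * v) + 1) := Ideal.mem_jacobson_bot.1 H.jacobson _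
  have : u + p * x = u * (p * (x * v) + 1) := by linear_combination (-(p : B) * x) * hv
  rw [this]
  exact hu.mul h1

/-- Frobenius is applied repeatedly to `φ(E) = E^p + p ε`; the units are the `φⁿ(ε)`. -/
theorem iterate_succ (H : EnvHyp p φ E y) (n : ℕ) :
    ∃ w, IsUnit w ∧ φ (φ^[n] E) = (φ^[n] E) ^ p + p * w := by
  induction n with
  | zero => exact H.distinguished
  | succ n ih =>
    obtain ⟨w, hw, h⟩ := ih
    refine ⟨φ w, hw.map φ, ?_⟩
    rw [Function.iterate_succ_apply', h, map_add, map_mul, map_pow, map_natCast, h]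

/-- Says that `φⁿ⁺¹(E)` is `p` times a unit modulo `E`, which makes `p` the leading coefficient of
all relations of positive index once `E` is killed. -/
theorem iterate_eq (H : EnvHyp p φ E y) (n : ℕ) :
    ∃ v a, IsUnit v ∧ φ^[n + 1] E = p * v + E ^ p * a := by
  induction n with
  | zero =>
    obtain ⟨ε, hε, h⟩ := H.distinguished
    exact ⟨ε, 1, hε, by simp [h, add_comm]⟩
  | succ n ih =>
    obtain ⟨v, a, hv, h⟩ := ih
    obtain ⟨w, hw, h'⟩ := H.iterate_succ (n + 1)
    obtain ⟨b, hb⟩ : E ^ p ∣ (p * v + E ^ p * a) ^ p - (p * v) ^ p := by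
      have := sub_dvd_pow_sub_pow (p * v + E ^ p * a) (p * v) p
      rw [add_sub_cancel_left] at this
      exact (dvd_mul_right _ _).trans this
    -- As `p ≥ 2`, the power `(p v)^p` is divisible by `p²`, so it changes the unit `w` only by a
    -- multiple of `p`, which lies in the Jacobson radical.
    obtain ⟨q, hq⟩ : ∃ q, p = q + 2 := ⟨p - 2, by have := H.prime.two_le; omega⟩
    refine ⟨w + p * ((p : B) ^ q * v ^ p), b, H.isUnit_add_natCast_mul hw _, ?_⟩
    have h3 : (p : B) ^ p = p * (p * p ^ q) := by
      rw [← pow_succ', ← pow_succ', ← hq]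
    rw [Function.iterate_succ_apply', h', h, ← hb, mul_pow, h3]
    ring

/-- The generators `δⁿ(E z_c - y_c)` of the `δ`-ideal of relations. -/
noncomputable def _root_.PrismaticEnvelope.rel (p : ℕ) (φ : B →+* B) (E : B) (y : C → B)
    (cn : C × ℕ) : MvPolynomial (C × ℕ) B :=
  (freeDelta p φ C)^[cn.2] (MvPolynomial.C E * X (cn.1, 0) - MvPolynomial.C (y cn.1))

theorem rel_zero (c : C) : rel p φ E y (c, 0) =
    MvPolynomial.C E * X (c, 0) - MvPolynomial.C (y c) := rfl

theorem rel_succ (c : C) (n : ℕ) :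
    rel p φ E y (c, n + 1) = freeDelta p φ C (rel p φ E y (c, n)) :=
  Function.iterate_succ_apply' _ _ _

theorem exists_rel_eq (H : EnvHyp p φ E y) (c : C) (n : ℕ) :
    ∃ q ∈ lowerVars B c n, rel p φ E y (c, n) = MvPolynomial.C (φ^[n] E) * X (c, n) + q := by
  induction n with
  | zero => exact ⟨-MvPolynomial.C (y c), neg_mem (C_mem_lowerVars _ _ _), by
      rw [rel_zero, sub_eq_add_neg]; rfl⟩
  | succ n ih =>
    obtain ⟨q, hq, h⟩ := ih
    obtain ⟨w, hw, h'⟩ := H.iterate_succ n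
    obtain ⟨q', hq', h1, -⟩ := freeDelta_linear H.prime H.torsionFree H.frobeniusLift hq h'
    exact ⟨q', hq', by rw [rel_succ, h, h1, Function.iterate_succ_apply']⟩

theorem iterate_mem (H : EnvHyp p φ E y) (n : ℕ) :
    φ^[n] E ∈ Ideal.span {E} ⊔ Ideal.span {(p : B)} := by
  cases n with
  | zero => exact Ideal.mem_sup_left (Ideal.mem_span_singleton_self _)
  | succ n =>
    obtain ⟨v, a, -, h⟩ := H.iterate_eq n
    rw [h, add_comm]
    exact Submodule.add_mem_sup (Ideal.mul_mem_right _ _ (Ideal.pow_mem_of_mem _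
      (Ideal.mem_span_singleton_self _) _ H.prime.pos))
      (Ideal.mul_mem_right _ _ (Ideal.mem_span_singleton_self _))

/-- Modulo `(p, E)` the coefficient `φⁿ⁺¹(E)` of `δⁿ⁺¹(z_c)` dies. The leading variable drops to
`δⁿ(z_c)`, in degree `p` and with the unit `w = δ(φⁿ(E))` as coefficient; this is why the indices
differ by one. -/
theorem exists_rel_sub_mem (H : EnvHyp p φ E y) (c : C) (n : ℕ) :
    ∃ w, IsUnit w ∧ ∃ r ∈ lowerVars B c n, ∃ s ∈ lowerVars B c n,
      rel p φ E y (c, n + 1) - (MvPolynomial.C w * X (c, n) ^ p + r * X (c, n) + s) ∈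
        Ideal.span {MvPolynomial.C E} ⊔ Ideal.span {(p : MvPolynomial (C × ℕ) B)} := by
  obtain ⟨q, hq, h⟩ := H.exists_rel_eq c n
  obtain ⟨w, hw, h'⟩ := H.iterate_succ n
  obtain ⟨q', hq', h1, r, hr, s, hs, t, t', h2⟩ :=
    freeDelta_linear H.prime H.torsionFree H.frobeniusLift hq h'
  have hC : ∀ n, (MvPolynomial.C (φ^[n] E) : MvPolynomial (C × ℕ) B) ∈
      Ideal.span {MvPolynomial.C E} ⊔ Ideal.span {(p : MvPolynomial (C × ℕ) B)} := fun n => by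
    have := Ideal.mem_map_of_mem (MvPolynomial.C : B →+* MvPolynomial (C × ℕ) B) (H.iterate_mem n)
    rwa [Ideal.map_sup, Ideal.map_span, Ideal.map_span, Set.image_singleton, Set.image_singleton,
      map_natCast] at this
  refine ⟨w, hw, r, hr, s, hs, ?_⟩
  have : rel p φ E y (c, n + 1) - (MvPolynomial.C w * X (c, n) ^ p + r * X (c, n) + s) =
      MvPolynomial.C (φ^[n + 1] E) * X (c, n + 1) +
        (p : MvPolynomial (C × ℕ) B) * t + MvPolynomial.C (φ^[n] E) * t' := by
    rw [rel_succ, h, h1, h2, Function.iterate_succ_apply']; ring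
  rw [this]
  exact add_mem (add_mem (Ideal.mul_mem_right _ _ (hC _)) (Ideal.mul_mem_right _ _
    (Ideal.mem_sup_right (Ideal.mem_span_singleton_self _)))) (Ideal.mul_mem_right _ _ (hC _))

theorem lowerVars_le_supported_compl {i j : C × ℕ} {m : ℕ} (h : j.1 = i.1 → m ≤ i.2) :
    lowerVars B j.1 m ≤ supported B {i}ᶜ := by
  refine supported_mono ?_
  rintro k ⟨hk1, hk2⟩ (rfl : k = i)
  exact absurd (h hk1.symm) (by omega)

theorem X_mem_supported_compl {i j : C × ℕ} (h : j ≠ i) :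
    (X j : MvPolynomial (C × ℕ) B) ∈ supported B {i}ᶜ :=
  Algebra.subset_adjoin ⟨j, h, rfl⟩

theorem C_mem_supported (s : Set (C × ℕ)) (b : B) :
    (MvPolynomial.C b : MvPolynomial (C × ℕ) B) ∈ supported B s :=
  (supported B s).algebraMap_mem b

theorem span_image_C_eq (I : Ideal B) (S : Finset (C × ℕ)) :
    ∃ S' : Finset C, (∀ c, c ∈ S' ↔ ∃ j ∈ S, j.1 = c) ∧
    I.map (MvPolynomial.C : B →+* MvPolynomial (C × ℕ) B) ⊔
      Ideal.span ((fun j : C × ℕ => -MvPolynomial.C (y j.1)) '' (S : Set (C × ℕ))) =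
      (I ⊔ Ideal.span (y '' (S' : Set C))).map MvPolynomial.C := by
  classical
  refine ⟨S.image Prod.fst, by simp, ?_⟩
  rw [Ideal.map_sup, Ideal.map_span]
  congr 1
  refine le_antisymm (Ideal.span_le.2 ?_) (Ideal.span_le.2 ?_)
  · rintro _ ⟨j, hj, rfl⟩
    exact Submodule.neg_mem _
      (Ideal.subset_span ⟨_, ⟨j.1, by simpa using ⟨j.2, hj⟩, rfl⟩, rfl⟩)
  · rintro _ ⟨_, ⟨c, hc, rfl⟩, rfl⟩
    obtain ⟨j, hj, rfl⟩ := Finset.mem_image.1 hc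
    rw [SetLike.mem_coe, ← neg_neg (MvPolynomial.C (y j.1))]
    exact Submodule.neg_mem _ (Ideal.subset_span ⟨j, hj, rfl⟩)

theorem map_C_span_sup (E : B) (p : ℕ) :
    (Ideal.span {E} ⊔ Ideal.span {(p : B)}).map
      (MvPolynomial.C : B →+* MvPolynomial (C × ℕ) B) =
    Ideal.span {MvPolynomial.C E} ⊔ Ideal.span {(p : MvPolynomial (C × ℕ) B)} := by
  rw [Ideal.map_sup, Ideal.map_span, Ideal.map_span, Set.image_singleton, Set.image_singleton,
    map_natCast]

/-- Once `E` is killed the relations of index `0` are the `-y_c`, whose regularity is assumed. -/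
theorem nzdMod_rel_zero {I : Ideal B} (hE : E ∈ I)
    (hy : ∀ (S : Finset C) (c : C), c ∉ S → NZDMod (I ⊔ Ideal.span (y '' S)) (y c))
    {c : C} {S : Finset (C × ℕ)} (hc : (c, 0) ∉ S) (hS : ∀ j ∈ S, j.2 ≤ 0) :
    NZDMod (I.map (MvPolynomial.C : B →+* MvPolynomial (C × ℕ) B) ⊔
      Ideal.span (rel p φ E y '' S)) (rel p φ E y (c, 0)) := by
  have hrel : ∀ c, rel p φ E y (c, 0) - -MvPolynomial.C (y c) ∈
      I.map (MvPolynomial.C : B →+* MvPolynomial (C × ℕ) B) := fun c => by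
    have : rel p φ E y (c, 0) - -MvPolynomial.C (y c) = MvPolynomial.C E * X (c, 0) := by
      rw [rel_zero]; ring
    rw [this]
    exact Ideal.mul_mem_right _ _ (Ideal.mem_map_of_mem _ hE)
  rw [sup_span_image_congr (g' := fun j : C × ℕ => -MvPolynomial.C (y j.1))]
  · obtain ⟨S', hS', heq⟩ := span_image_C_eq (y := y) I S
    have h1 := nzdMod_map_C (σ := C × ℕ) (hy S' c (by
      rw [hS']
      rintro ⟨⟨c', n⟩, hj, rfl⟩
      obtain rfl : n = 0 := Nat.le_zero.1 (hS _ hj)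
      exact hc hj))
    rw [← heq] at h1
    have h2 := h1.unit_mul (isUnit_one.neg)
    refine h2.of_sub_mem (Ideal.mem_sup_left ?_)
    rw [neg_one_mul, ← neg_sub]
    exact Submodule.neg_mem _ (hrel c)
  · rintro ⟨c', n⟩ hj
    obtain rfl : n = 0 := Nat.le_zero.1 (hS _ hj)
    exact hrel c'

/-- A relation of index `n + 1` has unit leading coefficient in its own variable `δⁿ(z_c)`, which
the relations preceding it do not contain modulo `(p, E)`. -/
theorem nzdMod_rel_mod_p (H : EnvHyp p φ E y) (i : C × ℕ) (S : Finset (C × ℕ)) (hi : i ∉ S)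
    (hS : ∀ j ∈ S, j.2 ≤ i.2) :
    NZDMod (Ideal.span {MvPolynomial.C E} ⊔ Ideal.span {(p : MvPolynomial (C × ℕ) B)} ⊔
      Ideal.span (rel p φ E y '' S)) (rel p φ E y i) := by
  classical
  obtain ⟨c, n⟩ := i
  cases n with
  | zero =>
    rw [← map_C_span_sup]
    exact nzdMod_rel_zero (Ideal.mem_sup_left (Ideal.mem_span_singleton_self _))
      H.nzd_y_mod_p hi hS
  | succ n =>
    obtain ⟨w, hw, r, hr, s, hs, h⟩ := H.exists_rel_sub_mem c n
    -- The earlier generators are replaced by their reductions modulo `(p, E)`. These avoid `X (c,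
    -- n)` because `c' ≠ c` or `n' < n`.
    have hj : ∀ j ∈ S, ∃ g ∈ supported B {(c, n)}ᶜ, rel p φ E y j - g ∈
        Ideal.span {MvPolynomial.C E} ⊔ Ideal.span {(p : MvPolynomial (C × ℕ) B)} := by
      rintro ⟨c', n'⟩ hj
      cases n' with
      | zero =>
        refine ⟨-MvPolynomial.C (y c'), neg_mem (C_mem_supported _ _), ?_⟩
        have : rel p φ E y (c', 0) - -MvPolynomial.C (y c') = MvPolynomial.C E * X (c', 0) := by
          rw [rel_zero]; ring
        rw [this]
        exact Ideal.mul_mem_right _ _ (Ideal.mem_sup_left (Ideal.mem_span_singleton_self _))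
      | succ n' =>
        obtain ⟨w', hw', r', hr', s', hs', h'⟩ := H.exists_rel_sub_mem c' n'
        have hne : (c', n') ≠ (c, n) := fun hh => hi (by
          obtain ⟨rfl, rfl⟩ := Prod.mk.inj hh
          exact hj)
        have hle := lowerVars_le_supported_compl (B := B) (i := (c, n)) (j := (c', n')) (m := n')
          (fun _ => by have := hS _ hj; simp at this; exact this)
        exact ⟨_, add_mem (add_mem (mul_mem (C_mem_supported _ _)
          (pow_mem (X_mem_supported_compl hne) _)) (mul_mem (hle hr')
          (X_mem_supported_compl hne))) (hle hs'), h'⟩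
    choose! g hg1 hg2 using hj
    rw [sup_span_image_congr (fun j hj => hg2 j hj), ← Ideal.span_union, ← Ideal.span_union]
    have hle := lowerVars_le_supported_compl (B := B) (i := (c, n)) (j := (c, n)) (m := n)
          (fun _ => le_rfl)
    have key := nzdMod_eval_of_coeff (B := B) (i := (c, n))
      (G := {MvPolynomial.C E} ∪ {(p : MvPolynomial (C × ℕ) B)} ∪ (g '' (S : Set (C × ℕ))))
      (H := Polynomial.C (MvPolynomial.C w) * Polynomial.X ^ p + Polynomial.C r * Polynomial.X +
        Polynomial.C s) (d := p) ?_ ?_ ?_ ?_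
    · refine key.of_sub_mem ?_
      rw [← neg_sub, Ideal.span_union, Ideal.span_union]
      refine Ideal.mem_sup_left (Submodule.neg_mem _ ?_)
      simpa using h
    · rintro q ((rfl | rfl) | ⟨j, hj, rfl⟩)
      · exact C_mem_supported _ _
      · exact natCast_mem _ _
      · exact hg1 j hj
    · intro k
      rw [Polynomial.coeff_add, Polynomial.coeff_add, Polynomial.coeff_C_mul,
        Polynomial.coeff_C_mul, Polynomial.coeff_X_pow, Polynomial.coeff_X, Polynomial.coeff_C]
      have h01 : ∀ (P : Prop) [Decidable P], ∀ z ∈ supported B {(c, n)}ᶜ, (if P then z else 0) ∈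
          supported B {(c, n)}ᶜ := fun P _ z hz => by
        split_ifs
        exacts [hz, zero_mem _]
      exact add_mem (add_mem (mul_mem (C_mem_supported _ _) (h01 _ _ (one_mem _)))
        (mul_mem (hle hr) (h01 _ _ (one_mem _)))) (h01 _ _ (hle hs))
    · have := H.prime.one_lt
      compute_degree
      omega
    · have h1 : p ≠ 1 := H.prime.one_lt.ne'
      have h0 : p ≠ 0 := H.prime.ne_zero
      refine nzdMod_unit ?_
      simp [Polynomial.coeff_X, Polynomial.coeff_C, h1.symm, h0]
      exact hw

/-- The exchange lemma over `(E)`, moving `p` behind the relations. -/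
theorem nzdMod_p_finset (H : EnvHyp p φ E y) (S : Finset (C × ℕ)) :
    NZDMod (Ideal.span {MvPolynomial.C E} ⊔ Ideal.span (rel p φ E y '' S))
      (p : MvPolynomial (C × ℕ) B) := by
  refine nzdMod_sup_span_image Prod.snd _ _ _ ?_ H.nzdMod_rel_mod_p S
  have := nzdMod_map_C (σ := C × ℕ) H.nzd_p
  rwa [Ideal.map_span, Set.image_singleton, map_natCast] at this

/-- The leading coefficient `φⁿ(E)`, `n ≥ 1`, is `p` times a unit modulo `E`, and `p` is regular
modulo the earlier relations by `nzdMod_p_finset`. This is why regularity modulo `(p, E)` has to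
come before regularity modulo `E`. -/
theorem nzdMod_rel (H : EnvHyp p φ E y) (i : C × ℕ) (S : Finset (C × ℕ)) (hi : i ∉ S)
    (hS : ∀ j ∈ S, j.2 ≤ i.2) :
    NZDMod (⊥ ⊔ Ideal.span {MvPolynomial.C E} ⊔
      Ideal.span (rel p φ E y '' S)) (rel p φ E y i) := by
  classical
  rw [bot_sup_eq]
  obtain ⟨c, n⟩ := i
  cases n with
  | zero =>
    have := nzdMod_rel_zero (p := p) (φ := φ) (Ideal.mem_span_singleton_self E) H.nzd_y hi hS
    rwa [Ideal.map_span, Set.image_singleton] at this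
  | succ n =>
    obtain ⟨q, hq, h⟩ := H.exists_rel_eq c (n + 1)
    obtain ⟨v, a, hv, hva⟩ := H.iterate_eq n
    have hp := (H.nzdMod_p_finset S).unit_mul
      (hv.map (MvPolynomial.C : B →+* MvPolynomial (C × ℕ) B))
    have hb : NZDMod (Ideal.span {MvPolynomial.C E} ⊔ Ideal.span (rel p φ E y '' S))
        (MvPolynomial.C (φ^[n + 1] E)) := by
      refine hp.of_sub_mem (Ideal.mem_sup_left ?_)
      have : (MvPolynomial.C v : MvPolynomial (C × ℕ) B) * (p : MvPolynomial (C × ℕ) B) - MvPolynomial.C (φ^[n + 1] E) =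
        MvPolynomial.C E ^ p * -MvPolynomial.C a := by
        rw [hva]; simp; ring
      rw [this]
      exact Ideal.mul_mem_right _ _ (Ideal.pow_mem_of_mem _
        (Ideal.mem_span_singleton_self _) _ H.prime.pos)
    rw [h]
    rw [← Ideal.span_union] at hb ⊢
    have hle := lowerVars_le_supported_compl (B := B) (i := (c, n + 1)) (j := (c, n + 1))
      (m := n + 1) (fun _ => le_rfl)
    have key := nzdMod_eval_of_coeff (B := B) (i := (c, n + 1))
      (G := {MvPolynomial.C E} ∪ (rel p φ E y '' (S : Set (C × ℕ))))
      (H := Polynomial.C (MvPolynomial.C (φ^[n + 1] E)) * Polynomial.X + Polynomial.C q)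
      (d := 1) ?_ ?_ ?_ ?_
    · simpa using key
    · rintro g (rfl | ⟨⟨c', n'⟩, hj, rfl⟩)
      · exact C_mem_supported _ _
      · obtain ⟨q', hq', h'⟩ := H.exists_rel_eq c' n'
        have hne : (c', n') ≠ (c, n + 1) := fun hh => hi (by rw [← hh]; exact hj)
        have hle' := lowerVars_le_supported_compl (B := B) (i := (c, n + 1)) (j := (c', n'))
          (m := n') (fun _ => hS _ hj)
        rw [h']
        exact add_mem (mul_mem (C_mem_supported _ _) (X_mem_supported_compl hne)) (hle' hq')
    · intro k
      rw [Polynomial.coeff_add, Polynomial.coeff_C_mul, Polynomial.coeff_X, Polynomial.coeff_C]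
      have h01 : ∀ (P : Prop) [Decidable P], ∀ z ∈ supported B {(c, n + 1)}ᶜ,
          (if P then z else 0) ∈ supported B {(c, n + 1)}ᶜ := fun P _ z hz => by
        split_ifs
        exacts [hz, zero_mem _]
      exact add_mem (mul_mem (C_mem_supported _ _) (h01 _ _ (one_mem _))) (h01 _ _ (hle hq))
    · compute_degree
    · simpa [Polynomial.coeff_X, Polynomial.coeff_C] using hb

theorem deltaRel_eq : deltaRel p φ E y = Ideal.span (Set.range (rel p φ E y)) := rfl

/-- The second use of the exchange lemma: `E` itself moves behind the relations. -/
theorem nzdMod_E (H : EnvHyp p φ E y) : NZDMod (deltaRel p φ E y) (MvPolynomial.C E) := by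
  rw [deltaRel_eq, ← bot_sup_eq (Ideal.span _)]
  refine NZDMod.span_range (nzdMod_sup_span_image Prod.snd _ _ _ ?_ H.nzdMod_rel)
  have := nzdMod_map_C (σ := C × ℕ) H.nzd_E
  rwa [Ideal.map_bot] at this

theorem nzdMod_p (H : EnvHyp p φ E y) :
    NZDMod (Ideal.span {MvPolynomial.C E} ⊔ deltaRel p φ E y) (p : MvPolynomial (C × ℕ) B) :=
  NZDMod.span_range H.nzdMod_p_finset

end EnvHyp

/-- The Frobenius of the `δ`-envelope. -/
theorem deltaRel_le_comap_freeFrob {p : ℕ} {B : Type*} [CommRing B] {φ : B →+* B} {C : Type*}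
    {E : B} {y : C → B} (hp : p.Prime) (hφ : IsFrobeniusLift p φ) :
    deltaRel p φ E y ≤ (deltaRel p φ E y).comap (freeFrob p φ C) := by
  refine Ideal.span_le.2 ?_
  rintro _ ⟨⟨c, n⟩, rfl⟩
  change freeFrob p φ C (rel p φ E y (c, n)) ∈ deltaRel p φ E y
  have h := natCast_mul_freeDelta (C := C) hp hφ (rel p φ E y (c, n))
  rw [← EnvHyp.rel_succ] at h
  -- Frobenius sends `ρ_n` to `ρ_n^p + p ρ_{n+1}`, a combination of relations.
  rw [← sub_add_cancel (freeFrob p φ C (rel p φ E y (c, n))) (rel p φ E y (c, n) ^ p), ← h]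
  have hmem : ∀ cn, rel p φ E y cn ∈ deltaRel p φ E y := fun cn =>
    Ideal.subset_span (Set.mem_range_self (f := rel p φ E y) cn)
  exact add_mem (Ideal.mul_mem_left _ _ (hmem _))
    (Ideal.pow_mem_of_mem _ (hmem _) _ hp.pos)

end PrismaticEnvelope

namespace PrismaticEnvelope

/-! ### Divided power polynomials -/

theorem exists_ringHom_lift {M L P : Type*} [CommRing M] [CommRing L] [CommRing P] (j : M →+* L)
    (hj : Function.Injective j) (Φ : P →+* L) (h : ∀ x, ∃ m, j m = Φ x) :
    ∃ g : P →+* M, ∀ x, j (g x) = Φ x := by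
  choose g hg using h
  exact ⟨{ toFun := g
           map_one' := hj (by rw [hg, map_one, map_one])
           map_mul' := fun x y => hj (by rw [hg, map_mul, map_mul, hg, hg])
           map_zero' := hj (by rw [hg, map_zero, map_zero])
           map_add' := fun x y => hj (by rw [hg, map_add, map_add, hg, hg]) }, hg⟩

/-- The multiples of `p` among `1, …, i` contribute `p^(i/p) (i/p)!`; the other factors are prime to
`p`. -/
theorem exists_factorial_eq {p : ℕ} (hp : p.Prime) (i : ℕ) :
    ∃ u : ℕ, p.Coprime u ∧ i.factorial = p ^ (i / p) * (i / p).factorial * u := by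
  induction i with
  | zero => exact ⟨1, by simp, by simp⟩
  | succ i ih =>
    obtain ⟨u, hu, h⟩ := ih
    rw [Nat.succ_div, Nat.factorial_succ, h]
    split_ifs with hd
    · refine ⟨u, hu, ?_⟩
      obtain ⟨k, hk⟩ := hd
      have : i / p + 1 = k := by
        have := Nat.succ_div (a := i) (b := p)
        rw [if_pos ⟨k, hk⟩, hk, Nat.mul_div_cancel_left _ hp.pos] at this
        exact this.symm
      rw [Nat.factorial_succ, this, hk, ← this, pow_succ]
      ring
    · refine ⟨(i + 1) * u, Nat.Coprime.mul_right ((hp.coprime_iff_not_dvd).2 hd) hu, ?_⟩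
      rw [add_zero]
      ring

section Fac

variable {C : Type*}

/-- The factorial of a multi-index. -/
def fac (e : C →₀ ℕ) : ℕ := e.prod fun _ i => i.factorial

theorem fac_ne_zero (e : C →₀ ℕ) : fac e ≠ 0 :=
  Finset.prod_ne_zero_iff.2 fun _ _ => Nat.factorial_ne_zero _

theorem fac_single (c : C) (i : ℕ) : fac (Finsupp.single c i) = i.factorial :=
  Finsupp.prod_single_index (by simp)

theorem fac_mul_fac_dvd (a b : C →₀ ℕ) : fac a * fac b ∣ fac (a + b) := by
  classical
  have h : ∀ e : C →₀ ℕ, e.support ⊆ a.support ∪ b.support →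
      fac e = ∏ c ∈ a.support ∪ b.support, (e c).factorial := fun e he =>
    Finsupp.prod_of_support_subset _ he _ (by simp)
  rw [h a Finset.subset_union_left, h b Finset.subset_union_right, h (a + b) Finsupp.support_add,
    ← Finset.prod_mul_distrib]
  exact Finset.prod_dvd_prod_of_dvd _ _ fun c _ => by
    simpa using Nat.factorial_mul_factorial_dvd_factorial_add (a c) (b c)

end Fac

section Pd

open MvPolynomial

variable {p : ℕ} {S : Type*} [CommRing S] {C : Type*}

theorem isUnit_natCast_self_invP (p : ℕ) (S : Type*) [CommRing S] : IsUnit (p : InvP p S) := by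
  have := IsLocalization.Away.algebraMap_isUnit (S := InvP p S) (p : S)
  rwa [map_natCast] at this

theorem isUnit_natCast_invP (hp : p.Prime) (hu : ∀ n : ℕ, p.Coprime n → IsUnit (n : S)) {n : ℕ}
    (hn : n ≠ 0) : IsUnit (n : InvP p S) := by
  obtain ⟨k, m, hm, rfl⟩ := Nat.exists_eq_pow_mul_and_not_dvd hn p hp.ne_one
  push_cast
  refine ((isUnit_natCast_self_invP p S).pow _).mul ?_
  have := (hu m ((hp.coprime_iff_not_dvd).2 hm)).map (algebraMap S (InvP p S))
  rwa [map_natCast] at this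

theorem algebraMap_invP_injective (htf : ∀ x : S, (p : S) * x = 0 → x = 0) :
    Function.Injective (algebraMap S (InvP p S)) := by
  refine IsLocalization.injective _ (M := Submonoid.powers (p : S)) ?_
  rintro _ ⟨n, rfl⟩
  refine mem_nonZeroDivisors_iff.2 ⟨?_, ?_⟩
  · have h := (NZDMod.pow (I := (⊥ : Ideal S)) (e := (p : S)) (by simpa [NZDMod] using htf) n)
    intro x hx
    simpa using h x (by simpa using hx)
  · have h := (NZDMod.pow (I := (⊥ : Ideal S)) (e := (p : S)) (by simpa [NZDMod] using htf) n)
    intro x hx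
    simpa using h x (by simpa [mul_comm] using hx)

theorem exists_natCast_pow_mul_eq (x : InvP p S) :
    ∃ (n : ℕ) (s : S), (p : InvP p S) ^ n * x = algebraMap S _ s := by
  obtain ⟨n, s, h⟩ := IsLocalization.Away.surj (p : S) x
  exact ⟨n, s, by rw [← h, map_natCast, mul_comm]⟩

/-- The polynomials `∑ a_e z ^ e / e!` with `a_e` in a given subalgebra of `S[1/p]`. -/
def pdOver (C : Type*) (A' : Subalgebra S (InvP p S)) :
    Subalgebra S (MvPolynomial C (InvP p S)) where
  carrier := {f | ∀ e, (fac e : InvP p S) * coeff e f ∈ A'}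
  mul_mem' := by
    classical
    intro f g hf hg e
    rw [coeff_mul, Finset.mul_sum]
    refine sum_mem fun ab hab => ?_
    have hab := Finset.HasAntidiagonal.mem_antidiagonal.1 hab
    obtain ⟨k, hk⟩ := fac_mul_fac_dvd ab.1 ab.2
    rw [← hab, hk]
    have : ((fac ab.1 * fac ab.2 * k : ℕ) : InvP p S) * (coeff ab.1 f * coeff ab.2 g) =
      (fac ab.1 * coeff ab.1 f) * (fac ab.2 * coeff ab.2 g) * (k : InvP p S) := by
      push_cast; ring
    rw [this]
    exact mul_mem (mul_mem (hf _) (hg _)) (natCast_mem _ _)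
  add_mem' := fun {f g} hf hg e => by
    rw [coeff_add, mul_add]
    exact add_mem (hf e) (hg e)
  algebraMap_mem' := fun s e => by
    classical
    rw [IsScalarTower.algebraMap_apply S (InvP p S), MvPolynomial.algebraMap_eq, coeff_C]
    split_ifs
    · exact mul_mem (natCast_mem _ _) (A'.algebraMap_mem _)
    · simp

theorem mem_pdOver {A' : Subalgebra S (InvP p S)} {f : MvPolynomial C (InvP p S)} :
    f ∈ pdOver C A' ↔ ∀ e, (fac e : InvP p S) * coeff e f ∈ A' := Iff.rfl

theorem gam_eq_monomial (c : C) (i : ℕ) :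
    gam p S c i = monomial (Finsupp.single c i) (Ring.inverse (i.factorial : InvP p S)) := by
  rw [gam, X_pow_eq_monomial, C_mul_monomial, mul_one]

section

variable (hp : p.Prime) (hu : ∀ n : ℕ, p.Coprime n → IsUnit (n : S))
include hp hu

theorem natCast_mul_inverse_factorial {n : ℕ} (hn : n ≠ 0) :
    (n : InvP p S) * Ring.inverse (n : InvP p S) = 1 :=
  Ring.mul_inverse_cancel _ (isUnit_natCast_invP hp hu hn)

theorem factorial_mul_gam (c : C) (i : ℕ) :
    (i.factorial : MvPolynomial C (InvP p S)) * gam p S c i = X c ^ i := by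
  rw [gam, ← map_natCast (MvPolynomial.C : InvP p S →+* MvPolynomial C (InvP p S)), ← mul_assoc,
    ← map_mul, natCast_mul_inverse_factorial hp hu (Nat.factorial_ne_zero i), map_one, one_mul]

theorem natCast_mul_cancel {n : ℕ} (hn : n ≠ 0) {f g : MvPolynomial C (InvP p S)}
    (h : (n : MvPolynomial C (InvP p S)) * f = n * g) : f = g := by
  have hU : IsUnit (n : MvPolynomial C (InvP p S)) := by
    have := (isUnit_natCast_invP (S := S) hp hu hn).map
      (MvPolynomial.C : InvP p S →+* MvPolynomial C (InvP p S))
    rwa [map_natCast] at this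
  exact hU.mul_left_cancel h

theorem gam_mem_pdOver (c : C) (i : ℕ) (A' : Subalgebra S (InvP p S)) :
    gam p S c i ∈ pdOver C A' := by
  classical
  intro e
  rw [gam_eq_monomial, coeff_monomial]
  split_ifs with h
  · rw [← h, fac_single, natCast_mul_inverse_factorial hp hu (Nat.factorial_ne_zero i)]
    exact one_mem _
  · simp

/-- The monomial `a_e z^e` is `(e! a_e)` times the product of the `γ_{e_c}(z_c)`. -/
theorem pdOver_le {A' : Subalgebra S (InvP p S)} {D : Subalgebra S (MvPolynomial C (InvP p S))}
    (hA' : ∀ a ∈ A', MvPolynomial.C a ∈ D) (hgam : ∀ c i, gam p S c i ∈ D) : pdOver C A' ≤ D := by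
  intro f hf
  rw [f.as_sum]
  refine sum_mem fun e _ => ?_
  have h1 : (monomial e) (coeff e f) = MvPolynomial.C ((fac e : InvP p S) * coeff e f) *
      e.prod fun c i => gam p S c i := by
    have h2 : (e.prod fun c i => gam p S c i) =
        MvPolynomial.C (Ring.inverse (fac e : InvP p S)) * e.prod fun c i => X c ^ i := by
      refine natCast_mul_cancel hp hu (fac_ne_zero e) ?_
      rw [← mul_assoc, ← map_natCast (MvPolynomial.C : InvP p S →+* MvPolynomial C (InvP p S)),
        ← map_mul, natCast_mul_inverse_factorial hp hu (fac_ne_zero e), map_one, one_mul,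
        map_natCast]
      simp only [fac, Finsupp.prod]
      push_cast
      rw [← Finset.prod_mul_distrib]
      exact Finset.prod_congr rfl fun c _ => factorial_mul_gam hp hu c _
    rw [h2, ← mul_assoc, ← map_mul, mul_right_comm,
      natCast_mul_inverse_factorial hp hu (fac_ne_zero e), one_mul, monomial_eq]
  rw [h1]
  exact mul_mem (hA' _ (hf e)) (prod_mem fun c _ => hgam _ _)

/-- Membership in the generated subalgebra becomes a condition on single coefficients. This yields
the basis of divided power monomials, and its analogue for `E/p` reduces divisibility questions to
the coefficient ring. -/
theorem pdSubalgebra_eq_pdOver : pdSubalgebra p S C = pdOver C ⊥ := by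
  refine le_antisymm (Algebra.adjoin_le ?_) (pdOver_le hp hu ?_ ?_)
  · rintro _ ⟨ci, rfl⟩
    exact gam_mem_pdOver hp hu _ _ _
  · rintro _ ⟨s, rfl⟩
    exact (pdSubalgebra p S C).algebraMap_mem s
  · exact fun c i => Algebra.subset_adjoin ⟨(c, i), rfl⟩

theorem maxSubalgebra_eq_pdOver (E : S) : maxSubalgebra p C E = pdOver C (Algebra.adjoin S
    {algebraMap S (InvP p S) E * Ring.inverse (p : InvP p S)}) := by
  refine le_antisymm (Algebra.adjoin_le ?_) (pdOver_le hp hu ?_ ?_)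
  · rintro _ (rfl | ⟨ci, rfl⟩)
    · classical
      intro e
      rw [coeff_C]
      split_ifs
      · exact mul_mem (natCast_mem _ _) (Algebra.subset_adjoin rfl)
      · simp
    · exact gam_mem_pdOver hp hu _ _ _
  · intro a ha
    induction ha using Algebra.adjoin_induction with
    | mem x hx =>
      obtain rfl := hx
      exact Algebra.subset_adjoin (Or.inl rfl)
    | algebraMap r => exact (maxSubalgebra p C E).algebraMap_mem r
    | add x y _ _ hx hy => rw [map_add]; exact add_mem hx hy
    | mul x y _ _ hx hy => rw [map_mul]; exact mul_mem hx hy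
  · exact fun c i => Algebra.subset_adjoin (Or.inr ⟨(c, i), rfl⟩)

/-- The ratio `(pi)! / (i!)^p` is `p!` times the number of partitions of `pi` objects into `p`
blocks of size `i`; the factor `p` comes from `p!`. -/
theorem gam_pow_eq (c : C) {i : ℕ} (hi : i ≠ 0) : gam p S c i ^ p =
    (p : MvPolynomial C (InvP p S)) *
      (((Nat.uniformBell p i * (p - 1).factorial : ℕ) : MvPolynomial C (InvP p S)) *
        gam p S c (p * i)) := by
  refine natCast_mul_cancel hp hu (pow_ne_zero p (Nat.factorial_ne_zero i)) ?_
  have h1 := Nat.uniformBell_mul_eq p hi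
  have h2 := factorial_mul_gam (C := C) (S := S) hp hu c (p * i)
  have h3 := factorial_mul_gam (C := C) (S := S) hp hu c i
  rw [← h1, ← Nat.mul_factorial_pred hp.ne_zero] at h2
  push_cast at h2 ⊢
  rw [← mul_pow, h3, ← pow_mul, mul_comm i p, ← h2]
  ring

end

/-- The elements `ζ_0 = z_c`, `ζ_{n+1} = -ζ_n ^ p / p`. -/
noncomputable def zeta (p : ℕ) (S : Type*) [CommRing S] {C : Type*} (c : C) :
    ℕ → MvPolynomial C (InvP p S)
  | 0 => X c
  | n + 1 => -(MvPolynomial.C (Ring.inverse (p : InvP p S)) * zeta p S c n ^ p)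

theorem natCast_mul_C_inverse :
    (p : MvPolynomial C (InvP p S)) * MvPolynomial.C (Ring.inverse (p : InvP p S)) = 1 := by
  rw [← map_natCast (MvPolynomial.C : InvP p S →+* MvPolynomial C (InvP p S)), ← map_mul,
    Ring.mul_inverse_cancel _ (isUnit_natCast_self_invP p S), map_one]

theorem natCast_mul_zeta_succ (c : C) (n : ℕ) :
    (p : MvPolynomial C (InvP p S)) * zeta p S c (n + 1) = -zeta p S c n ^ p := by
  rw [zeta]
  linear_combination (-zeta p S c n ^ p) * natCast_mul_C_inverse (p := p) (S := S) (C := C)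

section

variable (hp : p.Prime) (hu : ∀ n : ℕ, p.Coprime n → IsUnit (n : S))
include hp hu

theorem exists_zeta_eq (c : C) (n : ℕ) :
    ∃ a : ℤ, zeta p S c n = (a : MvPolynomial C (InvP p S)) * gam p S c (p ^ n) := by
  induction n with
  | zero => exact ⟨1, by simp [zeta, gam]⟩
  | succ n ih =>
    obtain ⟨a, ha⟩ := ih
    refine ⟨-(a ^ p * (Nat.uniformBell p (p ^ n) * (p - 1).factorial : ℕ)),
      natCast_mul_cancel hp hu hp.ne_zero ?_⟩
    rw [natCast_mul_zeta_succ, ha, mul_pow, gam_pow_eq hp hu c (pow_ne_zero _ hp.ne_zero),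
      ← pow_succ']
    push_cast
    ring

theorem zeta_mem (c : C) (n : ℕ) : zeta p S c n ∈ pdSubalgebra p S C := by
  obtain ⟨a, ha⟩ := exists_zeta_eq hp hu c n
  rw [ha]
  exact mul_mem (intCast_mem _ _) (Algebra.subset_adjoin ⟨(c, _), rfl⟩)

/-- Write `i = p (i/p) + i % p` and replace `ζ_n^p` by `-p ζ_{n+1}`. The powers of `p` cancel
against `i! = p^(i/p) (i/p)! u`, and what remains is `ζ_{n+1}^(i/p) / (i/p)!`, so the induction
lowers `i` while raising `n`. -/
theorem exists_factorial_mul_eq_zeta_pow {D : Subalgebra S (MvPolynomial C (InvP p S))} (c : C)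
    (hD : ∀ n, zeta p S c n ∈ D) (i n : ℕ) :
    ∃ f ∈ D, (i.factorial : MvPolynomial C (InvP p S)) * f = zeta p S c n ^ i := by
  induction i using Nat.strong_induction_on generalizing n with
  | _ i ih =>
    rcases Nat.eq_zero_or_pos i with rfl | hi
    · exact ⟨1, one_mem _, by simp⟩
    · obtain ⟨f, hf, h⟩ := ih (i / p) (Nat.div_lt_self hi hp.one_lt) (n + 1)
      obtain ⟨u, hup, hfac⟩ := exists_factorial_eq hp i
      obtain ⟨v, hv⟩ := (hu u hup).exists_right_inv
      have hv' : (u : MvPolynomial C (InvP p S)) * algebraMap S _ v = 1 := by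
        rw [← map_natCast (algebraMap S (MvPolynomial C (InvP p S))), ← map_mul, hv, map_one]
      refine ⟨algebraMap S _ v * ((-1) ^ (i / p) * f * zeta p S c n ^ (i % p)),
        mul_mem (D.algebraMap_mem _) (mul_mem (mul_mem (pow_mem (neg_mem (one_mem _)) _) hf)
          (pow_mem (hD n) _)), ?_⟩
      have h1 : zeta p S c n ^ i = (-1) ^ (i / p) * ((p : MvPolynomial C (InvP p S)) *
          zeta p S c (n + 1)) ^ (i / p) * zeta p S c n ^ (i % p) := by
        have : (-1 : MvPolynomial C (InvP p S)) * -zeta p S c n ^ p = zeta p S c n ^ p := by ring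
        rw [natCast_mul_zeta_succ, ← mul_pow, this, ← pow_mul, ← pow_add, Nat.div_add_mod]
      rw [h1, mul_pow, ← h, hfac]
      push_cast
      linear_combination ((p : MvPolynomial C (InvP p S)) ^ (i / p) * (i / p).factorial *
        ((-1) ^ (i / p) * f * zeta p S c n ^ (i % p))) * hv'

theorem pdSubalgebra_le_of_zeta_mem {D : Subalgebra S (MvPolynomial C (InvP p S))}
    (hD : ∀ c n, zeta p S c n ∈ D) : pdSubalgebra p S C ≤ D := by
  refine Algebra.adjoin_le ?_
  rintro _ ⟨⟨c, i⟩, rfl⟩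
  obtain ⟨f, hf, h⟩ := exists_factorial_mul_eq_zeta_pow hp hu c (hD c) i 0
  have : gam p S c i = f := natCast_mul_cancel hp hu (Nat.factorial_ne_zero i) (by
    rw [factorial_mul_gam hp hu, h, zeta])
  change gam p S c i ∈ D
  rwa [this]

end

/-- The inclusion of `S[γ_i(z_c)]` in `S[1/p][z_c]`. -/
noncomputable def PdPoly.val (p : ℕ) (S : Type*) [CommRing S] (C : Type*) :
    PdPoly p S C →ₐ[S] MvPolynomial C (InvP p S) := (pdSubalgebra p S C).val

theorem PdPoly.val_injective : Function.Injective (PdPoly.val p S C) := Subtype.val_injective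

theorem PdPoly.val_z (c : C) : PdPoly.val p S C (PdPoly.z p S c) = X c := rfl

theorem PdPoly.exists_val_eq {f : MvPolynomial C (InvP p S)} (hf : f ∈ pdSubalgebra p S C) :
    ∃ x, PdPoly.val p S C x = f := ⟨(⟨f, hf⟩ : pdSubalgebra p S C), rfl⟩

theorem PdPoly.val_mem (x : PdPoly p S C) : PdPoly.val p S C x ∈ pdSubalgebra p S C :=
  Subtype.prop (p := fun f => f ∈ pdSubalgebra p S C) x

theorem PdPoly.natCast_torsionFree (x : PdPoly p S C) (h : (p : PdPoly p S C) * x = 0) :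
    x = 0 := by
  apply PdPoly.val_injective
  have h1 := congrArg (PdPoly.val p S C) h
  rw [map_mul, map_natCast, map_zero] at h1
  rw [map_zero, ← one_mul (PdPoly.val p S C x), ← natCast_mul_C_inverse, mul_right_comm, h1,
    zero_mul]

/-- The inclusion of `S[E/p, γ_i(z_c)]` in `S[1/p][z_c]`. -/
noncomputable def PreMax.val (p : ℕ) {S : Type*} [CommRing S] (C : Type*) (E : S) :
    PreMax p C E →ₐ[S] MvPolynomial C (InvP p S) := (maxSubalgebra p C E).val

theorem PreMax.val_injective {E : S} : Function.Injective (PreMax.val p C E) :=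
  Subtype.val_injective

theorem PreMax.val_z {E : S} (c : C) : PreMax.val p C E (PreMax.z p E c) = X c := rfl

theorem PreMax.exists_val_eq {E : S} {f : MvPolynomial C (InvP p S)}
    (hf : f ∈ maxSubalgebra p C E) :
    ∃ x, PreMax.val p C E x = f := ⟨(⟨f, hf⟩ : maxSubalgebra p C E), rfl⟩

theorem PreMax.val_mem {E : S} (x : PreMax p C E) : PreMax.val p C E x ∈ maxSubalgebra p C E :=
  Subtype.prop (p := fun f => f ∈ maxSubalgebra p C E) x

theorem PreMax.natCast_torsionFree {E : S} (x : PreMax p C E) (h : (p : PreMax p C E) * x = 0) :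
    x = 0 := by
  apply PreMax.val_injective
  have h1 := congrArg (PreMax.val p C E) h
  rw [map_mul, map_natCast, map_zero] at h1
  rw [map_zero, ← one_mul (PreMax.val p C E x), ← natCast_mul_C_inverse, mul_right_comm, h1,
    zero_mul]

end Pd

end PrismaticEnvelope

namespace PrismaticEnvelope

/-! ### The reduction of the `δ`-envelope modulo `E` -/

/-- The hypotheses identifying `B / (E, y)` with `R` through a `φ`-equivariant quotient `A` of `B`
in which `y` vanishes. -/
structure ResidueHyp (p : ℕ) {B A R C : Type*} [CommRing B] [CommRing A] [CommRing R]
    (φ : B →+* B) (φA : A →+* A) (E : B) (y : C → B) (π : B →+* A) (q : A →+* R) : Prop where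
  map_y : ∀ c, π (y c) = 0
  comm : ∀ b, π (φ b) = φA (π b)
  surjective : Function.Surjective q
  surjective' : Function.Surjective π
  map_E : q (π E) = 0
  mem_of_map_eq_zero : ∀ b, q (π b) = 0 → b ∈ Ideal.span {E} ⊔ Ideal.span (Set.range y)
  torsionFree : ∀ x : R, (p : R) * x = 0 → x = 0
  isUnit : ∀ n : ℕ, p.Coprime n → IsUnit (n : R)

/-- The map `S[1/p] → S'[1/p]` induced by `S → S'`. -/
noncomputable def invPMap (p : ℕ) {S S' : Type*} [CommRing S] [CommRing S'] (g : S →+* S') :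
    InvP p S →+* InvP p S' :=
  IsLocalization.Away.lift (p : S) (g := (algebraMap S' (InvP p S')).comp g) (by
    rw [map_natCast]; exact isUnit_natCast_self_invP p S')

theorem invPMap_algebraMap (p : ℕ) {S S' : Type*} [CommRing S] [CommRing S'] (g : S →+* S')
    (s : S) : invPMap p g (algebraMap S _ s) = algebraMap S' _ (g s) :=
  IsLocalization.Away.lift_eq _ _ _

theorem algebraMap_mvPolynomial_invP {p : ℕ} {S : Type*} [CommRing S] {C : Type*} (s : S) :
    algebraMap S (MvPolynomial C (InvP p S)) s = MvPolynomial.C (algebraMap S _ s) := rfl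

theorem map_inverse_of_isUnit {S S' : Type*} [CommRing S] [CommRing S'] (g : S →+* S') {s : S}
    (hs : IsUnit s) : g (Ring.inverse s) = Ring.inverse (g s) := by
  obtain ⟨u, rfl⟩ := hs
  rw [Ring.inverse_unit, show g (u : S) = (Units.map (g : S →* S') u : S'ˣ) from rfl,
    Ring.inverse_unit, ← map_inv]
  rfl

theorem invPMap_inverse (p : ℕ) {S S' : Type*} [CommRing S] [CommRing S'] (g : S →+* S') :
    invPMap p g (Ring.inverse (p : InvP p S)) = Ring.inverse (p : InvP p S') := by
  rw [map_inverse_of_isUnit _ (isUnit_natCast_self_invP p S), map_natCast]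

open MvPolynomial

variable {p : ℕ} {B A R C C' : Type*} [CommRing B] [CommRing A] [CommRing R]
  {φ : B →+* B} {φA : A →+* A} {E : B} {y : C → B} {π : B →+* A} {q : A →+* R}

/-- The map `B{z} → S[1/p][z]` with `δⁿ(z_c) ↦ ζ_n`. -/
noncomputable def freeToPd (p : ℕ) (S : Type*) [CommRing S] (π : B →+* S) (κ : C → C') :
    MvPolynomial (C × ℕ) B →+* MvPolynomial C' (InvP p S) :=
  eval₂Hom ((MvPolynomial.C.comp (algebraMap S (InvP p S))).comp π) fun c => zeta p S (κ c.1) c.2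

theorem freeToPd_C {S : Type*} [CommRing S] (π : B →+* S) (κ : C → C') (b : B) :
    freeToPd p S π κ (MvPolynomial.C b) = algebraMap S _ (π b) := by
  rw [freeToPd, eval₂Hom_C]; rfl

theorem freeToPd_X {S : Type*} [CommRing S] (π : B →+* S) (κ : C → C') (c : C × ℕ) :
    freeToPd p S π κ (X c) = zeta p S (κ c.1) c.2 := by
  rw [freeToPd, eval₂Hom_X']

/-- The Frobenius of `A[1/p][z]` with `z ↦ 0`. -/
noncomputable def frobZero (p : ℕ) (C' : Type*) (φA : A →+* A) :
    MvPolynomial C' (InvP p A) →+* MvPolynomial C' (InvP p A) :=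
  eval₂Hom (MvPolynomial.C.comp (invPMap p φA)) fun _ => 0

theorem frobZero_zeta (hp : p.Prime) (c : C') (n : ℕ) :
    frobZero p C' φA (zeta p A c n) = 0 := by
  induction n with
  | zero => rw [zeta, frobZero, eval₂Hom_X']
  | succ n ih => rw [zeta, map_neg, map_mul, map_pow, ih, zero_pow hp.ne_zero, mul_zero, neg_zero]

/-- The `ζ_n` are the iterates of `δ` on `z_c` for a Frobenius killing `z_c`: their recursion says
`0 = ζ_n^p + p ζ_{n+1}`. -/
theorem frobZero_freeToPd (hp : p.Prime) (hcomm : ∀ b, π (φ b) = φA (π b)) (κ : C → C')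
    (x : MvPolynomial (C × ℕ) B) :
    frobZero p C' φA (freeToPd p A π κ x) = freeToPd p A π κ (freeFrob p φ C x) := by
  induction x using MvPolynomial.induction_on with
  | C b =>
    rw [freeFrob_C, freeToPd_C, freeToPd_C, hcomm, algebraMap_mvPolynomial_invP,
      algebraMap_mvPolynomial_invP, frobZero, eval₂Hom_C, RingHom.comp_apply, invPMap_algebraMap]
  | add x y hx hy => simp only [map_add, hx, hy]
  | mul_X x i hx =>
    rw [map_mul, map_mul, hx, freeToPd_X, frobZero_zeta hp, map_mul, map_mul, freeFrob_X,
      map_add, map_mul, map_pow, map_natCast, freeToPd_X, freeToPd_X, natCast_mul_zeta_succ]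
    ring

/-- Frobenius kills the image of each relation, so the next image is minus its `p`-th power divided
by `p` and remains a multiple of `E`. The argument runs over `A[1/p]` and not over `R`, because
`(E)` need not be stable under Frobenius. -/
theorem freeToPd_rel (hp : p.Prime) (hφ : IsFrobeniusLift p φ)
    (hcomm : ∀ b, π (φ b) = φA (π b)) (hy : ∀ c, π (y c) = 0) (κ : C → C') (c : C × ℕ) :
    freeToPd p A π κ (rel p φ E y c) ∈ Ideal.span {algebraMap A (MvPolynomial C' (InvP p A)) (π E)}
      ∧ frobZero p C' φA (freeToPd p A π κ (rel p φ E y c)) = 0 := by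
  obtain ⟨c, n⟩ := c
  induction n with
  | zero =>
    rw [EnvHyp.rel_zero, map_sub, map_mul, freeToPd_C, freeToPd_C, hy, map_zero, sub_zero,
      freeToPd_X, map_mul, frobZero_zeta hp, mul_zero]
    exact ⟨Ideal.mul_mem_right _ _ (Ideal.mem_span_singleton_self _), rfl⟩
  | succ n ih =>
    have h := natCast_mul_freeDelta (C := C) hp hφ (rel p φ E y (c, n))
    rw [← EnvHyp.rel_succ] at h
    have h1 := congrArg (freeToPd p A π κ) h
    rw [map_mul, map_natCast, map_sub, ← frobZero_freeToPd hp hcomm, ih.2, map_pow] at h1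
    have h2 : freeToPd p A π κ (rel p φ E y (c, n + 1)) =
        -(MvPolynomial.C (Ring.inverse (p : InvP p A)) *
          freeToPd p A π κ (rel p φ E y (c, n)) ^ p) := by
      linear_combination MvPolynomial.C (Ring.inverse (p : InvP p A)) * h1 -
        (freeToPd p A π κ (rel p φ E y (c, n + 1))) *
          natCast_mul_C_inverse (p := p) (S := A) (C := C')
    rw [h2]
    refine ⟨Submodule.neg_mem _ (Ideal.mul_mem_left _ _ (Ideal.pow_mem_of_mem _ ih.1 _ hp.pos)), ?_⟩
    rw [map_neg, map_mul, map_pow, ih.2, zero_pow hp.ne_zero, mul_zero, neg_zero]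

theorem map_zeta {S S' : Type*} [CommRing S] [CommRing S'] (g : S →+* S') (c : C') (n : ℕ) :
    MvPolynomial.map (invPMap p g) (zeta p S c n) = zeta p S' c n := by
  induction n with
  | zero => rw [zeta, zeta, map_X]
  | succ n ih => rw [zeta, zeta, map_neg, map_mul, map_pow, ih, map_C, invPMap_inverse]

theorem map_freeToPd (κ : C → C') (x : MvPolynomial (C × ℕ) B) :
    MvPolynomial.map (invPMap p q) (freeToPd p A π κ x) = freeToPd p R (q.comp π) κ x := by
  induction x using MvPolynomial.induction_on with
  | C b =>
    rw [freeToPd_C, freeToPd_C, algebraMap_mvPolynomial_invP, algebraMap_mvPolynomial_invP, map_C, invPMap_algebraMap, RingHom.comp_apply]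
  | add x y hx hy => simp only [map_add, hx, hy]
  | mul_X x i hx => rw [map_mul, map_mul, map_mul, hx, freeToPd_X, freeToPd_X, map_zeta]

theorem freeToPd_rename (κ : C → C') (P : MvPolynomial C B) :
    freeToPd p R (q.comp π) κ (rename (fun c => (c, 0)) P) =
      rename κ (MvPolynomial.map ((algebraMap R (InvP p R)).comp (q.comp π)) P) := by
  induction P using MvPolynomial.induction_on with
  | C b => rw [rename_C, freeToPd_C, map_C, rename_C]; rfl
  | add x y hx hy => simp only [map_add, hx, hy]
  | mul_X x i hx =>
    rw [map_mul, map_mul, map_mul, map_mul, hx, rename_X, freeToPd_X, map_X, rename_X, zeta]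

/-- Modulo `E` the relation of index `n + 1` reads `p v δⁿ⁺¹(z_c) = -q` with `v` a unit. So up to
powers of `p` all higher `δⁿ(z_c)` are eliminated in favour of the `z_c`. -/
theorem EnvHyp.exists_pow_mul_sub_rename_mem (H : EnvHyp p φ E y) (x : MvPolynomial (C × ℕ) B) :
    ∃ (N : ℕ) (P : MvPolynomial C B), (p : MvPolynomial (C × ℕ) B) ^ N * x -
      rename (fun c => (c, 0)) P ∈ Ideal.span {MvPolynomial.C E} ⊔ deltaRel p φ E y := by
  set I := Ideal.span {MvPolynomial.C E} ⊔ deltaRel p φ E y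
  have hC : ∀ b : B, ∃ (N : ℕ) (P : MvPolynomial C B), (p : MvPolynomial (C × ℕ) B) ^ N *
      MvPolynomial.C b - rename (fun c => (c, 0)) P ∈ I := fun b =>
    ⟨0, MvPolynomial.C b, by simp⟩
  have hadd : ∀ x y : MvPolynomial (C × ℕ) B,
      (∃ (N : ℕ) (P : MvPolynomial C B), (p : MvPolynomial (C × ℕ) B) ^ N * x -
        rename (fun c => (c, 0)) P ∈ I) →
      (∃ (N : ℕ) (P : MvPolynomial C B), (p : MvPolynomial (C × ℕ) B) ^ N * y -
        rename (fun c => (c, 0)) P ∈ I) →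
      ∃ (N : ℕ) (P : MvPolynomial C B), (p : MvPolynomial (C × ℕ) B) ^ N * (x + y) -
        rename (fun c => (c, 0)) P ∈ I := by
    rintro x y ⟨N, P, h⟩ ⟨N', P', h'⟩
    refine ⟨N + N', (p : MvPolynomial C B) ^ N' * P + (p : MvPolynomial C B) ^ N * P', ?_⟩
    have := add_mem (I.mul_mem_left ((p : MvPolynomial (C × ℕ) B) ^ N') h)
      (I.mul_mem_left ((p : MvPolynomial (C × ℕ) B) ^ N) h')
    convert this using 1
    simp only [map_add, map_mul, map_pow, map_natCast]
    ring
  have hmul : ∀ x y : MvPolynomial (C × ℕ) B,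
      (∃ (N : ℕ) (P : MvPolynomial C B), (p : MvPolynomial (C × ℕ) B) ^ N * x -
        rename (fun c => (c, 0)) P ∈ I) →
      (∃ (N : ℕ) (P : MvPolynomial C B), (p : MvPolynomial (C × ℕ) B) ^ N * y -
        rename (fun c => (c, 0)) P ∈ I) →
      ∃ (N : ℕ) (P : MvPolynomial C B), (p : MvPolynomial (C × ℕ) B) ^ N * (x * y) -
        rename (fun c => (c, 0)) P ∈ I := by
    rintro x y ⟨N, P, h⟩ ⟨N', P', h'⟩
    refine ⟨N + N', P * P', ?_⟩
    have := add_mem (I.mul_mem_left ((p : MvPolynomial (C × ℕ) B) ^ N' * y) h)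
      (I.mul_mem_left (rename (fun c => (c, 0)) P) h')
    convert this using 1
    simp only [map_mul]
    ring
  have hX : ∀ (n : ℕ) (c : C), ∃ (N : ℕ) (P : MvPolynomial C B), (p : MvPolynomial (C × ℕ) B) ^ N *
      X (c, n) - rename (fun c => (c, 0)) P ∈ I := by
    intro n
    induction n using Nat.strong_induction_on with
    | _ n ih =>
      intro c
      cases n with
      | zero => exact ⟨0, X c, by simp⟩
      | succ n =>
        obtain ⟨f, hf, h⟩ := H.exists_rel_eq c (n + 1)
        obtain ⟨v, a, hv, hva⟩ := H.iterate_eq n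
        obtain ⟨u, hu⟩ := hv.exists_left_inv
        have hf' : ∃ (N : ℕ) (P : MvPolynomial C B), (p : MvPolynomial (C × ℕ) B) ^ N *
            f - rename (fun c => (c, 0)) P ∈ I := by
          clear h
          induction hf using Algebra.adjoin_induction with
          | mem x hx =>
            obtain ⟨⟨c', i⟩, ⟨-, hi⟩, rfl⟩ := hx
            exact ih i hi c'
          | algebraMap b => exact hC b
          | add x y _ _ hx hy =>
            exact hadd _ _ hx hy
          | mul x y _ _ hx hy => exact hmul _ _ hx hy
        -- The relation gives `p δⁿ⁺¹(z_c) ≡ -u q`, whence the factor `-u` and the exponent `N + 1`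
        -- below.
        obtain ⟨N, P, hP⟩ := hmul _ _ (hC (-u)) hf'
        refine ⟨N + 1, P, ?_⟩
        have h1 : rel p φ E y (c, n + 1) ∈ I := Ideal.mem_sup_right
          (Ideal.subset_span (Set.mem_range_self (f := rel p φ E y) _))
        have h2 : MvPolynomial.C E ^ p ∈ I := Ideal.mem_sup_left (Ideal.pow_mem_of_mem _
          (Ideal.mem_span_singleton_self _) _ H.prime.pos)
        have h3 := sub_mem (add_mem (I.mul_mem_left ((p : MvPolynomial (C × ℕ) B) ^ N *
          MvPolynomial.C u) h1) hP) (I.mul_mem_left ((p : MvPolynomial (C × ℕ) B) ^ N *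
          MvPolynomial.C u * MvPolynomial.C a * X (c, n + 1)) h2)
        convert h3 using 1
        rw [h, hva]
        have hu' : (MvPolynomial.C u : MvPolynomial (C × ℕ) B) * MvPolynomial.C v = 1 := by
          rw [← map_mul, hu, map_one]
        simp only [map_add, map_mul, map_pow, map_natCast, map_neg]
        linear_combination (-(p : MvPolynomial (C × ℕ) B) ^ (N + 1) * X (c, n + 1)) * hu'
  induction x using MvPolynomial.induction_on with
  | C b => exact hC b
  | add x y hx hy => exact hadd _ _ hx hy
  | mul_X x i hx => exact hmul _ _ hx (hX i.2 i.1)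

/-! ### Kernel and image of the reduction to divided power polynomials -/

namespace ResidueHyp

variable (H : EnvHyp p φ E y) (G : ResidueHyp p φ φA E y π q) (κ : C ≃ C')

section
include H G

theorem freeToPd_eq_zero_of_mem {x : MvPolynomial (C × ℕ) B}
    (hx : x ∈ Ideal.span {MvPolynomial.C E} ⊔ deltaRel p φ E y) :
    freeToPd p R (q.comp π) κ x = 0 := by
  rw [← RingHom.mem_ker]
  refine (sup_le ?_ ?_ : Ideal.span {MvPolynomial.C E} ⊔ deltaRel p φ E y ≤
    RingHom.ker (freeToPd p R (q.comp π) κ)) hx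
  · rw [Ideal.span_singleton_le_iff_mem, RingHom.mem_ker, freeToPd_C, RingHom.comp_apply, G.map_E,
      map_zero]
  · refine Ideal.span_le.2 ?_
    rintro _ ⟨c, rfl⟩
    change freeToPd p R (q.comp π) κ (rel p φ E y c) = 0
    obtain ⟨h, -⟩ := freeToPd_rel (E := E) H.prime H.frobeniusLift G.comm G.map_y κ c
    obtain ⟨z, hz⟩ := Ideal.mem_span_singleton'.1 h
    rw [← map_freeToPd, ← hz, map_mul, algebraMap_mvPolynomial_invP, map_C, invPMap_algebraMap, G.map_E, map_zero, map_zero, mul_zero]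

/-- Some `p^N x` is a polynomial in the `z_c` modulo the ideal. Its coefficients vanish in `R`,
hence lie in `(E, y)`, and `y_c = E z_c` in the envelope. The factor `p^N` is removed because `p` is
regular modulo this ideal. -/
theorem mem_of_freeToPd_eq_zero {x : MvPolynomial (C × ℕ) B}
    (hx : freeToPd p R (q.comp π) κ x = 0) :
    x ∈ Ideal.span {MvPolynomial.C E} ⊔ deltaRel p φ E y := by
  obtain ⟨N, P, h⟩ := H.exists_pow_mul_sub_rename_mem x
  have h1 := G.freeToPd_eq_zero_of_mem H κ h
  rw [map_sub, map_mul, hx, mul_zero, zero_sub, neg_eq_zero, freeToPd_rename] at h1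
  have h2 := rename_injective _ κ.injective (h1.trans (map_zero _).symm)
  refine H.nzdMod_p.pow N x ?_
  rw [← sub_add_cancel ((p : MvPolynomial (C × ℕ) B) ^ N * x) (rename (fun c => (c, 0)) P)]
  refine add_mem h ?_
  rw [P.as_sum, map_sum]
  refine sum_mem fun d _ => ?_
  rw [rename_monomial, ← mul_one (coeff d P), ← C_mul_monomial]
  refine Ideal.mul_mem_right _ _ ?_
  have h3 : q (π (coeff d P)) = 0 := by
    apply algebraMap_invP_injective (p := p) G.torsionFree
    rw [map_zero]
    have := congrArg (coeff d) h2
    rwa [coeff_map, coeff_zero] at this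
  have h4 := Ideal.mem_map_of_mem (MvPolynomial.C : B →+* MvPolynomial (C × ℕ) B)
    (G.mem_of_map_eq_zero _ h3)
  rw [Ideal.map_sup, Ideal.map_span, Ideal.map_span, Set.image_singleton] at h4
  refine (sup_le le_sup_left (Ideal.span_le.2 ?_) : _ ≤ Ideal.span {MvPolynomial.C E} ⊔
    deltaRel p φ E y) h4
  rintro _ ⟨_, ⟨c, rfl⟩, rfl⟩
  have h5 : MvPolynomial.C (y c) = MvPolynomial.C E * X (c, 0) - rel p φ E y (c, 0) := by
    rw [EnvHyp.rel_zero]; ring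
  rw [SetLike.mem_coe, h5]
  exact sub_mem (Ideal.mul_mem_right _ _ (Ideal.mem_sup_left (Ideal.mem_span_singleton_self _)))
    (Ideal.mem_sup_right (Ideal.subset_span (Set.mem_range_self (f := rel p φ E y) _)))

theorem exists_envToPd : ∃ g : DeltaEnv p φ E y →+* PdPoly p R C',
    Function.Surjective g ∧ (∀ x, g x = 0 ↔ x ∈ Ideal.span {algebraMap B (DeltaEnv p φ E y) E}) ∧
    (∀ b, g (algebraMap B _ b) = algebraMap R _ (q (π b))) ∧
    ∀ c, g (DeltaEnv.z p φ E y c 0) = PdPoly.z p R (κ c) := by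
  have hmem : ∀ x, freeToPd p R (q.comp π) κ x ∈ pdSubalgebra p R C' := by
    intro x
    induction x using MvPolynomial.induction_on with
    | C b => rw [freeToPd_C]; exact (pdSubalgebra p R C').algebraMap_mem _
    | add x y hx hy => rw [map_add]; exact add_mem hx hy
    | mul_X x i hx =>
      rw [map_mul, freeToPd_X]
      exact mul_mem hx (zeta_mem H.prime G.isUnit _ _)
  obtain ⟨g₀, hg₀⟩ := exists_ringHom_lift (PdPoly.val p R C').toRingHom PdPoly.val_injective
    (freeToPd p R (q.comp π) κ) (fun x => PdPoly.exists_val_eq (hmem x))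
  replace hg₀ : ∀ x, PdPoly.val p R C' (g₀ x) = freeToPd p R (q.comp π) κ x := hg₀
  have hker : ∀ x, g₀ x = 0 ↔ x ∈ Ideal.span {MvPolynomial.C E} ⊔ deltaRel p φ E y := fun x => by
    rw [← (PdPoly.val_injective (p := p) (S := R) (C := C')).eq_iff, map_zero, hg₀]
    exact ⟨G.mem_of_freeToPd_eq_zero H κ, G.freeToPd_eq_zero_of_mem H κ⟩
  refine ⟨Ideal.Quotient.lift _ g₀ fun x hx => (hker x).2 (Ideal.mem_sup_right hx), ?_, ?_, ?_, ?_⟩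
  · intro f
    -- The image is a subalgebra containing all `ζ_n`, and these generate every divided power.
    let D : Subalgebra R (MvPolynomial C' (InvP p R)) :=
      { (freeToPd p R (q.comp π) κ).range with
        algebraMap_mem' := fun r => by
          obtain ⟨a, rfl⟩ := G.surjective r
          obtain ⟨b, rfl⟩ := G.surjective' a
          exact ⟨MvPolynomial.C b, freeToPd_C _ _ _⟩ }
    have hD : ∀ c n, zeta p R c n ∈ D := fun c n =>
      ⟨X (κ.symm c, n), by rw [freeToPd_X, Equiv.apply_symm_apply]⟩
    obtain ⟨x, hx⟩ := pdSubalgebra_le_of_zeta_mem H.prime G.isUnit hD (PdPoly.val_mem f)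
    refine ⟨Ideal.Quotient.mk _ x, PdPoly.val_injective ?_⟩
    rw [Ideal.Quotient.lift_mk, hg₀]
    exact hx
  · intro x
    obtain ⟨x, rfl⟩ := Ideal.Quotient.mk_surjective x
    rw [Ideal.Quotient.lift_mk, hker]
    have : Ideal.span {algebraMap B (DeltaEnv p φ E y) E} =
        (Ideal.span {MvPolynomial.C E}).map (Ideal.Quotient.mk (deltaRel p φ E y)) := by
      rw [Ideal.map_span, Set.image_singleton]; rfl
    rw [this, Ideal.mem_map_iff_of_surjective _ Ideal.Quotient.mk_surjective]
    constructor
    · intro h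
      obtain ⟨a, ha, b, hb, rfl⟩ := Submodule.mem_sup.1 h
      exact ⟨a, ha, by rw [map_add, Ideal.Quotient.eq_zero_iff_mem.2 hb, add_zero]⟩
    · rintro ⟨a, ha, h⟩
      rw [Ideal.Quotient.eq, ← Submodule.neg_mem_iff, neg_sub] at h
      rw [← sub_add_cancel x a, add_comm]
      exact Submodule.add_mem_sup ha h
  · intro b
    apply PdPoly.val_injective
    refine (hg₀ (MvPolynomial.C b)).trans ?_
    rw [freeToPd_C, AlgHom.commutes]; rfl
  · intro c
    apply PdPoly.val_injective
    refine (hg₀ (X (c, 0))).trans ?_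
    rw [freeToPd_X]; rfl

end

end ResidueHyp

end PrismaticEnvelope

namespace PrismaticEnvelope

/-! ### Adic completions -/

theorem IsAdicComplete.eq_zero_of_forall_mem {T : Type*} [CommRing T] (J : Ideal T)
    [IsAdicComplete J T] {x : T} (h : ∀ n, x ∈ J ^ n) : x = 0 := by
  refine IsHausdorff.haus (I := J) inferInstance x fun n => ?_
  rw [SModEq.sub_mem, sub_zero, smul_eq_mul, Ideal.mul_top]
  exact h n

theorem IsAdicComplete.exists_limit {T : Type*} [CommRing T] (J : Ideal T)
    [IsAdicComplete J T] (a : ℕ → T) (h : ∀ n, a (n + 1) - a n ∈ J ^ n) :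
    ∃ L, ∀ n, L - a n ∈ J ^ n := by
  have h1 : ∀ {m n}, m ≤ n → a m ≡ a n [SMOD (J ^ m • ⊤ : Submodule T T)] := by
    intro m n hmn
    rw [SModEq.sub_mem, smul_eq_mul, Ideal.mul_top]
    induction n, hmn using Nat.le_induction with
    | base => simp
    | succ n hmn ih =>
      have : a m - a (n + 1) = (a m - a n) - (a (n + 1) - a n) := by ring
      rw [this]
      exact sub_mem ih (Ideal.pow_le_pow_right hmn (h n))
  obtain ⟨L, hL⟩ := IsPrecomplete.prec (I := J) inferInstance h1
  refine ⟨L, fun n => ?_⟩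
  have := hL n
  rw [SModEq.sub_mem, smul_eq_mul, Ideal.mul_top] at this
  rw [← neg_sub]
  exact neg_mem this

/-- `c : T → T'` exhibits `T'` as the `I`-adic completion of `T`. -/
structure IsCompletion {T T' : Type*} [CommRing T] [CommRing T'] (I : Ideal T) (c : T →+* T') :
    Prop where
  complete : IsAdicComplete (I.map c) T'
  dense : ∀ (x : T') (n : ℕ), ∃ t, x - c t ∈ (I.map c) ^ n
  mem_of_map_mem : ∀ (t : T) (n : ℕ), c t ∈ (I.map c) ^ n → t ∈ I ^ n

theorem isCompletion_adicCompletion {T : Type*} [CommRing T] {I : Ideal T} (hI : I.FG) :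
    IsCompletion I (algebraMap T (AdicCompletion I T)) := by
  have key : ∀ (n : ℕ) (x : AdicCompletion I T),
      x ∈ (I.map (algebraMap T (AdicCompletion I T))) ^ n ↔ AdicCompletion.eval I T n x = 0 := by
    intro n x
    rw [← LinearMap.mem_ker, ← AdicCompletion.pow_smul_top_eq_ker_eval hI, ← Ideal.map_pow,
      Ideal.smul_top_eq_map]
    rfl
  refine ⟨?_, ?_, ?_⟩
  · exact (IsAdicComplete.map_algebraMap_iff I _).2 (AdicCompletion.isAdicComplete hI)
  · intro x n
    obtain ⟨t, ht⟩ := Submodule.mkQ_surjective _ (AdicCompletion.eval I T n x)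
    refine ⟨t, ?_⟩
    rw [key, map_sub, sub_eq_zero, ← ht]
    exact (AdicCompletion.eval_of I T n t).symm
  · intro t n h
    rw [key] at h
    have h2 : (Submodule.mkQ (I ^ n • ⊤ : Submodule T T)) t = 0 := by
      rw [← AdicCompletion.eval_of]; exact h
    rwa [Submodule.mkQ_apply, Submodule.Quotient.mk_eq_zero, smul_eq_mul, Ideal.mul_top] at h2

namespace IsCompletion

section

variable {T T' : Type*} [CommRing T] [CommRing T'] {I : Ideal T} {c : T →+* T'}

theorem map_mem (t : T) {n : ℕ} (h : t ∈ I ^ n) : c t ∈ (I.map c) ^ n := by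
  rw [← Ideal.map_pow]
  exact Ideal.mem_map_of_mem _ h

/-- Division by `e` loses at most one power of `I`, so it is compatible with approximation and
regularity survives completion. -/
theorem mul_eq_zero (H : IsCompletion I c) {e : T} (he : ∀ n t, e * t ∈ I ^ (n + 1) → t ∈ I ^ n)
    {x : T'} (hx : c e * x = 0) : x = 0 := by
  have := H.complete
  refine IsAdicComplete.eq_zero_of_forall_mem (I.map c) fun n => ?_
  obtain ⟨t, ht⟩ := H.dense x (n + 1)
  have h1 : c (e * t) ∈ (I.map c) ^ (n + 1) := by
    have : c (e * t) = c e * x - c e * (x - c t) := by rw [map_mul]; ring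
    rw [this, hx, zero_sub]
    exact neg_mem (Ideal.mul_mem_left _ _ ht)
  have h2 := map_mem (c := c) t (he n t (H.mem_of_map_mem _ _ h1))
  rw [← sub_add_cancel x (c t)]
  exact add_mem (Ideal.pow_le_pow_right n.le_succ ht) h2

theorem map_pow_le {M : Type*} [CommRing M] {K : Ideal M} {g : T →+* M} (hg : I ≤ K.comap g)
    {h : T' →+* M} (hh : h.comp c = g) {n : ℕ} {x : T'} (hx : x ∈ (I.map c) ^ n) :
    h x ∈ K ^ n := by
  have h1 := Ideal.mem_map_of_mem h hx
  rw [Ideal.map_pow, Ideal.map_map, hh] at h1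
  exact Ideal.pow_right_mono (Ideal.map_le_iff_le_comap.2 hg) n h1

theorem hom_ext (H : IsCompletion I c) {M : Type*} [CommRing M] (K : Ideal M)
    [IsAdicComplete K M] {h h' : T' →+* M} (hI : I ≤ K.comap (h.comp c))
    (heq : h.comp c = h'.comp c) : h = h' := by
  ext x
  refine sub_eq_zero.1 (IsAdicComplete.eq_zero_of_forall_mem K fun n => ?_)
  obtain ⟨t, ht⟩ := H.dense x n
  have h1 : h (c t) = h' (c t) := congrArg (fun f => f t) heq
  have : h x - h' x = h (x - c t) - h' (x - c t) := by rw [map_sub, map_sub, h1]; ring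
  rw [this]
  exact sub_mem (map_pow_le hI rfl ht) (map_pow_le hI heq.symm ht)

theorem exists_lift (H : IsCompletion I c) {M : Type*} [CommRing M] (K : Ideal M)
    [IsAdicComplete K M] (g : T →+* M) (hg : I ≤ K.comap g) :
    ∃ h : T' →+* M, h.comp c = g := by
  have hg' : ∀ n t, t ∈ I ^ n → g t ∈ K ^ n := fun n t ht => by
    have := Ideal.mem_map_of_mem g ht
    rw [Ideal.map_pow] at this
    exact Ideal.pow_right_mono (Ideal.map_le_iff_le_comap.2 hg) n this
  have hdiff : ∀ x n t t', x - c t ∈ (I.map c) ^ n → x - c t' ∈ (I.map c) ^ n →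
      g t - g t' ∈ K ^ n := fun x n t t' ht ht' => by
    rw [← map_sub]
    refine hg' _ _ (H.mem_of_map_mem _ _ ?_)
    have : c (t - t') = (x - c t') - (x - c t) := by rw [map_sub]; ring
    rw [this]
    exact sub_mem ht' ht
  have key : ∀ x, ∃ L, ∀ n t, x - c t ∈ (I.map c) ^ n → L - g t ∈ K ^ n := by
    intro x
    choose t ht using H.dense x
    obtain ⟨L, hL⟩ := IsAdicComplete.exists_limit K (fun n => g (t n)) fun n =>
      hdiff x n _ _ (Ideal.pow_le_pow_right n.le_succ (ht (n + 1))) (ht n)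
    refine ⟨L, fun n t' ht' => ?_⟩
    have : L - g t' = (L - g (t n)) + (g (t n) - g t') := by ring
    rw [this]
    exact add_mem (hL n) (hdiff x n _ _ (ht n) ht')
  choose h hh using key
  -- The value at `x` is characterised by approximations of `x`, so additivity and multiplicativity
  -- follow from those of `g`.
  have huniq : ∀ x L, (∀ n, ∃ t, x - c t ∈ (I.map c) ^ n ∧ L - g t ∈ K ^ n) → h x = L := by
    intro x L hL
    refine sub_eq_zero.1 (IsAdicComplete.eq_zero_of_forall_mem K fun n => ?_)
    obtain ⟨t, ht, ht'⟩ := hL n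
    have : h x - L = (h x - g t) - (L - g t) := by ring
    rw [this]
    exact sub_mem (hh x n t ht) ht'
  have hc : ∀ t, h (c t) = g t := fun t => huniq _ _ fun n => ⟨t, by simp, by simp⟩
  refine ⟨{ toFun := h
            map_one' := by rw [← map_one c, hc, map_one]
            map_zero' := by rw [← map_zero c, hc, map_zero]
            map_mul' := fun x y => huniq _ _ fun n => ?_
            map_add' := fun x y => huniq _ _ fun n => ?_ }, RingHom.ext hc⟩
  · obtain ⟨t, ht⟩ := H.dense x n
    obtain ⟨s, hs⟩ := H.dense y n
    refine ⟨t * s, ?_, ?_⟩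
    · have : x * y - c (t * s) = (x - c t) * y + c t * (y - c s) := by rw [map_mul]; ring
      rw [this]
      exact add_mem (Ideal.mul_mem_right _ _ ht) (Ideal.mul_mem_left _ _ hs)
    · have : h x * h y - g (t * s) = (h x - g t) * h y + g t * (h y - g s) := by
        rw [map_mul]; ring
      rw [this]
      exact add_mem (Ideal.mul_mem_right _ _ (hh _ _ _ ht)) (Ideal.mul_mem_left _ _ (hh _ _ _ hs))
  · obtain ⟨t, ht⟩ := H.dense x n
    obtain ⟨s, hs⟩ := H.dense y n
    refine ⟨t + s, ?_, ?_⟩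
    · have : x + y - c (t + s) = (x - c t) + (y - c s) := by rw [map_add]; ring
      rw [this]
      exact add_mem ht hs
    · have : h x + h y - g (t + s) = (h x - g t) + (h y - g s) := by rw [map_add]; ring
      rw [this]
      exact add_mem (hh _ _ _ ht) (hh _ _ _ hs)

end

/-! ### Surjections and principal kernels under completion -/

section Quotient

variable {T T' P P' : Type*} [CommRing T] [CommRing T'] [CommRing P] [CommRing P'] {I : Ideal T}
  {c : T →+* T'} {IP : Ideal P} {cP : P →+* P'} {g : T →+* P} {h : T' →+* P'}

theorem exists_lift_mem_pow (hg : Function.Surjective g) (hI : I.map g = IP) {n : ℕ} {x : P}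
    (hx : x ∈ IP ^ n) : ∃ t ∈ I ^ n, g t = x := by
  rw [← hI, ← Ideal.map_pow, Ideal.mem_map_iff_of_surjective _ hg] at hx
  exact hx

/-- Telescoping: successive differences of approximations lie in `IP ^ n` and lift to `I ^ n`, as
`I` maps onto `IP`. The lifted series converges. -/
theorem surjective_of_surjective (H : IsCompletion I c) (HP : IsCompletion IP cP)
    (hg : Function.Surjective g) (hI : I.map g = IP) (hh : ∀ t, h (c t) = cP (g t)) :
    Function.Surjective h := by
  intro z
  have := H.complete
  have := HP.complete
  choose b hb using HP.dense z
  have h1 : ∀ n, ∃ s ∈ I ^ n, g s = b (n + 1) - b n := fun n => by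
    refine exists_lift_mem_pow hg hI (HP.mem_of_map_mem _ _ ?_)
    have : cP (b (n + 1) - b n) = (z - cP (b n)) - (z - cP (b (n + 1))) := by rw [map_sub]; ring
    rw [this]
    exact sub_mem (hb n) (Ideal.pow_le_pow_right n.le_succ (hb (n + 1)))
  choose s hs hs' using h1
  obtain ⟨t₀, ht₀⟩ := hg (b 0)
  have hsum : ∀ n, g (t₀ + ∑ i ∈ Finset.range n, s i) = b n := fun n => by
    rw [map_add, map_sum, Finset.sum_congr rfl fun i _ => hs' i, Finset.sum_range_sub, ht₀]
    ring
  obtain ⟨L, hL⟩ := IsAdicComplete.exists_limit (I.map c)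
    (fun n => c (t₀ + ∑ i ∈ Finset.range n, s i)) fun n => by
      rw [← map_sub]
      refine map_mem _ ?_
      rw [Finset.sum_range_succ]
      have : t₀ + (∑ i ∈ Finset.range n, s i + s n) - (t₀ + ∑ i ∈ Finset.range n, s i) = s n := by
        ring
      rw [this]
      exact hs n
  refine ⟨L, sub_eq_zero.1 (IsAdicComplete.eq_zero_of_forall_mem (IP.map cP) fun n => ?_)⟩
  have h2 : h (L - c (t₀ + ∑ i ∈ Finset.range n, s i)) ∈ (IP.map cP) ^ n := by
    refine map_pow_le (c := c) (g := cP.comp g) ?_ (RingHom.ext hh) (hL n)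
    rw [← Ideal.map_le_iff_le_comap, ← Ideal.map_map, hI]
  have : h L - z = h (L - c (t₀ + ∑ i ∈ Finset.range n, s i)) - (z - cP (b n)) := by
    rw [map_sub, hh, hsum]; ring
  rw [this]
  exact sub_mem h2 (hb n)

/-- An element of the kernel is approximated by multiples `e s_n`. Since division by `e` costs one
power of `I`, the shifted sequence `s_{n+1}` is Cauchy, and its limit is the quotient by `e`. -/
theorem eq_zero_iff_mem_span (H : IsCompletion I c) (HP : IsCompletion IP cP)
    (hg : Function.Surjective g) (hI : I.map g = IP) (hh : ∀ t, h (c t) = cP (g t)) {e : T}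
    (hker : ∀ t, g t = 0 ↔ t ∈ Ideal.span {e}) (he : ∀ n t, e * t ∈ I ^ (n + 1) → t ∈ I ^ n)
    (x : T') : h x = 0 ↔ x ∈ Ideal.span {c e} := by
  have := H.complete
  constructor
  · intro hx
    choose t ht using H.dense x
    have h1 : ∀ n, ∃ s, t n - e * s ∈ I ^ n := fun n => by
      have h2 : h (x - c (t n)) ∈ (IP.map cP) ^ n := by
        refine map_pow_le (c := c) (g := cP.comp g) ?_ (RingHom.ext hh) (ht n)
        rw [← Ideal.map_le_iff_le_comap, ← Ideal.map_map, hI]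
      rw [map_sub, hx, zero_sub, Submodule.neg_mem_iff, hh] at h2
      obtain ⟨i, hi, hi'⟩ := exists_lift_mem_pow hg hI (HP.mem_of_map_mem _ _ h2)
      have h3 : g (t n - i) = 0 := by rw [map_sub, hi', sub_self]
      obtain ⟨s, hs⟩ := Ideal.mem_span_singleton'.1 ((hker _).1 h3)
      refine ⟨s, ?_⟩
      rw [mul_comm, hs]
      simpa using hi
    choose s hs using h1
    have hxs : ∀ n, x - c (e * s n) ∈ (I.map c) ^ n := fun n => by
      have : x - c (e * s n) = (x - c (t n)) + c (t n - e * s n) := by rw [map_sub]; ring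
      rw [this]
      exact add_mem (ht n) (map_mem _ (hs n))
    have hcauchy : ∀ n, c (s (n + 1 + 1)) - c (s (n + 1)) ∈ (I.map c) ^ n := fun n => by
      rw [← map_sub]
      refine map_mem _ (he n _ (H.mem_of_map_mem _ _ ?_))
      have : c (e * (s (n + 1 + 1) - s (n + 1))) =
          (x - c (e * s (n + 1))) - (x - c (e * s (n + 1 + 1))) := by
        simp only [map_mul, map_sub]; ring
      rw [this]
      exact sub_mem (hxs _) (Ideal.pow_le_pow_right (n + 1).le_succ (hxs _))
    obtain ⟨L, hL⟩ := IsAdicComplete.exists_limit (I.map c) (fun n => c (s (n + 1))) hcauchy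
    refine Ideal.mem_span_singleton'.2 ⟨L, ?_⟩
    refine sub_eq_zero.1 (IsAdicComplete.eq_zero_of_forall_mem (I.map c) fun n => ?_)
    have : L * c e - x = c e * (L - c (s (n + 1))) - (x - c (e * s (n + 1))) := by
      rw [map_mul]; ring
    rw [this]
    exact sub_mem (Ideal.mul_mem_left _ _ (hL n)) (Ideal.pow_le_pow_right n.le_succ (hxs _))
  · intro hx
    obtain ⟨z, rfl⟩ := Ideal.mem_span_singleton'.1 hx
    rw [map_mul, hh, (hker e).2 (Ideal.mem_span_singleton_self e), map_zero, mul_zero]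

end Quotient

/-! ### Frobenius lifts under completion -/

section Frobenius

variable {T T' : Type*} [CommRing T] [CommRing T'] {I : Ideal T} {c : T →+* T'}

/-- Density gives the congruence modulo `p` only up to powers of the ideal; that `(p)` is closed is
the separate statement `natCast_dvd_of_forall_mem`. -/
theorem dvd_sub_pow_of_closed {p : ℕ} (H : IsCompletion I c) {ψ : T →+* T}
    (hψ : IsFrobeniusLift p ψ) (hI : I ≤ I.comap ψ) {ψ' : T' →+* T'}
    (hψ' : ψ'.comp c = c.comp ψ) (x : T') (n : ℕ) :
    ψ' x - x ^ p ∈ Ideal.span {(p : T')} ⊔ (I.map c) ^ n := by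
  obtain ⟨t, ht⟩ := H.dense x n
  have h1 : ψ' (x - c t) ∈ (I.map c) ^ n := by
    refine map_pow_le (g := c.comp ψ) ?_ hψ' ht
    rw [← Ideal.comap_comap]
    exact hI.trans (Ideal.comap_mono Ideal.le_comap_map)
  obtain ⟨s, hs⟩ := hψ t
  have h2 : ψ' (c t) - c t ^ p = p * c s := by
    have : ψ' (c t) = c (ψ t) := congrArg (fun f => f t) hψ'
    rw [this, ← map_pow, ← map_sub, hs, map_mul, map_natCast]
  have h3 : x ^ p - c t ^ p ∈ (I.map c) ^ n :=
    Ideal.mem_of_dvd _ (sub_dvd_pow_sub_pow _ _ _) ht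
  have : ψ' x - x ^ p = p * c s + (ψ' (x - c t) - (x ^ p - c t ^ p)) := by
    rw [← h2, map_sub]; ring
  rw [this]
  exact Submodule.add_mem_sup (Ideal.mul_mem_right _ _ (Ideal.mem_span_singleton_self _))
    (sub_mem h1 h3)

end Frobenius

end IsCompletion

/-! ### Regular sequences and complete rings -/

section Regular

variable {T : Type*} [CommRing T]

theorem exists_eq_of_mem_span_pair_pow {a b : T} {n : ℕ} {x : T}
    (hx : x ∈ Ideal.span {a, b} ^ (n + 1)) :
    ∃ r, ∃ s ∈ Ideal.span {a, b} ^ n, x = a ^ (n + 1) * r + b * s := by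
  have key : Ideal.span {a, b} ^ (n + 1) ≤
      Ideal.span {a ^ (n + 1)} ⊔ Ideal.span {b} * Ideal.span {a, b} ^ n := by
    clear hx
    induction n with
    | zero => simp [Ideal.span_insert]
    | succ n ih =>
      rw [pow_succ _ (n + 1)]
      refine (Ideal.mul_mono_left ih).trans ?_
      rw [Ideal.sup_mul, mul_assoc, ← pow_succ]
      refine sup_le ?_ le_sup_right
      conv_lhs => rw [Ideal.span_insert]
      rw [Ideal.mul_sup, Ideal.span_singleton_mul_span_singleton, ← pow_succ]
      refine sup_le le_sup_left (le_sup_of_le_right ?_)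
      rw [mul_comm]
      refine Ideal.mul_mono_right ?_
      rw [Ideal.span_singleton_le_iff_mem]
      exact Ideal.pow_mem_pow (Ideal.subset_span (by simp)) _
  obtain ⟨y, hy, z, hz, rfl⟩ := Submodule.mem_sup.1 (key hx)
  obtain ⟨r, rfl⟩ := Ideal.mem_span_singleton.1 hy
  obtain ⟨s, hs, rfl⟩ := Ideal.mem_span_singleton_mul.1 hz
  exact ⟨r, s, hs, rfl⟩

/-- For the regular sequence `e, a`, multiplication by `e` raises the `(a, e)`-adic order by exactly
one. Indeed from `e t = a^(n+1) r + e s` regularity of `a` modulo `e` makes `r` a multiple of `e`,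
which can then be cancelled. -/
theorem mem_pow_of_mul_mem_pow_succ {a e : T} (he : ∀ x, e * x = 0 → x = 0)
    (ha : NZDMod (Ideal.span {e}) a) (n : ℕ) (t : T) (h : e * t ∈ Ideal.span {a, e} ^ (n + 1)) :
    t ∈ Ideal.span {a, e} ^ n := by
  obtain ⟨r, s, hs, h1⟩ := exists_eq_of_mem_span_pair_pow h
  have h2 : a ^ (n + 1) * r ∈ Ideal.span {e} :=
    Ideal.mem_span_singleton.2 ⟨t - s, by linear_combination -h1⟩
  obtain ⟨r', rfl⟩ := Ideal.mem_span_singleton.1 (ha.pow (n + 1) r h2)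
  have h3 : t = a ^ (n + 1) * r' + s := by
    refine sub_eq_zero.1 (he _ ?_)
    linear_combination h1
  rw [h3]
  refine add_mem (Ideal.mul_mem_right _ _ (Ideal.pow_le_pow_right n.le_succ
    (Ideal.pow_mem_pow (Ideal.subset_span (by simp)) _))) hs

theorem mem_pow_of_mul_mem_singleton_pow_succ {a : T} (ha : ∀ x, a * x = 0 → x = 0) (n : ℕ) (t : T)
    (h : a * t ∈ Ideal.span {a} ^ (n + 1)) : t ∈ Ideal.span {a} ^ n := by
  rw [Ideal.span_singleton_pow, Ideal.mem_span_singleton] at h ⊢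
  obtain ⟨r, hr⟩ := h
  exact ⟨r, sub_eq_zero.1 (ha _ (by rw [pow_succ'] at hr; linear_combination hr))⟩

variable {p : ℕ} {E : T} {J : Ideal T}

/-- An element killed by `p` is a multiple of `E`, the quotient is again killed by `p`, and so on:
the element lies in every `(Eⁿ)`. -/
theorem natCast_torsionFree_of_complete [IsAdicComplete J T] (hEJ : E ∈ J)
    (hE : ∀ x, E * x = 0 → x = 0) (hp : NZDMod (Ideal.span {E}) (p : T)) (x : T)
    (hx : (p : T) * x = 0) : x = 0 := by
  refine IsAdicComplete.eq_zero_of_forall_mem J fun n => ?_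
  have key : ∃ x', x = E ^ n * x' ∧ (p : T) * x' = 0 := by
    induction n with
    | zero => exact ⟨x, by simp, hx⟩
    | succ n ih =>
      obtain ⟨x', rfl, h'⟩ := ih
      obtain ⟨x'', rfl⟩ := Ideal.mem_span_singleton.1 (hp x' (by rw [h']; exact zero_mem _))
      exact ⟨x'', by ring, hE _ (by linear_combination h')⟩
  obtain ⟨x', rfl, -⟩ := key
  exact Ideal.mul_mem_right _ _ (Ideal.pow_mem_pow hEJ n)

theorem pow_dvd_of_dvd_mul (hE : ∀ x, E * x = 0 → x = 0) (hp : NZDMod (Ideal.span {E}) (p : T))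
    (n : ℕ) {a b : T} (h : (p : T) * a = E ^ n * b) : E ^ n ∣ a := by
  induction n generalizing a b with
  | zero => simp
  | succ n ih =>
    obtain ⟨a', rfl⟩ := Ideal.mem_span_singleton.1 (hp a (Ideal.mem_span_singleton.2
      ⟨E ^ n * b, by rw [h]; ring⟩))
    have h2 := ih (a := a') (b := b) (sub_eq_zero.1 (hE _ (by linear_combination h)))
    rw [pow_succ']
    exact mul_dvd_mul_left E h2

/-- Write `x = p a_n + Eⁿ b_n`. Then `p (a_{n+1} - a_n)` is divisible by `Eⁿ`, hence so is `a_{n+1}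
- a_n`, and the limit of the `a_n` is the quotient of `x` by `p`. -/
theorem natCast_dvd_of_forall_mem [IsAdicComplete J T] (hJ : J = Ideal.span {(p : T), E})
    (hE : ∀ x, E * x = 0 → x = 0) (hp : NZDMod (Ideal.span {E}) (p : T)) (x : T)
    (hx : ∀ n, x ∈ Ideal.span {(p : T)} ⊔ J ^ n) : (p : T) ∣ x := by
  have hEJ : E ∈ J := by rw [hJ]; exact Ideal.subset_span (by simp)
  have hpow : ∀ n, J ^ n ≤ Ideal.span {(p : T)} ⊔ Ideal.span {E ^ n} := by
    intro n
    induction n with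
    | zero => simp
    | succ n ih =>
      rw [pow_succ]
      refine (Ideal.mul_mono_left ih).trans ?_
      rw [hJ, Ideal.span_insert, Ideal.sup_mul, Ideal.mul_sup, Ideal.mul_sup,
        Ideal.span_singleton_mul_span_singleton (E ^ n) E, ← pow_succ]
      refine sup_le ?_ (sup_le ?_ le_sup_right)
      · exact le_sup_of_le_left (sup_le Ideal.mul_le_left Ideal.mul_le_left)
      · exact le_sup_of_le_left Ideal.mul_le_right
  have h1 : ∀ n, ∃ a b, x = p * a + E ^ n * b := fun n => by
    obtain ⟨a, ha, b, hb, rfl⟩ := Submodule.mem_sup.1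
      ((sup_le le_sup_left (hpow n) : Ideal.span {(p : T)} ⊔ J ^ n ≤ _) (hx n))
    obtain ⟨a, rfl⟩ := Ideal.mem_span_singleton.1 ha
    obtain ⟨b, rfl⟩ := Ideal.mem_span_singleton.1 hb
    exact ⟨a, b, rfl⟩
  choose a b hab using h1
  obtain ⟨L, hL⟩ := IsAdicComplete.exists_limit J a fun n => by
    have h2 : (p : T) * (a (n + 1) - a n) = E ^ n * (b n - E * b (n + 1)) := by
      linear_combination (hab n) - (hab (n + 1))
    obtain ⟨z, hz⟩ := pow_dvd_of_dvd_mul hE hp n h2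
    rw [hz]
    exact Ideal.mul_mem_right _ _ (Ideal.pow_mem_pow hEJ n)
  refine ⟨L, sub_eq_zero.1 (IsAdicComplete.eq_zero_of_forall_mem J fun n => ?_)⟩
  have : x - p * L = E ^ n * b n - p * (L - a n) := by linear_combination hab n
  rw [this]
  exact sub_mem (Ideal.mul_mem_right _ _ (Ideal.pow_mem_pow hEJ n))
    (Ideal.mul_mem_left _ _ (hL n))

/-- The inverse of `a_n ↦ a_n - f a_{n+1}` sends `b` to the convergent series `∑ fⁱ b_{n+i}`. -/
theorem isDerivedComplete_of_isAdicComplete [IsAdicComplete J T] : IsDerivedComplete J := by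
  intro f hf
  constructor
  · intro a b hab
    have h1 : ∀ n, a n - b n = f * (a (n + 1) - b (n + 1)) := fun n => by
      have := congrFun hab n
      simp only at this
      linear_combination this
    have h2 : ∀ k n, a n - b n = f ^ k * (a (n + k) - b (n + k)) := by
      intro k
      induction k with
      | zero => simp
      | succ k ih => intro n; rw [ih n, h1 (n + k), pow_succ]; ring_nf
    funext n
    refine sub_eq_zero.1 (IsAdicComplete.eq_zero_of_forall_mem J fun k => ?_)
    rw [h2 k n]
    exact Ideal.mul_mem_right _ _ (Ideal.pow_mem_pow hf k)
  · intro b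
    have h1 : ∀ n, ∃ L, ∀ k, L - ∑ i ∈ Finset.range k, f ^ i * b (n + i) ∈ J ^ k := fun n =>
      IsAdicComplete.exists_limit J (fun k => ∑ i ∈ Finset.range k, f ^ i * b (n + i)) fun k => by
        rw [Finset.sum_range_succ, add_sub_cancel_left]
        exact Ideal.mul_mem_right _ _ (Ideal.pow_mem_pow hf k)
    choose a ha using h1
    refine ⟨a, funext fun n => sub_eq_zero.1
      (IsAdicComplete.eq_zero_of_forall_mem J fun k => ?_)⟩
    have h2 : ∑ i ∈ Finset.range (k + 1), f ^ i * b (n + i) =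
        b n + f * ∑ i ∈ Finset.range k, f ^ i * b (n + 1 + i) := by
      rw [Finset.sum_range_succ', Finset.mul_sum, add_comm]
      congr 1
      · simp
      · refine Finset.sum_congr rfl fun i _ => ?_
        rw [pow_succ', mul_assoc, add_assoc n 1 i, add_comm 1 i]
    have h3 : a n - f * a (n + 1) - b n =
        (a n - ∑ i ∈ Finset.range (k + 1), f ^ i * b (n + i)) -
          f * (a (n + 1) - ∑ i ∈ Finset.range k, f ^ i * b (n + 1 + i)) := by
      rw [h2]; ring
    rw [h3]
    exact sub_mem (Ideal.pow_le_pow_right k.le_succ (ha n (k + 1)))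
      (Ideal.mul_mem_left _ _ (ha (n + 1) k))

end Regular

end PrismaticEnvelope

namespace PrismaticEnvelope

/-! ### The completed `δ`-envelope -/

theorem invertible_span_singleton {T : Type*} [CommRing T] {e : T}
    (he : ∀ x, e * x = 0 → x = 0) : Module.Invertible T (Ideal.span {e}) := by
  have hinj : Function.Injective (LinearMap.toSpanSingleton T T e) := by
    rw [← LinearMap.ker_eq_bot, LinearMap.ker_eq_bot']
    intro x hx
    exact he x (by rw [mul_comm]; simpa using hx)
  exact Module.Invertible.congr ((LinearEquiv.ofInjective _ hinj).trans
    (LinearEquiv.ofEq _ _ (LinearMap.range_toSpanSingleton e)))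

variable {p : ℕ} {B A R C C' : Type*} [CommRing B] [CommRing A] [CommRing R]
  {φ : B →+* B} {φA : A →+* A} {E : B} {y : C → B} {π : B →+* A} {q : A →+* R}

namespace EnvHyp

/-- The ideal `(p, E)` of the `δ`-envelope. -/
noncomputable abbrev _root_.PrismaticEnvelope.envIdeal (p : ℕ) (φ : B →+* B) (E : B) (y : C → B) :
    Ideal (DeltaEnv p φ E y) :=
  Ideal.span {(p : DeltaEnv p φ E y), algebraMap B (DeltaEnv p φ E y) E}

theorem isCompletion_env : IsCompletion (envIdeal p φ E y)
    (algebraMap (DeltaEnv p φ E y) (ComplEnv p φ E y)) :=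
  isCompletion_adicCompletion (Submodule.fg_span (by simp))

theorem map_envIdeal : (envIdeal p φ E y).map (algebraMap (DeltaEnv p φ E y) (ComplEnv p φ E y)) =
    Ideal.span {(p : ComplEnv p φ E y), algebraMap B (ComplEnv p φ E y) E} := by
  rw [Ideal.map_span, Set.image_pair, map_natCast]
  rfl

variable (H : EnvHyp p φ E y)
include H

theorem env_mul_eq_zero (x : DeltaEnv p φ E y) (hx : algebraMap B (DeltaEnv p φ E y) E * x = 0) :
    x = 0 := by
  obtain ⟨x, rfl⟩ := Ideal.Quotient.mk_surjective x
  refine Ideal.Quotient.eq_zero_iff_mem.2 (H.nzdMod_E x (Ideal.Quotient.eq_zero_iff_mem.1 ?_))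
  rw [map_mul]
  exact hx

theorem env_nzdMod_p : NZDMod (Ideal.span {algebraMap B (DeltaEnv p φ E y) E})
    (p : DeltaEnv p φ E y) := by
  have hspan : Ideal.span {algebraMap B (DeltaEnv p φ E y) E} =
      (Ideal.span {MvPolynomial.C E}).map (Ideal.Quotient.mk (deltaRel p φ E y)) := by
    rw [Ideal.map_span, Set.image_singleton]; rfl
  have hiff : ∀ x, Ideal.Quotient.mk (deltaRel p φ E y) x ∈
      Ideal.span {algebraMap B (DeltaEnv p φ E y) E} ↔
      x ∈ Ideal.span {MvPolynomial.C E} ⊔ deltaRel p φ E y := fun x => by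
    rw [hspan, ← Ideal.mem_comap, Ideal.comap_map_of_surjective' _ Ideal.Quotient.mk_surjective,
      Ideal.mk_ker]
  intro x hx
  obtain ⟨x, rfl⟩ := Ideal.Quotient.mk_surjective x
  rw [hiff]
  refine H.nzdMod_p x ((hiff _).1 ?_)
  rw [map_mul, map_natCast]
  exact hx

theorem env_mem_pow (n : ℕ) (t : DeltaEnv p φ E y)
    (h : algebraMap B (DeltaEnv p φ E y) E * t ∈ envIdeal p φ E y ^ (n + 1)) :
    t ∈ envIdeal p φ E y ^ n :=
  mem_pow_of_mul_mem_pow_succ H.env_mul_eq_zero H.env_nzdMod_p n t h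

theorem compl_mul_eq_zero (x : ComplEnv p φ E y) (hx : algebraMap B (ComplEnv p φ E y) E * x = 0) :
    x = 0 :=
  isCompletion_env.mul_eq_zero H.env_mem_pow hx

end EnvHyp

theorem exists_frobenius_env (hp : p.Prime) (hφ : IsFrobeniusLift p φ) :
    ∃ ψ : DeltaEnv p φ E y →+* DeltaEnv p φ E y, IsFrobeniusLift p ψ ∧
      (∀ b, ψ (algebraMap B _ b) = algebraMap B _ (φ b)) ∧
      ∀ c n, ψ (DeltaEnv.z p φ E y c n) = DeltaEnv.z p φ E y c n ^ p +
        (p : DeltaEnv p φ E y) * DeltaEnv.z p φ E y c (n + 1) := by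
  refine ⟨Ideal.quotientMap _ (freeFrob p φ C) (deltaRel_le_comap_freeFrob hp hφ), ?_, ?_, ?_⟩
  · intro x
    obtain ⟨x, rfl⟩ := Ideal.Quotient.mk_surjective x
    obtain ⟨w, hw⟩ := isFrobeniusLift_freeFrob (C := C) hp hφ x
    rw [Ideal.quotientMap_mk, ← map_pow, ← map_sub, hw, map_mul, map_natCast]
    exact dvd_mul_right _ _
  · intro b
    exact congrArg (Ideal.Quotient.mk _) (freeFrob_C b)
  · intro c n
    refine (congrArg (Ideal.Quotient.mk (deltaRel p φ E y)) (freeFrob_X (c, n))).trans ?_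
    rw [map_add, map_mul, map_pow, map_natCast]
    rfl

theorem isCompletion_pdPoly : IsCompletion (Ideal.span {(p : PdPoly p R C')})
    (algebraMap (PdPoly p R C') (ComplPdPoly p R C')) :=
  isCompletion_adicCompletion (Submodule.fg_span (by simp))

theorem ComplPdPoly.natCast_torsionFree (x : ComplPdPoly p R C')
    (hx : (p : ComplPdPoly p R C') * x = 0) : x = 0 := by
  refine isCompletion_pdPoly.mul_eq_zero (e := (p : PdPoly p R C')) (fun n t h => ?_)
    (by rw [map_natCast]; exact hx)
  exact mem_pow_of_mul_mem_singleton_pow_succ PdPoly.natCast_torsionFree n t h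

namespace ResidueHyp

variable (H : EnvHyp p φ E y) (G : ResidueHyp p φ φA E y π q) (κ : C ≃ C')
include H G

theorem exists_complEnvToPd : ∃ (g : DeltaEnv p φ E y →+* PdPoly p R C')
    (h : ComplEnv p φ E y →+* ComplPdPoly p R C'),
    (Function.Surjective g ∧
      (∀ x, g x = 0 ↔ x ∈ Ideal.span {algebraMap B (DeltaEnv p φ E y) E}) ∧
      (∀ b, g (algebraMap B _ b) = algebraMap R _ (q (π b))) ∧
      ∀ c, g (DeltaEnv.z p φ E y c 0) = PdPoly.z p R (κ c)) ∧
    Function.Surjective h ∧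
    (∀ x, h x = 0 ↔ x ∈ Ideal.span {algebraMap B (ComplEnv p φ E y) E}) ∧
    (∀ b, h (algebraMap B _ b) = algebraMap R _ (q (π b))) ∧
    (∀ c, h (ComplEnv.z p φ E y c 0) = ComplPdPoly.z p R (κ c)) ∧
    h.comp (algebraMap (DeltaEnv p φ E y) (ComplEnv p φ E y)) =
      (algebraMap (PdPoly p R C') (ComplPdPoly p R C')).comp g := by
  obtain ⟨g, hg, hker, hB, hz⟩ := G.exists_envToPd H κ
  have hE : g (algebraMap B (DeltaEnv p φ E y) E) = 0 :=
    (hker _).2 (Ideal.mem_span_singleton_self _)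
  have hI : (envIdeal p φ E y).map g = Ideal.span {(p : PdPoly p R C')} := by
    rw [Ideal.map_span, Set.image_pair, hE, map_natCast, Ideal.span_pair_comm, Ideal.span_insert_zero]
  have := (isCompletion_pdPoly (p := p) (R := R) (C' := C')).complete
  obtain ⟨h, hh⟩ := EnvHyp.isCompletion_env.exists_lift
    ((Ideal.span {(p : PdPoly p R C')}).map (algebraMap (PdPoly p R C') (ComplPdPoly p R C')))
    ((algebraMap (PdPoly p R C') (ComplPdPoly p R C')).comp g) (by
      rw [← Ideal.map_le_iff_le_comap, ← Ideal.map_map, hI])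
  have hh' : ∀ t, h (algebraMap _ _ t) = algebraMap _ _ (g t) := fun t =>
    congrArg (fun f => f t) hh
  refine ⟨g, h, ⟨hg, hker, hB, hz⟩,
    EnvHyp.isCompletion_env.surjective_of_surjective isCompletion_pdPoly hg hI hh', ?_, ?_, ?_, hh⟩
  · exact EnvHyp.isCompletion_env.eq_zero_iff_mem_span isCompletion_pdPoly hg hI hh' hker
      H.env_mem_pow
  · intro b
    refine (hh' (algebraMap B _ b)).trans ?_
    rw [hB]; rfl
  · intro c
    refine (hh' (DeltaEnv.z p φ E y c 0)).trans ?_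
    rw [hz]; rfl

/-- The quotient by `E` is a completed divided power ring, which has no `p`-torsion. -/
theorem compl_nzdMod_p : NZDMod (Ideal.span {algebraMap B (ComplEnv p φ E y) E})
    (p : ComplEnv p φ E y) := by
  obtain ⟨-, h, -, -, hker, -⟩ := G.exists_complEnvToPd H (Equiv.refl C)
  intro x hx
  rw [← hker] at hx ⊢
  rw [map_mul, map_natCast] at hx
  exact ComplPdPoly.natCast_torsionFree _ hx

theorem compl_natCast_torsionFree (x : ComplEnv p φ E y) (hx : (p : ComplEnv p φ E y) * x = 0) :
    x = 0 := by
  have := (EnvHyp.isCompletion_env (p := p) (φ := φ) (E := E) (y := y)).complete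
  refine natCast_torsionFree_of_complete (E := algebraMap B (ComplEnv p φ E y) E)
    (J := (envIdeal p φ E y).map (algebraMap (DeltaEnv p φ E y) (ComplEnv p φ E y))) ?_
    H.compl_mul_eq_zero (G.compl_nzdMod_p H) x hx
  rw [EnvHyp.map_envIdeal]
  exact Ideal.subset_span (by simp)

/-- The completed `δ`-envelope is a bounded prism. -/
theorem exists_isBoundedPrism : ∃ D : DeltaStructure p (ComplEnv p φ E y),
    (∀ b, D.frob (algebraMap B _ b) = algebraMap B _ (φ b)) ∧
    (∀ c n, D.δ (ComplEnv.z p φ E y c n) = ComplEnv.z p φ E y c (n + 1)) ∧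
    IsBoundedPrism D (Ideal.span {algebraMap B (ComplEnv p φ E y) E}) := by
  have hc := EnvHyp.isCompletion_env (p := p) (φ := φ) (E := E) (y := y)
  have := hc.complete
  obtain ⟨ψ, hψ, hψB, hψz⟩ := exists_frobenius_env (E := E) (y := y) H.prime H.frobeniusLift
  obtain ⟨ε, hε, hφE⟩ := H.distinguished
  have hI : envIdeal p φ E y ≤ (envIdeal p φ E y).comap ψ := by
    refine Ideal.span_le.2 ?_
    rintro _ (rfl | rfl)
    · rw [SetLike.mem_coe, Ideal.mem_comap, map_natCast]
      exact Ideal.subset_span (by simp)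
    · rw [SetLike.mem_coe, Ideal.mem_comap, hψB, hφE, map_add, map_mul, map_pow, map_natCast]
      exact add_mem (Ideal.pow_mem_of_mem _ (Ideal.subset_span (by simp)) _ H.prime.pos)
        (Ideal.mul_mem_right _ _ (Ideal.subset_span (by simp)))
  obtain ⟨ψ', hψ'⟩ := hc.exists_lift
    ((envIdeal p φ E y).map (algebraMap (DeltaEnv p φ E y) (ComplEnv p φ E y)))
    ((algebraMap (DeltaEnv p φ E y) (ComplEnv p φ E y)).comp ψ) (by
      rw [← Ideal.comap_comap]
      exact hI.trans (Ideal.comap_mono Ideal.le_comap_map))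
  have hψ'' : ∀ t, ψ' (algebraMap (DeltaEnv p φ E y) _ t) = algebraMap _ _ (ψ t) := fun t =>
    congrArg (fun f => f t) hψ'
  -- Continuity gives the congruences up to powers of `(p, E)`; closedness of `(p)` turns them into
  -- divisibility.
  have hlift : IsFrobeniusLift p ψ' := fun x =>
    natCast_dvd_of_forall_mem (E := algebraMap B (ComplEnv p φ E y) E)
      EnvHyp.map_envIdeal H.compl_mul_eq_zero (G.compl_nzdMod_p H) _
      (hc.dvd_sub_pow_of_closed hψ hI hψ' x)
  have htf := G.compl_natCast_torsionFree H
  have hB : ∀ b, (deltaOfLift H.prime htf ψ' hlift).frob (algebraMap B (ComplEnv p φ E y) b) =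
      algebraMap B _ (φ b) := fun b => by
    rw [deltaOfLift_frob]
    refine (hψ'' (algebraMap B _ b)).trans ?_
    rw [hψB]; rfl
  refine ⟨deltaOfLift H.prime htf ψ' hlift, hB, ?_, ⟨⟨?_, ?_, ?_⟩, ?_⟩⟩
  · intro c n
    refine sub_eq_zero.1 (htf _ ?_)
    have h1 : ψ' (ComplEnv.z p φ E y c n) = ComplEnv.z p φ E y c n ^ p +
        (p : ComplEnv p φ E y) * ComplEnv.z p φ E y c (n + 1) := by
      refine (hψ'' (DeltaEnv.z p φ E y c n)).trans ?_
      rw [hψz, map_add, map_mul, map_pow, map_natCast]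
      rfl
    rw [mul_sub, deltaOfLift_spec, h1]
    ring
  · exact invertible_span_singleton H.compl_mul_eq_zero
  · have h1 : Ideal.span {(p : ComplEnv p φ E y)} ⊔
        Ideal.span {algebraMap B (ComplEnv p φ E y) E} =
        (envIdeal p φ E y).map (algebraMap (DeltaEnv p φ E y) (ComplEnv p φ E y)) := by
      exact (Ideal.span_insert _ _).symm.trans EnvHyp.map_envIdeal.symm
    rw [h1]
    exact isDerivedComplete_of_isAdicComplete
  · have h1 : (p : ComplEnv p φ E y) * algebraMap B _ ε =
        -algebraMap B (ComplEnv p φ E y) E ^ p +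
          (deltaOfLift H.prime htf ψ' hlift).frob (algebraMap B (ComplEnv p φ E y) E) := by
      rw [hB, hφE, map_add, map_mul, map_pow, map_natCast]; ring
    have h2 : (p : ComplEnv p φ E y) * algebraMap B _ ε ∈
        Ideal.span {algebraMap B (ComplEnv p φ E y) E} ⊔
        Ideal.span ((deltaOfLift H.prime htf ψ' hlift).frob ''
          (Ideal.span {algebraMap B (ComplEnv p φ E y) E} : Set (ComplEnv p φ E y))) := by
      rw [h1]
      exact Submodule.add_mem_sup (neg_mem (Ideal.pow_mem_of_mem _
        (Ideal.mem_span_singleton_self _) _ H.prime.pos))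
        (Ideal.subset_span ⟨_, Ideal.mem_span_singleton_self _, rfl⟩)
    rwa [Ideal.mul_unit_mem_iff_mem _ (hε.map _)] at h2
  -- The bound is `N = 0`, since there is no `p`-torsion modulo `E` at all.
  · refine ⟨0, fun x n hx => ?_⟩
    obtain ⟨x, rfl⟩ := Ideal.Quotient.mk_surjective x
    rw [pow_zero, one_mul, Ideal.Quotient.eq_zero_iff_mem]
    refine (G.compl_nzdMod_p H).pow n x ?_
    rw [← Ideal.Quotient.eq_zero_iff_mem, map_mul, map_pow, map_natCast]
    exact hx

end ResidueHyp

end PrismaticEnvelope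

namespace PrismaticEnvelope

open scoped TensorProduct

/-! ### Totally ramified extensions of Witt vectors -/

theorem natCast_mem_jacobson_of_isAdicComplete {S : Type*} [CommRing S] (p : ℕ)
    [IsAdicComplete (Ideal.span {(p : S)}) S] : (p : S) ∈ Ideal.jacobson (⊥ : Ideal S) :=
  IsAdicComplete.le_jacobson_bot (Ideal.span {(p : S)}) (Ideal.mem_span_singleton_self _)

theorem isUnit_natCast_of_coprime {S : Type*} [CommRing S] (p : ℕ)
    [IsAdicComplete (Ideal.span {(p : S)}) S] {n : ℕ} (hn : p.Coprime n) : IsUnit (n : S) := by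
  obtain ⟨a, b, h⟩ := Nat.isCoprime_iff_coprime.2 hn
  have h1 : (a : S) * p + b * n = 1 := by exact_mod_cast congrArg (Int.cast : ℤ → S) h
  have h2 := Ideal.mem_jacobson_bot.1 (natCast_mem_jacobson_of_isAdicComplete (S := S) p) (-a)
  have h3 : (p : S) * -a + 1 = b * n := by linear_combination -h1
  rw [h3] at h2
  exact isUnit_of_mul_isUnit_right h2

theorem isPrecomplete_pi {S ι : Type*} [CommRing S] (p : ℕ)
    [IsAdicComplete (Ideal.span {(p : S)}) S] :
    IsPrecomplete (Ideal.span {(p : S)}) (ι → S) where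
  prec' a ha := by
    have key : ∀ i, ∃ L : S, ∀ n, a n i ≡ L [SMOD ((Ideal.span {(p : S)}) ^ n • ⊤ : Ideal S)] := by
      intro i
      refine IsPrecomplete.prec (I := Ideal.span {(p : S)}) inferInstance fun {m n} hmn => ?_
      obtain ⟨z, hz⟩ := (smodEq_span_natCast_iff p m _ _).1 (ha hmn)
      exact (smodEq_span_natCast_iff p m _ _).2 ⟨z i, congrFun hz i⟩
    choose L hL using key
    refine ⟨L, fun n => ?_⟩
    choose z hz using fun i => (smodEq_span_natCast_iff p n _ _).1 (hL i n)
    exact (smodEq_span_natCast_iff p n _ _).2 ⟨z, funext hz⟩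

section Eisenstein

variable {p : ℕ} [Fact p.Prime] {k : Type*} [Field k] [CharP k p] [PerfectRing k p]
variable {OK : Type*} [CommRing OK] [IsDomain OK] [IsDiscreteValuationRing OK] [CharZero OK]
  [IsAdicComplete (IsLocalRing.maximalIdeal OK) OK] [Algebra (WittVector p k) OK]

theorem isTorsionFree_wittVector {T : Type*} [CommRing T] [IsDomain T] [CharZero T]
    [Algebra (WittVector p k) T] : Module.IsTorsionFree (WittVector p k) T := by
  rw [Module.isTorsionFree_iff_algebraMap_injective, injective_iff_map_eq_zero]
  intro a ha
  by_contra h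
  obtain ⟨n, b, rfl⟩ := WittVector.exists_eq_pow_p_mul' a h
  rw [map_mul, map_pow, map_natCast] at ha
  have h1 := (b.isUnit.map (algebraMap (WittVector p k) T)).ne_zero
  have h2 : ((p : T) ^ n) ≠ 0 :=
    pow_ne_zero _ (Nat.cast_ne_zero.2 (Fact.out : p.Prime).ne_zero)
  exact mul_ne_zero h2 h1 ha

theorem isPrime_span_natCast_wittVector :
    (Ideal.span {(p : WittVector p k)}).IsPrime :=
  (Ideal.span_singleton_prime (WittVector.irreducible p).ne_zero).2
    (WittVector.irreducible p).prime

variable {ϖ : OK} {E : Polynomial (WittVector p k)}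

theorem natDegree_pos_of_aeval_eq_zero (hEmonic : E.Monic) (hEroot : Polynomial.aeval ϖ E = 0) :
    0 < E.natDegree := by
  rw [Nat.pos_iff_ne_zero]
  intro h
  rw [hEmonic.natDegree_eq_zero.1 h, map_one] at hEroot
  exact one_ne_zero hEroot

theorem minpoly_eq_of_isEisensteinAt (hEmonic : E.Monic)
    (hEeis : E.IsEisensteinAt (Ideal.span {(p : WittVector p k)}))
    (hEroot : Polynomial.aeval ϖ E = 0) : minpoly (WittVector p k) ϖ = E := by
  have := isTorsionFree_wittVector (p := p) (k := k) (T := OK)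
  have hint : IsIntegral (WittVector p k) ϖ := ⟨E, hEmonic, hEroot⟩
  have hirr := hEeis.irreducible isPrime_span_natCast_wittVector hEmonic.isPrimitive
    (natDegree_pos_of_aeval_eq_zero hEmonic hEroot)
  obtain ⟨q, hq⟩ := minpoly.isIntegrallyClosed_dvd hint hEroot
  have h1 : ¬ IsUnit (minpoly (WittVector p k) ϖ) := minpoly.not_isUnit _ _
  have h2 := (hirr.isUnit_or_isUnit hq).resolve_left h1
  refine Polynomial.eq_of_monic_of_associated (minpoly.monic hint) hEmonic ⟨h2.unit, ?_⟩
  rw [hq]; rfl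

/-- If `p` were nonzero in the residue field, its inverse would come from some `b` in `W`; but `1 -
p b` is a unit of `W`, and it would map to `0`. -/
theorem natCast_mem_maximalIdeal
    (hres : Function.Surjective (algebraMap (WittVector p k) (IsLocalRing.ResidueField OK))) :
    (p : OK) ∈ IsLocalRing.maximalIdeal OK := by
  rw [← IsLocalRing.residue_eq_zero_iff]
  by_contra hp
  obtain ⟨b, hb⟩ := hres (IsLocalRing.residue OK p)⁻¹
  have h1 : algebraMap (WittVector p k) (IsLocalRing.ResidueField OK) (p * b) = 1 := by
    rw [map_mul, hb, map_natCast, ← map_natCast (IsLocalRing.residue OK)]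
    exact mul_inv_cancel₀ hp
  have h2 : (p * b : WittVector p k) ∈ nonunits _ := fun h =>
    (WittVector.irreducible p).not_isUnit (isUnit_of_mul_isUnit_left h)
  have h3 := IsLocalRing.isUnit_one_sub_self_of_mem_nonunits _ h2
  have h4 := h3.map (algebraMap (WittVector p k) (IsLocalRing.ResidueField OK))
  rw [map_sub, map_one, h1, sub_self] at h4
  exact not_isUnit_zero h4

theorem pow_natDegree_mem_span (hEmonic : E.Monic)
    (hEeis : E.IsEisensteinAt (Ideal.span {(p : WittVector p k)}))
    (hEroot : Polynomial.aeval ϖ E = 0) : (p : OK) ∣ ϖ ^ E.natDegree := by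
  rw [Polynomial.aeval_eq_sum_range, Finset.sum_range_succ, hEmonic.coeff_natDegree, one_smul]
    at hEroot
  rw [eq_neg_of_add_eq_zero_right hEroot, dvd_neg]
  refine Finset.dvd_sum fun i hi => ?_
  obtain ⟨a, ha⟩ := Ideal.mem_span_singleton.1 (hEeis.mem (Finset.mem_range.1 hi))
  rw [ha, Algebra.smul_def, map_mul, map_natCast, mul_assoc]
  exact dvd_mul_right _ _

theorem exists_sub_aeval_mem_pow
    (hres : Function.Surjective (algebraMap (WittVector p k) (IsLocalRing.ResidueField OK)))
    (hϖ : Irreducible ϖ) (n : ℕ) (x : OK) :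
    ∃ P : Polynomial (WittVector p k), ϖ ^ n ∣ x - Polynomial.aeval ϖ P := by
  induction n generalizing x with
  | zero => exact ⟨0, by simp⟩
  | succ n ih =>
    obtain ⟨a, ha⟩ := hres (IsLocalRing.residue OK x)
    have h1 : x - algebraMap (WittVector p k) OK a ∈ IsLocalRing.maximalIdeal OK := by
      rw [← IsLocalRing.residue_eq_zero_iff, map_sub, ← ha, sub_eq_zero]
      rfl
    rw [(IsDiscreteValuationRing.irreducible_iff_uniformizer ϖ).1 hϖ,
      Ideal.mem_span_singleton] at h1
    obtain ⟨y, hy⟩ := h1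
    obtain ⟨P, z, hz⟩ := ih y
    refine ⟨Polynomial.C a + Polynomial.X * P, z, ?_⟩
    rw [map_add, map_mul, Polynomial.aeval_C, Polynomial.aeval_X]
    linear_combination hy + ϖ * hz

/-- A complete form of Nakayama: the powers of `ϖ` below `deg E` span `𝒪_K` modulo `p`. Surjectivity
lifts because a finite power of `W` is `p`-adically complete and `𝒪_K` is `p`-adically separated. -/
theorem adjoin_uniformizer_eq_top
    (hres : Function.Surjective (algebraMap (WittVector p k) (IsLocalRing.ResidueField OK)))
    (hϖ : Irreducible ϖ) (hEmonic : E.Monic)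
    (hEeis : E.IsEisensteinAt (Ideal.span {(p : WittVector p k)}))
    (hEroot : Polynomial.aeval ϖ E = 0) : Algebra.adjoin (WittVector p k) {ϖ} = ⊤ := by
  have hpre : IsPrecomplete (Ideal.span {(p : WittVector p k)})
    (Fin E.natDegree → WittVector p k) := isPrecomplete_pi p
  have hhaus : IsHausdorff (Ideal.span {(p : WittVector p k)}) OK := by
    refine ⟨fun x hx => ?_⟩
    refine IsAdicComplete.eq_zero_of_forall_mem (IsLocalRing.maximalIdeal OK) fun n => ?_
    obtain ⟨z, hz⟩ := (smodEq_span_natCast_iff p n _ _).1 (hx n)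
    rw [sub_zero, Algebra.smul_def, map_pow, map_natCast] at hz
    rw [hz]
    exact Ideal.mul_mem_right _ _ (Ideal.pow_mem_pow (natCast_mem_maximalIdeal hres) n)
  have hE1 : E ≠ 1 := by
    rintro rfl
    simp at hEroot
  have hsurj : Function.Surjective
      (Fintype.linearCombination (WittVector p k) fun i : Fin E.natDegree => ϖ ^ (i : ℕ)) := by
    refine surjective_of_mkQ_comp_surjective (I := Ideal.span {(p : WittVector p k)}) ?_
    intro x
    obtain ⟨x, rfl⟩ := Submodule.mkQ_surjective _ x
    -- Precision `deg E` suffices, since `p` divides `ϖ ^ deg E` by the Eisenstein equation.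
    obtain ⟨P, hP⟩ := exists_sub_aeval_mem_pow hres hϖ E.natDegree x
    obtain ⟨y, hy⟩ := (pow_natDegree_mem_span hEmonic hEeis hEroot).trans hP
    refine ⟨fun i => (P %ₘ E).coeff i, ?_⟩
    rw [LinearMap.comp_apply, ← sub_eq_zero, ← map_sub, ← LinearMap.mem_ker,
      Submodule.ker_mkQ]
    have h1 : Fintype.linearCombination (WittVector p k) (fun i : Fin E.natDegree => ϖ ^ (i : ℕ))
        (fun i => (P %ₘ E).coeff i) = Polynomial.aeval ϖ P := by
      rw [Fintype.linearCombination_apply, Finset.sum_fin_eq_sum_range,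
        ← Polynomial.aeval_modByMonic_eq_self_of_root (p := P) hEroot,
        Polynomial.aeval_eq_sum_range' (Polynomial.natDegree_modByMonic_lt P hEmonic hE1)]
      exact Finset.sum_congr rfl fun i hi => by rw [dif_pos (Finset.mem_range.1 hi)]
    rw [h1, ← neg_sub, hy, neg_mem_iff, ← map_natCast (algebraMap (WittVector p k) OK),
      ← Algebra.smul_def]
    exact Submodule.smul_mem_smul (Ideal.mem_span_singleton_self _) trivial
  rw [eq_top_iff]
  rintro x -
  obtain ⟨a, rfl⟩ := hsurj x
  rw [Fintype.linearCombination_apply]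
  exact sum_mem fun i _ => Subalgebra.smul_mem _
    (pow_mem (Algebra.subset_adjoin (Set.mem_singleton ϖ)) (i : ℕ)) (a i)

/-- `𝒪_K = W[u]/E`. -/
theorem exists_isAdjoinRootMonic
    (hres : Function.Surjective (algebraMap (WittVector p k) (IsLocalRing.ResidueField OK)))
    (hϖ : Irreducible ϖ) (hEmonic : E.Monic)
    (hEeis : E.IsEisensteinAt (Ideal.span {(p : WittVector p k)}))
    (hEroot : Polynomial.aeval ϖ E = 0) :
    ∃ h : IsAdjoinRootMonic OK E, h.toIsAdjoinRoot.root = ϖ := by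
  have := isTorsionFree_wittVector (p := p) (k := k) (T := OK)
  have hint : IsIntegral (WittVector p k) ϖ := ⟨E, hEmonic, hEroot⟩
  have hm := minpoly_eq_of_isEisensteinAt hEmonic hEeis hEroot
  have h2 : (IsAdjoinRootMonic.mkOfAdjoinEqTop hint
    (adjoin_uniformizer_eq_top hres hϖ hEmonic hEeis hEroot)).toIsAdjoinRoot.root = ϖ := by
    simp
  revert h2
  generalize IsAdjoinRootMonic.mkOfAdjoinEqTop hint
    (adjoin_uniformizer_eq_top hres hϖ hEmonic hEeis hEroot) = h'
  intro h2
  subst hm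
  exact ⟨h', h2⟩

/-! ### The base change of `𝒪_K` to `R₀` -/

variable {R₀ : Type*} [CommRing R₀] [Algebra (WittVector p k) R₀]

theorem tensor_natCast_torsionFree (h : IsAdjoinRootMonic OK E)
    (htf : ∀ x : R₀, (p : R₀) * x = 0 → x = 0) (x : R₀ ⊗[WittVector p k] OK)
    (hx : (p : R₀ ⊗[WittVector p k] OK) * x = 0) : x = 0 := by
  let b := Algebra.TensorProduct.basis R₀ h.basis
  refine b.ext_elem fun i => ?_
  rw [map_zero]
  refine htf _ ?_
  have h1 : (p : R₀) • x = 0 := by rw [Algebra.smul_def, map_natCast, hx]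
  have h2 := congrArg (fun y => b.repr y i) h1
  simpa using h2

theorem aeval_tmul_uniformizer (h : IsAdjoinRootMonic OK E) (hroot : h.toIsAdjoinRoot.root = ϖ)
    (P : Polynomial R₀) (hP : P.natDegree < E.natDegree) :
    Polynomial.aeval ((1 : R₀) ⊗ₜ[WittVector p k] ϖ) P =
      ∑ i : Fin E.natDegree, P.coeff i • (Algebra.TensorProduct.basis R₀ h.basis i) := by
  rw [Polynomial.aeval_eq_sum_range' hP, Finset.sum_fin_eq_sum_range]
  refine Finset.sum_congr rfl fun i hi => ?_
  rw [dif_pos (Finset.mem_range.1 hi), Algebra.TensorProduct.basis_apply, h.basis_apply, hroot,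
    Algebra.TensorProduct.tmul_pow, one_pow]

theorem aeval_tmul_root (h : IsAdjoinRootMonic OK E) (hroot : h.toIsAdjoinRoot.root = ϖ) :
    Polynomial.aeval ((1 : R₀) ⊗ₜ[WittVector p k] ϖ)
      (E.map (algebraMap (WittVector p k) R₀)) = 0 := by
  rw [Polynomial.aeval_map_algebraMap]
  have h1 : (1 : R₀) ⊗ₜ[WittVector p k] ϖ =
      Algebra.TensorProduct.includeRight (R := WittVector p k) (A := R₀) ϖ := rfl
  rw [h1, Polynomial.aeval_algHom_apply, ← hroot, h.aeval_root_self, map_zero]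

theorem aeval_tmul_eq_zero_iff (h : IsAdjoinRootMonic OK E) (hroot : h.toIsAdjoinRoot.root = ϖ)
    (P : Polynomial R₀) :
    Polynomial.aeval ((1 : R₀) ⊗ₜ[WittVector p k] ϖ) P = 0 ↔
      E.map (algebraMap (WittVector p k) R₀) ∣ P := by
  have hmon : (E.map (algebraMap (WittVector p k) R₀)).Monic := h.monic.map _
  constructor
  · intro hP
    nontriviality R₀
    have hE1 : E.map (algebraMap (WittVector p k) R₀) ≠ 1 := by
      intro h1
      have h2 := h.deg_pos
      rw [← h.monic.natDegree_map (algebraMap (WittVector p k) R₀), h1] at h2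
      simp at h2
    have hlt := Polynomial.natDegree_modByMonic_lt P hmon hE1
    rw [h.monic.natDegree_map] at hlt
    rw [← Polynomial.modByMonic_eq_zero_iff_dvd hmon]
    rw [← Polynomial.aeval_modByMonic_eq_self_of_root (aeval_tmul_root h hroot),
      aeval_tmul_uniformizer h hroot _ hlt] at hP
    have hli := Fintype.linearIndependent_iff.1
      (Algebra.TensorProduct.basis R₀ h.basis).linearIndependent _ hP
    ext i
    rw [Polynomial.coeff_zero]
    by_cases hi : i < E.natDegree
    · exact hli ⟨i, hi⟩
    · exact Polynomial.coeff_eq_zero_of_natDegree_lt (by omega)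
  · rintro ⟨Q, rfl⟩
    rw [map_mul, aeval_tmul_root h hroot, zero_mul]

theorem aeval_tmul_surjective (h : IsAdjoinRootMonic OK E)
    (hroot : h.toIsAdjoinRoot.root = ϖ) :
    Function.Surjective
      (Polynomial.aeval (R := R₀) ((1 : R₀) ⊗ₜ[WittVector p k] ϖ)) := by
  intro x
  have h1 := (Algebra.TensorProduct.basis R₀ h.basis).sum_repr x
  refine ⟨∑ i : Fin E.natDegree, Polynomial.C
    ((Algebra.TensorProduct.basis R₀ h.basis).repr x i) * Polynomial.X ^ (i : ℕ), ?_⟩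
  rw [map_sum]
  conv_rhs => rw [← h1]
  refine Finset.sum_congr rfl fun i _ => ?_
  rw [map_mul, map_pow, Polynomial.aeval_C, Polynomial.aeval_X, ← Algebra.smul_def,
    Algebra.TensorProduct.basis_apply, h.basis_apply, hroot, Algebra.TensorProduct.tmul_pow,
    one_pow]

theorem isDistinguishedAt_map (hEmonic : E.Monic)
    (hEeis : E.IsEisensteinAt (Ideal.span {(p : WittVector p k)})) :
    (E.map (algebraMap (WittVector p k) R₀)).IsDistinguishedAt (Ideal.span {(p : R₀)}) where
  monic := hEmonic.map _
  mem := by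
    intro n hn
    rw [Polynomial.coeff_map]
    obtain ⟨a, ha⟩ := Ideal.mem_span_singleton.1
      (hEeis.mem (hn.trans_le Polynomial.natDegree_map_le))
    rw [ha, map_mul, map_natCast]
    exact Ideal.mul_mem_right _ _ (Ideal.mem_span_singleton_self _)

/-- Weierstrass division: modulo a distinguished polynomial, polynomials and power series have the
same quotient. -/
theorem quotient_mk_comp_coe {S : Type*} [CommRing S] {I : Ideal S} [IsAdicComplete I S]
    {P₀ : Polynomial S} (hD : P₀.IsDistinguishedAt I) :
    Function.Surjective ((Ideal.Quotient.mk (Ideal.span {(P₀ : PowerSeries S)})).comp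
      (Polynomial.coeToPowerSeries.ringHom (R := S))) ∧
    ∀ P : Polynomial S, (Ideal.Quotient.mk (Ideal.span {(P₀ : PowerSeries S)})).comp
      (Polynomial.coeToPowerSeries.ringHom (R := S)) P = 0 ↔ P₀ ∣ P := by
  have hε : ∀ P : Polynomial S, hD.algEquivQuotient (Ideal.Quotient.mk _ P) =
      (Ideal.Quotient.mk (Ideal.span {(P₀ : PowerSeries S)})).comp
      (Polynomial.coeToPowerSeries.ringHom (R := S)) P := fun P => by
    rw [Polynomial.IsDistinguishedAt.algEquivQuotient_apply]
    change Ideal.Quotient.mk _ (Polynomial.coeToPowerSeries.algHom S P) = _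
    simp
  constructor
  · intro x
    obtain ⟨y, hy⟩ := hD.algEquivQuotient.surjective x
    obtain ⟨P, rfl⟩ := Ideal.Quotient.mk_surjective y
    exact ⟨P, (hε P).symm.trans hy⟩
  · intro P
    rw [← hε, map_eq_zero_iff _ hD.algEquivQuotient.injective, Ideal.Quotient.eq_zero_iff_mem,
      Ideal.mem_span_singleton]

/-- `R₀⟦u⟧ / E = R₀ ⊗ 𝒪_K`. -/
theorem exists_powerSeries_to_tensor [IsAdicComplete (Ideal.span {(p : R₀)}) R₀]
    (hEeis : E.IsEisensteinAt (Ideal.span {(p : WittVector p k)}))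
    (h : IsAdjoinRootMonic OK E) (hroot : h.toIsAdjoinRoot.root = ϖ) :
    ∃ q : PowerSeries R₀ →+* R₀ ⊗[WittVector p k] OK, Function.Surjective q ∧
      (∀ x, q x = 0 ↔ x ∈ Ideal.span {eisA p R₀ E}) ∧
      (∀ a, q (PowerSeries.C a) = a ⊗ₜ 1) ∧ q PowerSeries.X = 1 ⊗ₜ ϖ := by
  obtain ⟨hsurj, hker⟩ := quotient_mk_comp_coe (isDistinguishedAt_map (R₀ := R₀) h.monic hEeis)
  change Function.Surjective ((Ideal.Quotient.mk (Ideal.span {eisA p R₀ E})).comp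
      (Polynomial.coeToPowerSeries.ringHom (R := R₀))) at hsurj
  change ∀ P : Polynomial R₀, (Ideal.Quotient.mk (Ideal.span {eisA p R₀ E})).comp
      (Polynomial.coeToPowerSeries.ringHom (R := R₀)) P = 0 ↔ _ at hker
  generalize hg : (Ideal.Quotient.mk (Ideal.span {eisA p R₀ E})).comp
      (Polynomial.coeToPowerSeries.ringHom (R := R₀)) = g at hsurj hker
  let θ : Polynomial R₀ →+* R₀ ⊗[WittVector p k] OK :=
    (Polynomial.aeval (R := R₀) ((1 : R₀) ⊗ₜ[WittVector p k] ϖ)).toRingHom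
  have hθ : ∀ P : Polynomial R₀, θ P = 0 ↔ g P = 0 := fun P =>
    (aeval_tmul_eq_zero_iff h hroot P).trans (hker P).symm
  let θ' := g.liftOfSurjective hsurj ⟨θ, fun P hP => (hθ P).2 hP⟩
  have hθ' : ∀ P, θ' (g P) = θ P := fun P =>
    g.liftOfRightInverse_comp_apply _ _ ⟨θ, fun P hP => (hθ P).2 hP⟩ P
  have hC : ∀ P : Polynomial R₀, θ' (Ideal.Quotient.mk _ (P : PowerSeries R₀)) = θ P := fun P => by
    rw [← hθ', ← hg]
    simp
  refine ⟨θ'.comp (Ideal.Quotient.mk _), ?_, ?_, ?_, ?_⟩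
  · intro x
    obtain ⟨P, hP⟩ := aeval_tmul_surjective h hroot x
    exact ⟨P, (hC P).trans hP⟩
  · intro x
    obtain ⟨P, hP⟩ := hsurj (Ideal.Quotient.mk _ x)
    rw [RingHom.comp_apply, ← hP, hθ', hθ, hP, Ideal.Quotient.eq_zero_iff_mem]
  · intro a
    rw [RingHom.comp_apply, ← Polynomial.coe_C, hC]
    exact Polynomial.aeval_C _ _
  · rw [RingHom.comp_apply, ← Polynomial.coe_X, hC]
    exact Polynomial.aeval_X _

end Eisenstein

end PrismaticEnvelope

namespace PrismaticEnvelope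

open scoped TensorProduct

/-! ### Regularity in power series rings -/

section Regular

variable {σ S : Type*} [CommRing S]

/-- Power series whose coefficients at the exponents vanishing on `s` belong to `J`. -/
def coeffIdeal (J : Ideal S) (s : Set σ) : Ideal (MvPowerSeries σ S) where
  carrier := {b | ∀ d : σ →₀ ℕ, (∀ c ∈ s, d c = 0) → MvPowerSeries.coeff d b ∈ J}
  zero_mem' := fun d _ => by simp
  add_mem' := fun ha hb d hd => by
    rw [map_add]
    exact add_mem (ha d hd) (hb d hd)
  smul_mem' := fun a b hb d hd => by
    classical
    rw [smul_eq_mul, MvPowerSeries.coeff_mul]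
    refine sum_mem fun ij hij => Ideal.mul_mem_left _ _ (hb _ fun c hc => ?_)
    have h1 := DFunLike.congr_fun (Finset.HasAntidiagonal.mem_antidiagonal.1 hij) c
    have h2 := hd c hc
    rw [Finsupp.add_apply] at h1
    omega

theorem mem_span_range_C {n : ℕ} (g : Fin n → S) {b : MvPowerSeries σ S}
    (h : ∀ d, MvPowerSeries.coeff d b ∈ Ideal.span (Set.range g)) :
    b ∈ Ideal.span (Set.range fun i => (MvPowerSeries.C (g i) : MvPowerSeries σ S)) := by
  choose a ha using fun d => Ideal.mem_span_range_iff_exists_fun.1 (h d)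
  obtain ⟨N, hN⟩ : ∃ N : Fin n → MvPowerSeries σ S, ∀ i d, MvPowerSeries.coeff d (N i) = a d i :=
    ⟨fun i d => a d i, fun i d => rfl⟩
  refine Ideal.mem_span_range_iff_exists_fun.2 ⟨N, ?_⟩
  ext d
  rw [map_sum, ← ha]
  exact Finset.sum_congr rfl fun i _ => by rw [MvPowerSeries.coeff_mul_C, hN]

theorem coeff_single_add_X_mul (c : σ) (d : σ →₀ ℕ) (b : MvPowerSeries σ S) :
    MvPowerSeries.coeff (Finsupp.single c 1 + d) (MvPowerSeries.X c * b) =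
      MvPowerSeries.coeff d b := by
  rw [MvPowerSeries.X, MvPowerSeries.coeff_add_monomial_mul, one_mul]

theorem coeff_X_mul_of_eq_zero {c : σ} {d : σ →₀ ℕ} (h : d c = 0) (b : MvPowerSeries σ S) :
    MvPowerSeries.coeff d (MvPowerSeries.X c * b) = 0 := by
  classical
  rw [MvPowerSeries.X, MvPowerSeries.coeff_monomial_mul, if_neg]
  intro h1
  have := h1 c
  simp [h] at this

theorem exists_eq_add_X_mul (c : σ) (b : MvPowerSeries σ S) :
    ∃ b₀ b₁ : MvPowerSeries σ S, b = b₀ + MvPowerSeries.X c * b₁ ∧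
      ∀ d : σ →₀ ℕ, (d c = 0 → MvPowerSeries.coeff d b₀ = MvPowerSeries.coeff d b) ∧
        (d c ≠ 0 → MvPowerSeries.coeff d b₀ = 0) := by
  classical
  obtain ⟨b₀, h₀⟩ : ∃ b₀ : MvPowerSeries σ S, ∀ d, MvPowerSeries.coeff d b₀ =
      if d c = 0 then MvPowerSeries.coeff d b else 0 := ⟨fun d => _, fun d => rfl⟩
  obtain ⟨b₁, h₁⟩ : ∃ b₁ : MvPowerSeries σ S, ∀ d, MvPowerSeries.coeff d b₁ =
      MvPowerSeries.coeff (Finsupp.single c 1 + d) b := ⟨fun d => _, fun d => rfl⟩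
  refine ⟨b₀, b₁, ?_, fun d => ⟨fun h => by rw [h₀, if_pos h], fun h => by rw [h₀, if_neg h]⟩⟩
  ext d
  rw [map_add, h₀]
  split_ifs with h
  · rw [coeff_X_mul_of_eq_zero h, add_zero]
  · have hd : Finsupp.single c 1 + (d - Finsupp.single c 1) = d :=
      add_tsub_cancel_of_le (by simpa [Nat.one_le_iff_ne_zero] using h)
    rw [← hd, coeff_single_add_X_mul, h₁, zero_add]

/-- Turns the ideals of the regularity hypotheses into conditions on coefficients, where
multiplication by a variable is a shift. Finitely many `g` allow coefficientwise combinations to be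
assembled into power series, and a finite `s` allows its variables to be split off one by one. -/
theorem coeffIdeal_eq {n : ℕ} (g : Fin n → S) (s : Finset σ) :
    coeffIdeal (Ideal.span (Set.range g)) (s : Set σ) =
      Ideal.span (Set.range fun i => (MvPowerSeries.C (g i) : MvPowerSeries σ S)) ⊔
        Ideal.span (MvPowerSeries.X '' (s : Set σ)) := by
  classical
  apply le_antisymm
  · induction s using Finset.induction_on with
    | empty =>
      intro b hb
      exact Ideal.mem_sup_left (mem_span_range_C g fun d => hb d (by simp))
    | insert c s hc ih =>
      intro b hb
      obtain ⟨b₀, b₁, rfl, h⟩ := exists_eq_add_X_mul c b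
      refine add_mem ?_ (Ideal.mul_mem_right _ _ (Ideal.mem_sup_right
        (Ideal.subset_span ⟨c, by simp, rfl⟩)))
      have h1 : b₀ ∈ coeffIdeal (Ideal.span (Set.range g)) (s : Set σ) := by
        intro d hd
        by_cases hdc : d c = 0
        · rw [(h d).1 hdc]
          refine hb d fun c' hc' => ?_
          rw [Finset.coe_insert, Set.mem_insert_iff] at hc'
          rcases hc' with rfl | hc'
          · exact hdc
          · exact hd c' hc'
        · rw [(h d).2 hdc]
          exact zero_mem _
      have h2 : Ideal.span (MvPowerSeries.X '' (s : Set σ)) ≤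
          Ideal.span (MvPowerSeries.X '' ((insert c s : Finset σ) : Set σ) :
            Set (MvPowerSeries σ S)) :=
        Ideal.span_mono (Set.image_mono (by simp))
      exact sup_le_sup_left h2 _ (ih h1)
  · rw [sup_le_iff, Ideal.span_le, Ideal.span_le]
    constructor
    · rintro _ ⟨i, rfl⟩ d _
      rw [MvPowerSeries.coeff_C]
      split_ifs
      · exact Ideal.subset_span ⟨i, rfl⟩
      · exact zero_mem _
    · rintro _ ⟨c, hc, rfl⟩ d hd
      have := coeff_X_mul_of_eq_zero (hd c hc) (1 : MvPowerSeries σ S)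
      rw [mul_one] at this
      rw [this]
      exact zero_mem _

theorem nzdMod_coeffIdeal (J : Ideal S) {s : Set σ} {c : σ} (hc : c ∉ s) :
    NZDMod (coeffIdeal J s) (MvPowerSeries.X c) := by
  classical
  intro b hb d hd
  rw [← coeff_single_add_X_mul c]
  refine hb _ fun c' hc' => ?_
  have : c ≠ c' := fun h => hc (h ▸ hc')
  rw [Finsupp.add_apply, hd c' hc', Finsupp.single_eq_of_ne' this]

end Regular

/-! ### Frobenius lifts on power series rings -/

section Frobenius

variable {σ S : Type*} [CommRing S]

theorem natCast_dvd_iff_map_eq_zero (p : ℕ) (x : MvPowerSeries σ S) :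
    (p : MvPowerSeries σ S) ∣ x ↔
      MvPowerSeries.map (Ideal.Quotient.mk (Ideal.span {(p : S)})) x = 0 := by
  have hp : (p : MvPowerSeries σ S) = MvPowerSeries.C (p : S) := by simp
  constructor
  · rintro ⟨y, rfl⟩
    rw [hp, map_mul, MvPowerSeries.map_C,
      Ideal.Quotient.eq_zero_iff_mem.2 (Ideal.mem_span_singleton_self _), map_zero, zero_mul]
  · intro h
    have h1 : ∀ d, ∃ y, MvPowerSeries.coeff d x = p * y := fun d => by
      have := congrArg (MvPowerSeries.coeff d) h
      rw [MvPowerSeries.coeff_map, map_zero, Ideal.Quotient.eq_zero_iff_mem,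
        Ideal.mem_span_singleton] at this
      exact this
    choose y hy using h1
    obtain ⟨N, hN⟩ : ∃ N : MvPowerSeries σ S, ∀ d, MvPowerSeries.coeff d N = y d :=
      ⟨fun d => y d, fun d => rfl⟩
    refine ⟨N, ?_⟩
    ext d
    rw [hp, MvPowerSeries.coeff_C_mul, hN, hy]

/-- Modulo `p` the substitution becomes `X_c ↦ X_c^p` and `ψ` becomes the Frobenius of the
coefficients. Together they are the `p`-power map of power series in characteristic `p`. -/
theorem isFrobeniusLift_subst {p : ℕ} (hp : p.Prime) {ψ : S →+* S} (hψ : IsFrobeniusLift p ψ)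
    {a : σ → MvPowerSeries σ S} (ha : MvPowerSeries.HasSubst a)
    (hd : ∀ c, (p : MvPowerSeries σ S) ∣ a c - MvPowerSeries.X c ^ p) :
    IsFrobeniusLift p ((MvPowerSeries.substAlgHom (R := S) ha).toRingHom.comp
      (MvPowerSeries.map ψ)) := by
  intro x
  rw [natCast_dvd_iff_map_eq_zero, map_sub, sub_eq_zero]
  let S' := S ⧸ Ideal.span {(p : S)}
  rcases subsingleton_or_nontrivial S' with hS | hS
  · ext d
    exact Subsingleton.elim (α := S') _ _
  have hp0 : (p : S') = 0 := by
    rw [← map_natCast (Ideal.Quotient.mk (Ideal.span {(p : S)})), Ideal.Quotient.eq_zero_iff_mem]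
    exact Ideal.mem_span_singleton_self _
  have : Fact p.Prime := ⟨hp⟩
  have hchar : CharP S' p := (CharP.charP_iff_prime_eq_zero hp).2 hp0
  have hfrob : (Ideal.Quotient.mk (Ideal.span {(p : S)})).comp ψ =
      (frobenius S' p).comp (Ideal.Quotient.mk (Ideal.span {(p : S)})) := by
    ext y
    rw [RingHom.comp_apply, RingHom.comp_apply, frobenius_def, ← map_pow, ← sub_eq_zero, ← map_sub,
      Ideal.Quotient.eq_zero_iff_mem, Ideal.mem_span_singleton]
    exact hψ y
  have ha' : (fun c => MvPowerSeries.map (Ideal.Quotient.mk (Ideal.span {(p : S)})) (a c)) =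
      fun c => (MvPowerSeries.X c ^ p : MvPowerSeries σ S') := by
    funext c
    have := (natCast_dvd_iff_map_eq_zero p _).1 (hd c)
    rw [map_sub, sub_eq_zero] at this
    rw [this, map_pow, MvPowerSeries.map_X]
  have h1 : MvPowerSeries.map (Ideal.Quotient.mk (Ideal.span {(p : S)}))
      (MvPowerSeries.subst a (MvPowerSeries.map ψ x)) =
      MvPowerSeries.expand p hp.ne_zero (MvPowerSeries.map (frobenius S' p)
        (MvPowerSeries.map (Ideal.Quotient.mk (Ideal.span {(p : S)})) x)) := by
    rw [MvPowerSeries.map_subst ha, ha', ← RingHom.comp_apply (MvPowerSeries.map _),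
      ← MvPowerSeries.map_comp, hfrob, MvPowerSeries.map_comp, RingHom.comp_apply,
      MvPowerSeries.expand, MvPowerSeries.substAlgHom_apply]
  have h2 : ((MvPowerSeries.substAlgHom (R := S) ha).toRingHom.comp (MvPowerSeries.map ψ)) x =
      MvPowerSeries.subst a (MvPowerSeries.map ψ x) := by
    rw [← MvPowerSeries.substAlgHom_apply ha]
    rfl
  rw [h2, h1, ← MvPowerSeries.map_expand, MvPowerSeries.map_frobenius_expand, map_pow]

/-- The constant coefficient is the substitution of zero, and substitutions compose. -/
theorem constantCoeff_subst_of_constantCoeff_zero {τ : Type*} {a : σ → MvPowerSeries τ S}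
    (ha : MvPowerSeries.HasSubst a) (h0 : ∀ c, MvPowerSeries.constantCoeff (a c) = 0)
    (x : MvPowerSeries σ S) :
    MvPowerSeries.constantCoeff (MvPowerSeries.subst a x) = MvPowerSeries.constantCoeff x := by
  have hz : MvPowerSeries.HasSubst (0 : τ → MvPowerSeries τ S) := MvPowerSeries.HasSubst.zero
  have h1 := MvPowerSeries.subst_comp_subst_apply (R := S) ha hz x
  have h2 : (fun c => MvPowerSeries.subst (0 : τ → MvPowerSeries τ S) (a c)) = 0 := by
    funext c
    exact MvPowerSeries.subst_zero_of_constantCoeff_zero (h0 c)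
  rw [h2, MvPowerSeries.subst_zero_eq_C_constantCoeff,
    MvPowerSeries.subst_zero_eq_C_constantCoeff] at h1
  have h3 := congrArg MvPowerSeries.constantCoeff h1
  simpa using h3

end Frobenius

/-! ### The self-products of `R₀⟦u⟧` and their Frobenius -/

section Concrete

variable {p : ℕ} [Fact p.Prime] {k : Type*} [Field k] [CharP k p] [PerfectRing k p]
variable {R₀ : Type*} [CommRing R₀] [Algebra (WittVector p k) R₀]
  {φ : R₀ →+* R₀} {E : Polynomial (WittVector p k)}

theorem isFrobeniusLift_frobA (hφ : IsFrobeniusLift p φ) : IsFrobeniusLift p (frobA p φ) :=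
  isFrobeniusLift_subst (σ := Unit) Fact.out hφ
    (MvPowerSeries.HasSubst.X_pow (Fact.out : p.Prime).ne_zero) fun c => by simp

theorem constantCoeff_frobA (x : PowerSeries R₀) :
    PowerSeries.constantCoeff (frobA p φ x) = φ (PowerSeries.constantCoeff x) := by
  change PowerSeries.constantCoeff (PowerSeries.expand p (Fact.out : p.Prime).ne_zero (PowerSeries.map φ x)) = _
  rw [PowerSeries.constantCoeff_expand, ← PowerSeries.coeff_zero_eq_constantCoeff_apply,
    PowerSeries.coeff_map, PowerSeries.coeff_zero_eq_constantCoeff_apply]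

theorem constantCoeff_eisA :
    PowerSeries.constantCoeff (eisA p R₀ E) = algebraMap (WittVector p k) R₀ (E.coeff 0) := by
  rw [eisA, ← PowerSeries.coeff_zero_eq_constantCoeff_apply, Polynomial.coeff_coe,
    Polynomial.coeff_map]

theorem exists_unit_coeff_zero (hEeis : E.IsEisensteinAt (Ideal.span {(p : WittVector p k)}))
    (hdeg : 0 < E.natDegree) : ∃ c : WittVector p k, IsUnit c ∧ E.coeff 0 = p * c := by
  obtain ⟨c, hc⟩ := Ideal.mem_span_singleton.1 (hEeis.mem hdeg)
  refine ⟨c, WittVector.isUnit_of_coeff_zero_ne_zero c fun h => ?_, hc⟩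
  rw [← WittVector.mem_span_p_iff_coeff_zero_eq_zero] at h
  refine hEeis.notMem ?_
  rw [hc, pow_two]
  exact Ideal.mul_mem_mul (Ideal.mem_span_singleton_self _) h

/-- Units of `R₀⟦u⟧` are detected on constant coefficients. By the Eisenstein condition `E(0) = p c`
with `c` a unit, so `ε` has constant coefficient `φ(c) - p^(p-1) c^p`, a unit minus an element of
the Jacobson radical. -/
theorem exists_frobA_eisA [IsAdicComplete (Ideal.span {(p : R₀)}) R₀]
    (htf : ∀ x : R₀, (p : R₀) * x = 0 → x = 0) (hφ : IsFrobeniusLift p φ)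
    (hEeis : E.IsEisensteinAt (Ideal.span {(p : WittVector p k)}))
    (hdeg : 0 < E.natDegree) :
    ∃ ε, IsUnit ε ∧ frobA p φ (eisA p R₀ E) = eisA p R₀ E ^ p + p * ε := by
  have hp : p.Prime := Fact.out
  obtain ⟨ε, hε⟩ := isFrobeniusLift_frobA hφ (eisA p R₀ E)
  refine ⟨ε, ?_, by rw [← hε]; ring⟩
  obtain ⟨c, hc, hc'⟩ := exists_unit_coeff_zero hEeis hdeg
  have h1 := congrArg PowerSeries.constantCoeff hε
  obtain ⟨c₀, hc₀⟩ : ∃ c₀, c₀ = algebraMap (WittVector p k) R₀ c := ⟨_, rfl⟩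
  have hu : IsUnit (φ c₀) := by rw [hc₀]; exact (hc.map _).map _
  rw [map_sub, map_pow, map_mul, map_natCast, constantCoeff_frobA, constantCoeff_eisA, hc',
    map_mul, map_natCast, map_mul, map_natCast, ← hc₀] at h1
  have hpow : (p : R₀) ^ p = p * p ^ (p - 1) := by
    rw [← pow_succ', Nat.sub_add_cancel hp.one_le]
  have h2 : PowerSeries.constantCoeff ε = φ c₀ - p ^ (p - 1) * c₀ ^ p := by
    refine sub_eq_zero.1 (htf _ ?_)
    rw [mul_pow, hpow] at h1
    linear_combination -h1
  rw [PowerSeries.isUnit_iff_constantCoeff, h2]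
  have h3 : (p : R₀) ^ (p - 1) ∈ Ideal.jacobson (⊥ : Ideal R₀) :=
    Ideal.pow_mem_of_mem _ (natCast_mem_jacobson_of_isAdicComplete p) _
      (Nat.sub_pos_of_lt hp.one_lt)
  obtain ⟨v, hv⟩ := hu
  have h4 := Ideal.mem_jacobson_bot.1 h3 (-(c₀ ^ p * ↑v⁻¹))
  have h5 : φ c₀ - p ^ (p - 1) * c₀ ^ p = v * (p ^ (p - 1) * -(c₀ ^ p * ↑v⁻¹) + 1) := by
    rw [← hv]
    linear_combination ((p : R₀) ^ (p - 1) * c₀ ^ p) * v.mul_inv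
  rw [h5]
  exact v.isUnit.mul h4

variable [IsAdicComplete (Ideal.span {(p : R₀)}) R₀] {m : ℕ} {f : Tate p k m →ₐ[WittVector p k] R₀}
  {φt : Tate p k m →+* Tate p k m} {r : ℕ}

theorem copyHom_t (i : Fin r) (j : Fin m) : copyHom p f i (Tate.t p k m j) =
    MvPowerSeries.C (PowerSeries.C (f (Tate.t p k m j))) + MvPowerSeries.X (i, some j) := by
  rw [copyHom, Tate.t, Tate.eval_algebraMap, MvPolynomial.aeval_X]
  rfl

/-- Both copies of `φ(t_j) = t_j^p + p w` are `p`-th powers modulo `p`, and modulo `p` the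
difference of `p`-th powers is the `p`-th power of the difference. -/
theorem natCast_dvd_frobVar_sub (hφt : IsFrobeniusLift p φt) (c : Fin r × Option (Fin m)) :
    (p : AProd R₀ m r) ∣ frobVar p f φt c - MvPowerSeries.X c ^ p := by
  have key : ∀ a b : AProd R₀ m r, ∃ s, (a + b) ^ p = a ^ p + b ^ p + p * s := fun a b =>
    ⟨_, add_pow_eq_add_sum_Ioo (Fact.out : p.Prime) a b⟩
  rcases c with ⟨i, _ | j⟩
  · obtain ⟨s, hs⟩ := key (MvPowerSeries.C PowerSeries.X) (MvPowerSeries.X (i, none))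
    rw [frobVar, hs, map_pow]
    exact ⟨s, by ring⟩
  · obtain ⟨w, hw⟩ := hφt (Tate.t p k m j)
    obtain ⟨s, hs⟩ := key (MvPowerSeries.C (PowerSeries.C (f (Tate.t p k m j))))
      (MvPowerSeries.X (i, some j))
    rw [frobVar, eq_add_of_sub_eq hw]
    simp only [map_add, map_mul, map_pow, map_natCast, copyHom_t]
    rw [hs]
    exact ⟨copyHom p f i w - MvPowerSeries.C (PowerSeries.C (f w)) + s, by ring⟩

theorem isFrobeniusLift_frobProd (hφ : IsFrobeniusLift p φ) (hφt : IsFrobeniusLift p φt) :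
    IsFrobeniusLift p (frobProd (r := r) p f φ φt) :=
  isFrobeniusLift_subst Fact.out (isFrobeniusLift_frobA hφ) (hasSubst_frobVar p f φt)
    (natCast_dvd_frobVar_sub hφt)

theorem constantCoeff_frobVar (c : Fin r × Option (Fin m)) :
    MvPowerSeries.constantCoeff (frobVar p f φt c) = 0 := by
  rcases c with ⟨i, _ | j⟩
  · simp [frobVar]
  · simp [frobVar, constantCoeff_copyHom]

theorem frobProd_apply (x : AProd R₀ m r) : frobProd p f φ φt x =
    MvPowerSeries.subst (frobVar p f φt) (MvPowerSeries.map (frobA p φ) x) := by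
  rw [← MvPowerSeries.substAlgHom_apply (hasSubst_frobVar p f φt)]
  rfl

theorem constantCoeff_frobProd (x : AProd R₀ m r) :
    MvPowerSeries.constantCoeff (frobProd p f φ φt x) =
      frobA p φ (MvPowerSeries.constantCoeff x) := by
  rw [frobProd_apply, constantCoeff_subst_of_constantCoeff_zero (hasSubst_frobVar p f φt)
    constantCoeff_frobVar, MvPowerSeries.constantCoeff_map]

theorem frobProd_C (x : PowerSeries R₀) : frobProd (r := r) p f φ φt (MvPowerSeries.C x) =
    MvPowerSeries.C (frobA p φ x) := by
  rw [frobProd_apply, MvPowerSeries.map_C, MvPowerSeries.subst_C]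

theorem frobProd_X (c : Fin r × Option (Fin m)) :
    frobProd p f φ φt (MvPowerSeries.X c) = frobVar p f φt c := by
  rw [frobProd_apply, MvPowerSeries.map_X, MvPowerSeries.subst_X (hasSubst_frobVar p f φt)]

theorem mvPowerSeries_natCast_torsionFree {σ S : Type*} [CommRing S] {n : ℕ}
    (htf : ∀ x : S, (n : S) * x = 0 → x = 0) (x : MvPowerSeries σ S)
    (hx : (n : MvPowerSeries σ S) * x = 0) : x = 0 := by
  ext d
  refine htf _ ?_
  have h1 : (n : MvPowerSeries σ S) = MvPowerSeries.C (n : S) := by simp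
  rw [← MvPowerSeries.coeff_C_mul, ← h1, hx, MvPowerSeries.coeff_zero]

theorem eisA_mul_eq_zero [IsDomain R₀] (hE : E.Monic) (x : PowerSeries R₀)
    (hx : eisA p R₀ E * x = 0) : x = 0 := by
  refine (mul_eq_zero.1 hx).resolve_left ?_
  rw [eisA, Polynomial.coe_eq_zero_iff]
  exact (hE.map _).ne_zero

theorem span_C_sup_span_X {σ S : Type*} [CommRing S] (e : S) (s : Finset σ) :
    Ideal.span {(MvPowerSeries.C e : MvPowerSeries σ S)} ⊔
      Ideal.span (MvPowerSeries.X '' (s : Set σ)) = coeffIdeal (Ideal.span {e}) s := by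
  have h := coeffIdeal_eq (σ := σ) ![e] s
  simpa [Set.range_comp', eq_comm] using h

theorem span_C_sup_span_natCast_sup_span_X {σ S : Type*} [CommRing S] (e : S) (n : ℕ)
    (s : Finset σ) :
    Ideal.span {(MvPowerSeries.C e : MvPowerSeries σ S)} ⊔ Ideal.span {(n : MvPowerSeries σ S)} ⊔
      Ideal.span (MvPowerSeries.X '' (s : Set σ)) = coeffIdeal (Ideal.span {e, (n : S)}) s := by
  have h := coeffIdeal_eq (σ := σ) ![e, (n : S)] s
  have h1 : (Set.range fun i => (MvPowerSeries.C (![e, (n : S)] i) : MvPowerSeries σ S)) =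
      {MvPowerSeries.C e, (n : MvPowerSeries σ S)} := by
    ext x
    simp [Fin.exists_fin_two, eq_comm]
  rw [h1, Ideal.span_insert, Matrix.range_cons, Matrix.range_cons, Matrix.range_empty,
    Set.union_empty, Set.singleton_union] at h
  exact h.symm

variable {R : Type*} [CommRing R] {q : PowerSeries R₀ →+* R}

theorem envHyp_aProd [IsDomain R₀] (htf : ∀ x : R₀, (p : R₀) * x = 0 → x = 0)
    (hφ : IsFrobeniusLift p φ) (hφt : IsFrobeniusLift p φt) (hEmonic : E.Monic)
    (hEeis : E.IsEisensteinAt (Ideal.span {(p : WittVector p k)})) (hdeg : 0 < E.natDegree)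
    (hq : ∀ x, q x = 0 ↔ x ∈ Ideal.span {eisA p R₀ E})
    (hR : ∀ x : R, (p : R) * x = 0 → x = 0) :
    EnvHyp p (frobProd (r := r) p f φ φt)
      (algebraMap (PowerSeries R₀) (AProd R₀ m r) (eisA p R₀ E)) MvPowerSeries.X where
  prime := Fact.out
  torsionFree := mvPowerSeries_natCast_torsionFree (mvPowerSeries_natCast_torsionFree htf)
  frobeniusLift := isFrobeniusLift_frobProd hφ hφt
  jacobson := natCast_mem_jacobson_of_isAdicComplete p
  distinguished := by
    obtain ⟨ε, hε, h⟩ := exists_frobA_eisA htf hφ hEeis hdeg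
    refine ⟨MvPowerSeries.C ε, hε.map _, ?_⟩
    rw [MvPowerSeries.algebraMap_apply, Algebra.algebraMap_self, RingHom.id_apply, frobProd_C, h]
    simp
  nzd_E := by
    intro x hx
    rw [Ideal.mem_bot] at hx ⊢
    rw [MvPowerSeries.algebraMap_apply, Algebra.algebraMap_self, RingHom.id_apply] at hx
    refine MvPowerSeries.ext fun d => ?_
    refine eisA_mul_eq_zero (R₀ := R₀) hEmonic (MvPowerSeries.coeff d x) ?_
    rw [← MvPowerSeries.coeff_C_mul, hx, MvPowerSeries.coeff_zero]
  nzd_p := by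
    intro x hx
    have h := span_C_sup_span_X (σ := Fin r × Option (Fin m)) (eisA p R₀ E) ∅
    rw [Finset.coe_empty, Set.image_empty, Ideal.span_empty, sup_bot_eq] at h
    rw [MvPowerSeries.algebraMap_apply, Algebra.algebraMap_self, RingHom.id_apply, h] at hx ⊢
    intro d hd
    have h1 := hx d hd
    rw [← hq] at h1 ⊢
    have h2 : (p : AProd R₀ m r) = MvPowerSeries.C (p : PowerSeries R₀) := by simp
    rw [h2, MvPowerSeries.coeff_C_mul, map_mul, map_natCast] at h1
    exact hR _ h1
  nzd_y := by
    intro S c hc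
    rw [MvPowerSeries.algebraMap_apply, Algebra.algebraMap_self, RingHom.id_apply,
      span_C_sup_span_X]
    exact nzdMod_coeffIdeal _ hc
  nzd_y_mod_p := by
    intro S c hc
    rw [MvPowerSeries.algebraMap_apply, Algebra.algebraMap_self, RingHom.id_apply,
      span_C_sup_span_natCast_sup_span_X]
    exact nzdMod_coeffIdeal _ hc

theorem residueHyp_aProd [IsAdicComplete (Ideal.span {(p : R)}) R]
    (hsurj : Function.Surjective q)
    (hq : ∀ x, q x = 0 ↔ x ∈ Ideal.span {eisA p R₀ E})
    (hR : ∀ x : R, (p : R) * x = 0 → x = 0) :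
    ResidueHyp p (frobProd (r := r) p f φ φt) (frobA p φ)
      (algebraMap (PowerSeries R₀) (AProd R₀ m r) (eisA p R₀ E)) MvPowerSeries.X
      MvPowerSeries.constantCoeff q where
  map_y := MvPowerSeries.constantCoeff_X
  comm := constantCoeff_frobProd
  surjective := hsurj
  surjective' := fun x => ⟨MvPowerSeries.C x, MvPowerSeries.constantCoeff_C x⟩
  map_E := by
    rw [MvPowerSeries.algebraMap_apply, Algebra.algebraMap_self, RingHom.id_apply,
      MvPowerSeries.constantCoeff_C, hq]
    exact Ideal.mem_span_singleton_self _
  mem_of_map_eq_zero := by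
    intro b hb
    have h := span_C_sup_span_X (σ := Fin r × Option (Fin m)) (eisA p R₀ E) Finset.univ
    rw [Finset.coe_univ, Set.image_univ] at h
    rw [MvPowerSeries.algebraMap_apply, Algebra.algebraMap_self, RingHom.id_apply, h]
    intro d hd
    have hd0 : d = 0 := Finsupp.ext fun c => hd c trivial
    rw [hd0, MvPowerSeries.coeff_zero_eq_constantCoeff_apply, ← hq]
    exact hb
  torsionFree := hR
  isUnit := fun n hn => isUnit_natCast_of_coprime p hn

end Concrete

end PrismaticEnvelope

namespace PrismaticEnvelope

/-! ### Evaluation of power series at topologically nilpotent elements -/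

section Eval

variable {σ A M : Type*} [Finite σ] [CommRing A] [CommRing M]

/-- With finitely many variables, power series are the completion of polynomials at the ideal of the
variables. A homomorphism sending the variables into `K` is automatically continuous, hence
determined on polynomials. -/
theorem mvPowerSeries_hom_ext (K : Ideal M) [IsAdicComplete K M]
    {h h' : MvPowerSeries σ A →+* M} (hC : ∀ a, h (MvPowerSeries.C a) = h' (MvPowerSeries.C a))
    (hX : ∀ c, h (MvPowerSeries.X c) = h' (MvPowerSeries.X c))
    (hK : ∀ c, h (MvPowerSeries.X c) ∈ K) : h = h' := by
  let e := (MvPowerSeries.toAdicCompletionAlgEquiv σ A).toRingEquiv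
  have he : ∀ P : MvPolynomial σ A, e.symm (algebraMap _ _ P) = (P : MvPowerSeries σ A) :=
    fun P => by
      rw [RingEquiv.symm_apply_eq]
      exact (MvPowerSeries.toAdicCompletion_coe P).symm
  have H := isCompletion_adicCompletion (MvPolynomial.idealOfVars_fg σ A)
  have h1 : h.comp e.symm.toRingHom = h'.comp e.symm.toRingHom := by
    refine H.hom_ext K ?_ ?_
    · refine Ideal.span_le.2 ?_
      rintro _ ⟨c, rfl⟩
      change h (e.symm (algebraMap _ _ (MvPolynomial.X c))) ∈ K
      rw [he, MvPolynomial.coe_X]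
      exact hK c
    · refine MvPolynomial.ringHom_ext (fun a => ?_) fun c => ?_
      · change h (e.symm (algebraMap _ _ (MvPolynomial.C a))) =
          h' (e.symm (algebraMap _ _ (MvPolynomial.C a)))
        rw [he, MvPolynomial.coe_C, hC]
      · change h (e.symm (algebraMap _ _ (MvPolynomial.X c))) =
          h' (e.symm (algebraMap _ _ (MvPolynomial.X c)))
        rw [he, MvPolynomial.coe_X, hX]
  ext x
  have := congrArg (fun g => g (e x)) h1
  simpa using this

theorem exists_mvPowerSeries_eval (K : Ideal M) [IsAdicComplete K M] (g : A →+* M) (v : σ → M)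
    (hv : ∀ c, v c ∈ K) : ∃ β : MvPowerSeries σ A →+* M,
      (∀ a, β (MvPowerSeries.C a) = g a) ∧ ∀ c, β (MvPowerSeries.X c) = v c := by
  let e := (MvPowerSeries.toAdicCompletionAlgEquiv σ A).toRingEquiv
  have he : ∀ P : MvPolynomial σ A, e (P : MvPowerSeries σ A) = algebraMap _ _ P :=
    MvPowerSeries.toAdicCompletion_coe
  obtain ⟨l, hl⟩ := (isCompletion_adicCompletion (MvPolynomial.idealOfVars_fg σ A)).exists_lift K
    (MvPolynomial.eval₂Hom g v) (by
      rw [MvPolynomial.idealOfVars, Ideal.span_le]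
      rintro _ ⟨c, rfl⟩
      change MvPolynomial.eval₂Hom g v (MvPolynomial.X c) ∈ K
      rw [MvPolynomial.eval₂Hom_X']
      exact hv c)
  have hl' : ∀ P, l (algebraMap _ _ P) = MvPolynomial.eval₂Hom g v P := fun P =>
    congrArg (fun f => f P) hl
  refine ⟨l.comp (e : MvPowerSeries σ A →+* _), fun a => ?_, fun c => ?_⟩
  · change l (e (MvPowerSeries.C a)) = _
    rw [← MvPolynomial.coe_C, he, hl', MvPolynomial.eval₂Hom_C]
  · change l (e (MvPowerSeries.X c)) = _
    rw [← MvPolynomial.coe_X, he, hl', MvPolynomial.eval₂Hom_X']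

end Eval

/-! ### Homomorphisms out of `δ`-envelopes -/

section Hom

open MvPolynomial

variable {p : ℕ} {B C M : Type*} [CommRing B] [CommRing M] {φ : B →+* B} {E : B} {y : C → B}

/-- The relation of index `n + 1` expresses `φⁿ⁺¹(E) δⁿ⁺¹(z_c)` through lower terms, and the factor
`φⁿ⁺¹(E)` can be cancelled in the target. -/
theorem EnvHyp.hom_ext (H : EnvHyp p φ E y) {g g' : DeltaEnv p φ E y →+* M}
    (hB : ∀ b, g (algebraMap B _ b) = g' (algebraMap B _ b))
    (hz : ∀ c, g (DeltaEnv.z p φ E y c 0) = g' (DeltaEnv.z p φ E y c 0))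
    (hE : ∀ n x, g (algebraMap B _ (φ^[n + 1] E)) * x = 0 → x = 0) : g = g' := by
  have key : ∀ n c, g (DeltaEnv.z p φ E y c n) = g' (DeltaEnv.z p φ E y c n) := by
    intro n
    induction n using Nat.strong_induction_on with
    | _ n ih =>
      intro c
      rcases n with _ | n
      · exact hz c
      obtain ⟨q, hq, h⟩ := H.exists_rel_eq c (n + 1)
      have hlow : ∀ q ∈ lowerVars B c (n + 1), g (Ideal.Quotient.mk _ q) =
          g' (Ideal.Quotient.mk _ q) := by
        intro q hq
        rw [lowerVars, MvPolynomial.supported_eq_adjoin_X] at hq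
        induction hq using Algebra.adjoin_induction with
        | mem x hx =>
          obtain ⟨⟨c', i⟩, hi, rfl⟩ := hx
          obtain ⟨rfl, hi⟩ := hi
          exact ih i hi _
        | algebraMap b => exact hB b
        | add x y _ _ hx hy => rw [map_add, map_add, map_add, hx, hy]
        | mul x y _ _ hx hy => rw [map_mul, map_mul, map_mul, hx, hy]
      have hrel : Ideal.Quotient.mk (deltaRel p φ E y) (rel p φ E y (c, n + 1)) = 0 := by
        rw [Ideal.Quotient.eq_zero_iff_mem]
        exact Ideal.subset_span ⟨(c, n + 1), rfl⟩
      rw [h, map_add, map_mul] at hrel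
      have h1 := congrArg g hrel
      have h2 := congrArg g' hrel
      rw [map_zero, map_add, map_mul] at h1 h2
      have h3 : g (algebraMap B _ (φ^[n + 1] E)) * g (DeltaEnv.z p φ E y c (n + 1)) +
          g (Ideal.Quotient.mk _ q) = 0 := h1
      have h4 : g' (algebraMap B _ (φ^[n + 1] E)) * g' (DeltaEnv.z p φ E y c (n + 1)) +
          g' (Ideal.Quotient.mk _ q) = 0 := h2
      rw [← hB, ← hlow q hq] at h4
      refine sub_eq_zero.1 (hE n _ ?_)
      rw [mul_sub]
      linear_combination h3 - h4
  refine Ideal.Quotient.ringHom_ext (MvPolynomial.ringHom_ext (fun b => hB b) fun c => ?_)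
  exact key c.2 c.1

/-- The target need not be a `δ`-ring. On `K` both `ψ(x)` and `x^p` are divisible by `p`, so `δ(x) =
(ψ(x) - x^p)/p` exists, and it stays in `K` because `K` is saturated for `p`. Hence `δ` can be
iterated on the `z_c`. The relations die one after the other since the map intertwines the Frobenius
maps and `M` has no `p`-torsion. -/
theorem exists_deltaEnv_hom (hp : p.Prime) (hφ : IsFrobeniusLift p φ)
    (htf : ∀ x : M, (p : M) * x = 0 → x = 0) {ψ : M →+* M} (K : Ideal M)
    (hK : ∀ x, (p : M) * x ∈ K → x ∈ K) (hψK : ∀ x ∈ K, ψ x ∈ K)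
    (hψp : ∀ x ∈ K, (p : M) ∣ ψ x) (hpow : ∀ x ∈ K, (p : M) ∣ x ^ p) {β : B →+* M}
    (hβ : ∀ b, β (φ b) = ψ (β b)) {z : C → M} (hz : ∀ c, z c ∈ K)
    (hy : ∀ c, β (y c) = β E * z c) :
    ∃ g : DeltaEnv p φ E y →+* M, (∀ b, g (algebraMap B _ b) = β b) ∧
      ∀ c, g (DeltaEnv.z p φ E y c 0) = z c := by
  have hδ : ∀ x : K, ∃ w : K, (p : M) * w = ψ x - x ^ p := by
    rintro ⟨x, hx⟩
    obtain ⟨a, ha⟩ := hψp x hx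
    obtain ⟨b, hb⟩ := hpow x hx
    refine ⟨⟨a - b, hK _ ?_⟩, ?_⟩
    · rw [mul_sub, ← ha, ← hb]
      exact sub_mem (hψK x hx) (Ideal.pow_mem_of_mem _ hx _ hp.pos)
    · rw [mul_sub, ← ha, ← hb]
  choose δK hδK using hδ
  let ζ : C × ℕ → M := fun cn => (δK^[cn.2] ⟨z cn.1, hz cn.1⟩ : K)
  have hζ : ∀ c n, (p : M) * ζ (c, n + 1) = ψ (ζ (c, n)) - ζ (c, n) ^ p := fun c n => by
    have : ζ (c, n + 1) = δK (δK^[n] ⟨z c, hz c⟩) := by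
      change ((δK^[n + 1] ⟨z c, hz c⟩ : K) : M) = _
      rw [Function.iterate_succ_apply']
    rw [this, hδK]
  let G : MvPolynomial (C × ℕ) B →+* M := eval₂Hom β ζ
  have hGC : ∀ b, G (MvPolynomial.C b) = β b := fun b => eval₂Hom_C _ _ _
  have hGX : ∀ c, G (X c) = ζ c := fun c => eval₂Hom_X' _ _ _
  have hfrob : G.comp (freeFrob p φ C) = ψ.comp G := by
    refine MvPolynomial.ringHom_ext (fun b => ?_) fun c => ?_
    · rw [RingHom.comp_apply, RingHom.comp_apply, freeFrob_C, hGC, hGC, hβ]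
    · rw [RingHom.comp_apply, RingHom.comp_apply, freeFrob_X, map_add, map_mul, map_pow,
        map_natCast, hGX, hGX, hζ c.1 c.2]
      ring
  have hrel : ∀ (n : ℕ) (c : C), G (rel p φ E y (c, n)) = 0 := by
    intro n c
    induction n with
    | zero =>
      rw [EnvHyp.rel_zero, map_sub, map_mul, hGC, hGC, hGX, hy, sub_eq_zero]
      rfl
    | succ n ih =>
      rw [EnvHyp.rel_succ]
      refine htf _ ?_
      have h := congrArg G (natCast_mul_freeDelta (C := C) hp hφ (rel p φ E y (c, n)))
      rw [map_mul, map_natCast, map_sub, map_pow, ih, zero_pow hp.ne_zero, sub_zero] at h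
      rw [h]
      have h2 := congrArg (fun f => f (rel p φ E y (c, n))) hfrob
      rw [RingHom.comp_apply, RingHom.comp_apply, ih, map_zero] at h2
      exact h2
  refine ⟨Ideal.Quotient.lift _ G fun x hx => ?_, fun b => ?_, fun c => ?_⟩
  · have : deltaRel p φ E y ≤ RingHom.ker G := by
      rw [deltaRel, Ideal.span_le]
      rintro _ ⟨⟨c, n⟩, rfl⟩
      exact hrel n c
    exact this hx
  · exact (Ideal.Quotient.lift_mk _ _ _).trans (hGC b)
  · exact (Ideal.Quotient.lift_mk _ _ _).trans (hGX (c, 0))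

end Hom

end PrismaticEnvelope

namespace PrismaticEnvelope

open MvPolynomial

/-! ### The ring `S[E/p, γ_i(z_c)]` -/

section Adjoin

variable {p : ℕ} {S : Type*} [CommRing S] {E : S}

theorem natCast_pow_mul_cancel_invP {n : ℕ} {a b : InvP p S} (h : (p : InvP p S) ^ n * a = p ^ n * b) :
    a = b :=
  ((isUnit_natCast_self_invP p S).pow n).mul_left_cancel h

/-- With its converse below, this describes `S[E/p]` as the union of the fractions `p⁻ⁿ (p, E)ⁿ`. -/
theorem exists_mem_adjoin_of_mem_pow (n : ℕ) {x : S} (hx : x ∈ Ideal.span {(p : S), E} ^ n) :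
    ∃ a ∈ Algebra.adjoin S {algebraMap S (InvP p S) E * Ring.inverse (p : InvP p S)},
      (p : InvP p S) ^ n * a = algebraMap S _ x := by
  induction n generalizing x with
  | zero => exact ⟨_, Subalgebra.algebraMap_mem _ x, by simp⟩
  | succ n ih =>
    obtain ⟨r, s, hs, rfl⟩ := exists_eq_of_mem_span_pair_pow hx
    obtain ⟨a, ha, h⟩ := ih hs
    refine ⟨algebraMap S _ r + algebraMap S (InvP p S) E * Ring.inverse (p : InvP p S) * a,
      add_mem (Subalgebra.algebraMap_mem _ r) (mul_mem (Algebra.subset_adjoin rfl) ha), ?_⟩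
    have h1 := Ring.mul_inverse_cancel _ (isUnit_natCast_self_invP p S)
    rw [map_add, map_mul, map_mul, map_pow, map_natCast, ← h]
    linear_combination (algebraMap S (InvP p S) E * p ^ n * a) * h1

theorem exists_pow_mul_eq_of_mem_adjoin {a : InvP p S}
    (ha : a ∈ Algebra.adjoin S {algebraMap S (InvP p S) E * Ring.inverse (p : InvP p S)}) :
    ∃ n, ∃ x ∈ Ideal.span {(p : S), E} ^ n, (p : InvP p S) ^ n * a = algebraMap S _ x := by
  have hp : (p : S) ∈ Ideal.span {(p : S), E} := Ideal.subset_span (by simp)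
  induction ha using Algebra.adjoin_induction with
  | mem x hx =>
    obtain rfl := hx
    refine ⟨1, E, by rw [pow_one]; exact Ideal.subset_span (by simp), ?_⟩
    rw [pow_one, mul_left_comm, Ring.mul_inverse_cancel _ (isUnit_natCast_self_invP p S), mul_one]
  | algebraMap r => exact ⟨0, r, by simp, by simp⟩
  | add a b _ _ ha hb =>
    obtain ⟨n, x, hx, h1⟩ := ha
    obtain ⟨m, y, hy, h2⟩ := hb
    refine ⟨n + m, p ^ m * x + p ^ n * y, add_mem ?_ ?_, ?_⟩
    · rw [add_comm n m, pow_add]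
      exact Ideal.mul_mem_mul (Ideal.pow_mem_pow hp _) hx
    · rw [pow_add]
      exact Ideal.mul_mem_mul (Ideal.pow_mem_pow hp _) hy
    · rw [map_add, map_mul, map_mul, ← h1, ← h2, map_pow, map_pow, map_natCast]
      ring
  | mul a b _ _ ha hb =>
    obtain ⟨n, x, hx, h1⟩ := ha
    obtain ⟨m, y, hy, h2⟩ := hb
    refine ⟨n + m, x * y, ?_, ?_⟩
    · rw [pow_add]
      exact Ideal.mul_mem_mul hx hy
    · rw [map_mul, ← h1, ← h2]
      ring

/-- After clearing denominators this concerns orders for the ideal `(p, E)`: multiplication by `E`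
and by `p` each raise the order by exactly one, as `E` and `p` form a regular sequence in either
order. In effect `E/p` is regular modulo `p` in `S[E/p]`. -/
theorem natCast_dvd_of_mul_dvd_adjoin (htf : ∀ x : S, (p : S) * x = 0 → x = 0)
    (hE : ∀ x : S, E * x = 0 → x = 0) (hpE : NZDMod (Ideal.span {E}) (p : S)) {a b : InvP p S}
    (ha : a ∈ Algebra.adjoin S {algebraMap S (InvP p S) E * Ring.inverse (p : InvP p S)})
    (hb : b ∈ Algebra.adjoin S {algebraMap S (InvP p S) E * Ring.inverse (p : InvP p S)})
    (h : algebraMap S (InvP p S) E * Ring.inverse (p : InvP p S) * a = p * b) :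
    ∃ a' ∈ Algebra.adjoin S {algebraMap S (InvP p S) E * Ring.inverse (p : InvP p S)},
      a = p * a' := by
  have hp : (p : S) ∈ Ideal.span {(p : S), E} := Ideal.subset_span (by simp)
  obtain ⟨n, x, -, h1⟩ := exists_pow_mul_eq_of_mem_adjoin ha
  obtain ⟨N, y, hy, h2⟩ := exists_pow_mul_eq_of_mem_adjoin hb
  have h3 := Ring.mul_inverse_cancel _ (isUnit_natCast_self_invP p S)
  have h4 : E * ((p : S) ^ N * x) = p ^ (n + 2) * y := by
    apply algebraMap_invP_injective htf
    rw [map_mul, map_mul, map_mul, ← h1, ← h2, map_pow, map_pow, map_natCast]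
    linear_combination (p : InvP p S) ^ (N + n + 1) * h -
      (algebraMap S (InvP p S) E * p ^ (N + n) * a) * h3
  have hEp : NZDMod (Ideal.span {(p : S)}) E := by
    intro x hx
    obtain ⟨w, hw⟩ := Ideal.mem_span_singleton.1 hx
    obtain ⟨v, rfl⟩ := Ideal.mem_span_singleton.1
      (hpE w (Ideal.mem_span_singleton.2 ⟨x, hw.symm⟩))
    exact Ideal.mem_span_singleton.2 ⟨v, sub_eq_zero.1 (hE _ (by linear_combination hw))⟩
  have h5 : (p : S) ^ N * x ∈ Ideal.span {(p : S), E} ^ (n + 1 + N) := by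
    refine mem_pow_of_mul_mem_pow_succ hE hpE _ _ ?_
    rw [h4, show n + 1 + N + 1 = n + 2 + N by ring, pow_add _ (n + 2)]
    exact Ideal.mul_mem_mul (Ideal.pow_mem_pow hp _) hy
  have h6 : ∀ k, (p : S) ^ k * x ∈ Ideal.span {(p : S), E} ^ (n + 1 + k) →
      x ∈ Ideal.span {(p : S), E} ^ (n + 1) := by
    intro k
    induction k with
    | zero => simp
    | succ k ih =>
      intro hk
      refine ih ?_
      rw [pow_succ', mul_assoc, ← add_assoc, Ideal.span_pair_comm] at hk
      have := mem_pow_of_mul_mem_pow_succ htf hEp _ _ hk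
      rwa [Ideal.span_pair_comm] at this
  obtain ⟨a', ha', h7⟩ := exists_mem_adjoin_of_mem_pow _ (h6 N h5)
  refine ⟨a', ha', natCast_pow_mul_cancel_invP (n := n) ?_⟩
  rw [h1, ← h7]
  ring

end Adjoin

namespace PreMax

variable {p : ℕ} {S : Type*} [CommRing S] {C : Type*} {E : S}

theorem exists_eDiv : ∃ e : PreMax p C E, p * e = algebraMap S _ E ∧ PreMax.val p C E e =
    MvPolynomial.C (algebraMap S (InvP p S) E * Ring.inverse (p : InvP p S)) := by
  obtain ⟨e, he⟩ := PreMax.exists_val_eq (p := p) (C := C) (E := E)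
    (Algebra.subset_adjoin (Or.inl rfl))
  refine ⟨e, ?_, he⟩
  apply PreMax.val_injective
  rw [map_mul, map_natCast, he, AlgHom.commutes, map_mul, mul_left_comm, natCast_mul_C_inverse,
    mul_one, algebraMap_mvPolynomial_invP]

theorem exists_gam (c : C) (i : ℕ) : ∃ x : PreMax p C E, PreMax.val p C E x = gam p S c i :=
  PreMax.exists_val_eq (Algebra.subset_adjoin (Or.inr ⟨(c, i), rfl⟩))

theorem induction {P : PreMax p C E → Prop} (halg : ∀ s : S, P (algebraMap S _ s))
    (hdiv : ∀ x : PreMax p C E, p * x = algebraMap S _ E → P x)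
    (hgam : ∀ (x : PreMax p C E) (c : C) (i : ℕ), i ≠ 0 → PreMax.val p C E x = gam p S c i → P x)
    (hadd : ∀ x y, P x → P y → P (x + y)) (hmul : ∀ x y, P x → P y → P (x * y))
    (x : PreMax p C E) : P x := by
  have key : ∀ f ∈ maxSubalgebra p C E, ∀ x, PreMax.val p C E x = f → P x := by
    intro f hf
    change f ∈ Algebra.adjoin S _ at hf
    induction hf using Algebra.adjoin_induction with
    | mem f hf =>
      intro x hx
      rcases hf with rfl | ⟨⟨c, i⟩, rfl⟩
      · obtain ⟨e, he, hv⟩ := exists_eDiv (p := p) (C := C) (E := E)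
        rw [← hv] at hx
        exact PreMax.val_injective hx ▸ hdiv e he
      · rcases eq_or_ne i 0 with rfl | hi
        · have h1 : x = algebraMap S _ 1 := by
            apply PreMax.val_injective
            rw [hx, map_one, map_one]
            simp [gam]
          rw [h1]
          exact halg 1
        · exact hgam x c i hi hx
    | algebraMap r =>
      intro x hx
      have : x = algebraMap S _ r := PreMax.val_injective (by rw [hx, AlgHom.commutes])
      rw [this]
      exact halg r
    | add f g hf hg ihf ihg =>
      intro x hx
      obtain ⟨a, ha⟩ := PreMax.exists_val_eq hf
      obtain ⟨b, hb⟩ := PreMax.exists_val_eq hg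
      have : x = a + b := PreMax.val_injective (by rw [hx, map_add, ha, hb])
      rw [this]
      exact hadd _ _ (ihf a ha) (ihg b hb)
    | mul f g hf hg ihf ihg =>
      intro x hx
      obtain ⟨a, ha⟩ := PreMax.exists_val_eq hf
      obtain ⟨b, hb⟩ := PreMax.exists_val_eq hg
      have : x = a * b := PreMax.val_injective (by rw [hx, map_mul, ha, hb])
      rw [this]
      exact hmul _ _ (ihf a ha) (ihg b hb)
  exact key _ (PreMax.val_mem x) x rfl

section

variable (hp : p.Prime) (hu : ∀ n : ℕ, p.Coprime n → IsUnit (n : S))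
include hp hu

theorem factorial_mul_of_val_eq {x : PreMax p C E} {c : C} {i : ℕ}
    (hx : PreMax.val p C E x = gam p S c i) :
    ((i.factorial : ℕ) : PreMax p C E) * x = PreMax.z p E c ^ i := by
  apply PreMax.val_injective
  rw [map_mul, map_natCast, hx, factorial_mul_gam hp hu, map_pow, PreMax.val_z]

variable {T : Type*} [CommRing T]

theorem hom_ext (htf : ∀ x : T, (p : T) * x = 0 → x = 0) {h h' : PreMax p C E →+* T}
    (halg : ∀ s, h (algebraMap S _ s) = h' (algebraMap S _ s))
    (hz : ∀ c, h (PreMax.z p E c) = h' (PreMax.z p E c)) : h = h' := by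
  have huT : ∀ n : ℕ, p.Coprime n → IsUnit (n : T) := fun n hn => by
    have := ((hu n hn).map (algebraMap S (PreMax p C E))).map h
    rwa [map_natCast, map_natCast] at this
  refine RingHom.ext (PreMax.induction halg ?_ ?_ ?_ ?_)
  · intro x hx
    have h1 := halg E
    rw [← hx, map_mul, map_mul, map_natCast, map_natCast] at h1
    exact sub_eq_zero.1 (htf _ (by linear_combination h1))
  · intro x c i hi hx
    have h1 := factorial_mul_of_val_eq hp hu hx
    have h2 := congrArg h h1
    have h3 := congrArg h' h1
    rw [map_mul, map_natCast, map_pow] at h2 h3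
    rw [← hz, ← h2] at h3
    have h4 := isUnit_natCast_invP hp huT (Nat.factorial_ne_zero i)
    apply algebraMap_invP_injective htf
    refine h4.mul_left_cancel ?_
    have h5 := congrArg (algebraMap T (InvP p T)) h3
    rw [map_mul, map_mul, map_natCast] at h5
    exact h5.symm
  · intro x y hx hy
    rw [map_add, map_add, hx, hy]
  · intro x y hx hy
    rw [map_mul, map_mul, hx, hy]

/-- The map is built after inverting `p`. It lands in `T` because it does so on the generators `E/p`
and `γ_i(z_c)`. -/
theorem exists_hom (htf : ∀ x : T, (p : T) * x = 0 → x = 0) (g : S →+* T) {u : T}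
    (hE : p * u = g E) {w : C → T} (hw : ∀ c i, ((i.factorial : ℕ) : T) ∣ w c ^ i) :
    ∃ Ψ : PreMax p C E →+* T, (∀ s, Ψ (algebraMap S _ s) = g s) ∧
      ∀ c, Ψ (PreMax.z p E c) = w c := by
  have huT : ∀ n : ℕ, p.Coprime n → IsUnit (n : T) := fun n hn => by
    have := (hu n hn).map g
    rwa [map_natCast] at this
  let Φ : MvPolynomial C (InvP p S) →+* InvP p T :=
    eval₂Hom (invPMap p g) fun c => algebraMap T _ (w c)
  have hΦ : ∀ s, Φ (algebraMap S _ s) = algebraMap T _ (g s) := fun s => by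
    rw [algebraMap_mvPolynomial_invP, eval₂Hom_C, invPMap_algebraMap]
  have hΦX : ∀ c, Φ (X c) = algebraMap T _ (w c) := fun c => eval₂Hom_X' _ _ _
  have hinj := algebraMap_invP_injective htf
  obtain ⟨Ψ, hΨ⟩ := exists_ringHom_lift (algebraMap T (InvP p T)) hinj
    (Φ.comp (PreMax.val p C E : PreMax p C E →+* _)) (by
      refine PreMax.induction ?_ ?_ ?_ ?_ ?_
      · intro s
        refine ⟨g s, ?_⟩
        rw [RingHom.comp_apply, RingHom.coe_coe, AlgHom.commutes, hΦ]
      · intro x hx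
        refine ⟨u, (isUnit_natCast_self_invP p T).mul_left_cancel ?_⟩
        rw [← map_natCast (algebraMap T (InvP p T)), ← map_mul, hE, map_natCast,
          ← map_natCast (Φ.comp (PreMax.val p C E : PreMax p C E →+* _)), ← map_mul, hx,
          RingHom.comp_apply, RingHom.coe_coe, AlgHom.commutes, hΦ]
      · intro x c i hi hx
        obtain ⟨t, ht⟩ := hw c i
        refine ⟨t, (isUnit_natCast_invP hp huT (Nat.factorial_ne_zero i)).mul_left_cancel ?_⟩
        rw [← map_natCast (algebraMap T (InvP p T)), ← map_mul, ← ht, map_natCast,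
          ← map_natCast (Φ.comp (PreMax.val p C E : PreMax p C E →+* _)), ← map_mul,
          factorial_mul_of_val_eq hp hu hx, map_pow, map_pow, RingHom.comp_apply, RingHom.coe_coe,
          PreMax.val_z, hΦX]
      · rintro x y ⟨a, ha⟩ ⟨b, hb⟩
        exact ⟨a + b, by rw [map_add, map_add, ha, hb]⟩
      · rintro x y ⟨a, ha⟩ ⟨b, hb⟩
        exact ⟨a * b, by rw [map_mul, map_mul, ha, hb]⟩)
  refine ⟨Ψ, fun s => hinj ?_, fun c => hinj ?_⟩
  · rw [hΨ, RingHom.comp_apply, RingHom.coe_coe, AlgHom.commutes, hΦ]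
  · rw [hΨ, RingHom.comp_apply, RingHom.coe_coe, PreMax.val_z, hΦX]

theorem natCast_dvd_of_eDiv_mul (htf : ∀ x : S, (p : S) * x = 0 → x = 0)
    (hE : ∀ x : S, E * x = 0 → x = 0) (hpE : NZDMod (Ideal.span {E}) (p : S))
    {e t s : PreMax p C E} (he : p * e = algebraMap S _ E) (h : e * t = p * s) :
    (p : PreMax p C E) ∣ t := by
  obtain ⟨e₀, he₀, hv⟩ := exists_eDiv (p := p) (C := C) (E := E)
  have hee : e = e₀ := sub_eq_zero.1 (PreMax.natCast_torsionFree _ (by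
    rw [mul_sub, he, he₀, sub_self]))
  subst hee
  have ht := PreMax.val_mem t
  have hs := PreMax.val_mem s
  rw [maxSubalgebra_eq_pdOver hp hu, mem_pdOver] at ht hs
  have hmem : MvPolynomial.C (Ring.inverse (p : InvP p S)) * PreMax.val p C E t ∈
      maxSubalgebra p C E := by
    rw [maxSubalgebra_eq_pdOver hp hu, mem_pdOver]
    intro d
    obtain ⟨a', ha', h1⟩ := natCast_dvd_of_mul_dvd_adjoin htf hE hpE (ht d) (hs d) (by
      have h2 := congrArg (fun x => coeff d (PreMax.val p C E x)) h
      simp only [map_mul, map_natCast, hv] at h2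
      rw [← map_mul, coeff_C_mul, ← map_natCast (MvPolynomial.C : InvP p S →+* _),
        coeff_C_mul] at h2
      linear_combination (fac d : InvP p S) * h2)
    have h3 : (fac d : InvP p S) * coeff d (MvPolynomial.C (Ring.inverse (p : InvP p S)) *
        PreMax.val p C E t) = a' := by
      rw [coeff_C_mul, mul_left_comm, h1, Ring.inverse_mul_cancel_left _ _
        (isUnit_natCast_self_invP p S)]
    rw [h3]
    exact ha'
  obtain ⟨t', ht'⟩ := PreMax.exists_val_eq hmem
  refine ⟨t', PreMax.val_injective ?_⟩
  rw [map_mul, map_natCast, ht', ← mul_assoc, natCast_mul_C_inverse, one_mul]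

/-- One factor `p` is split off `E = p · (E/p)`; the other factor is regular modulo `p` and does not
change the `p`-adic order. -/
theorem mem_pow_of_algebraMap_mul_mem (htf : ∀ x : S, (p : S) * x = 0 → x = 0)
    (hE : ∀ x : S, E * x = 0 → x = 0) (hpE : NZDMod (Ideal.span {E}) (p : S)) (n : ℕ)
    (t : PreMax p C E) (h : algebraMap S _ E * t ∈ Ideal.span {(p : PreMax p C E)} ^ (n + 1)) :
    t ∈ Ideal.span {(p : PreMax p C E)} ^ n := by
  obtain ⟨e, he, -⟩ := exists_eDiv (p := p) (C := C) (E := E)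
  rw [← he, mul_assoc] at h
  have h1 := mem_pow_of_mul_mem_singleton_pow_succ PreMax.natCast_torsionFree n _ h
  clear h
  induction n generalizing t with
  | zero => simp
  | succ n ih =>
    rw [Ideal.span_singleton_pow, Ideal.mem_span_singleton] at h1
    obtain ⟨s, hs⟩ := h1
    obtain ⟨t', rfl⟩ := natCast_dvd_of_eDiv_mul hp hu htf hE hpE he
      (s := (p : PreMax p C E) ^ n * s) (by rw [hs]; ring)
    rw [pow_succ']
    refine Ideal.mul_mem_mul (Ideal.mem_span_singleton_self _) (ih t' ?_)
    rw [Ideal.span_singleton_pow, Ideal.mem_span_singleton]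
    exact ⟨s, sub_eq_zero.1 (PreMax.natCast_torsionFree _ (by linear_combination hs))⟩

end

end PreMax

end PrismaticEnvelope

namespace PrismaticEnvelope

/-! ### The ring `A_max` and its Frobenius -/

section Factorial

variable {p : ℕ} {T : Type*} [CommRing T]

theorem natCast_mul_eq_zero_of_torsionFree (hp : p.Prime)
    (htf : ∀ x : T, (p : T) * x = 0 → x = 0) (hu : ∀ n : ℕ, p.Coprime n → IsUnit (n : T)) {n : ℕ}
    (hn : n ≠ 0) {x : T} (hx : (n : T) * x = 0) : x = 0 := by
  apply algebraMap_invP_injective htf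
  refine (isUnit_natCast_invP hp hu hn).mul_left_cancel ?_
  rw [← map_natCast (algebraMap T (InvP p T)), ← map_mul, hx, map_zero, mul_zero]

/-- The `p`-adic valuation of `i!` is at most `i - 1` for `i ≥ 1`, so `p^i / i!` keeps a factor `p`.
-/
theorem exists_natCast_pow_eq_factorial_mul (hp : p.Prime)
    (hu : ∀ n : ℕ, p.Coprime n → IsUnit (n : T)) (i : ℕ) (hi : i ≠ 0) :
    ∃ t : T, (p : T) ^ i = (i.factorial : ℕ) * (p * t) := by
  induction i using Nat.strong_induction_on with
  | _ i ih =>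
    obtain ⟨u, hup, h⟩ := exists_factorial_eq hp i
    obtain ⟨v, hv⟩ := (hu u hup).exists_right_inv
    rcases eq_or_ne (i / p) 0 with h0 | h0
    · rw [h0] at h
      refine ⟨v * p ^ (i - 1), ?_⟩
      obtain ⟨j, rfl⟩ := Nat.exists_eq_succ_of_ne_zero hi
      rw [h]
      push_cast
      simp only [Nat.succ_eq_add_one]
      linear_combination (-(p : T) ^ (j + 1)) * hv
    · obtain ⟨t, ht⟩ := ih (i / p) (Nat.div_lt_self (Nat.pos_of_ne_zero hi) hp.one_lt) h0
      -- One `i / p` pays for the explicit power of `p` in `i!`, the other for `(i/p)!` by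
      -- induction; this uses `p ≥ 2`.
      have h2 : i / p + i / p ≤ i := by
        have := Nat.div_mul_le_self i p
        nlinarith [hp.two_le]
      obtain ⟨k, hk⟩ := Nat.exists_eq_add_of_le h2
      refine ⟨v * t * p ^ k, ?_⟩
      have h3 : (p : T) ^ i = p ^ (i / p) * p ^ (i / p) * p ^ k := by
        rw [← pow_add, ← pow_add, ← hk]
      rw [h3, h]
      push_cast
      linear_combination ((p : T) ^ (i / p) * p ^ k) * ht -
        ((p : T) ^ (i / p) * (i / p).factorial * p * t * p ^ k) * hv

end Factorial

namespace RingMax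

variable {p : ℕ} {A C : Type*} [CommRing A] {E : A}

theorem isCompletion : IsCompletion (Ideal.span {(p : PreMax p C E)})
    (algebraMap (PreMax p C E) (RingMax p C E)) :=
  isCompletion_adicCompletion (Submodule.fg_span (by simp))

instance isAdicComplete : IsAdicComplete (Ideal.span {(p : RingMax p C E)}) (RingMax p C E) := by
  have := (isCompletion (p := p) (C := C) (E := E)).complete
  rwa [Ideal.map_span, Set.image_singleton, map_natCast] at this

theorem natCast_torsionFree (x : RingMax p C E) (hx : (p : RingMax p C E) * x = 0) : x = 0 := by
  refine isCompletion.mul_eq_zero (e := (p : PreMax p C E)) (fun n t h => ?_)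
    (by rw [map_natCast]; exact hx)
  exact mem_pow_of_mul_mem_singleton_pow_succ PreMax.natCast_torsionFree n t h

theorem isUnit_natCast {n : ℕ} (hn : p.Coprime n) : IsUnit (n : RingMax p C E) :=
  isUnit_natCast_of_coprime p hn

theorem exists_eDiv : ∃ e : RingMax p C E, p * e = algebraMap A _ E := by
  obtain ⟨e, he, -⟩ := PreMax.exists_eDiv (p := p) (C := C) (E := E)
  refine ⟨algebraMap _ _ e, ?_⟩
  rw [← map_natCast (algebraMap (PreMax p C E) (RingMax p C E)), ← map_mul, he]
  rfl

/-- An element of the kernel equals `x - ε(x)`. Approximating `x` modulo `p` reduces divisibility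
claims on the kernel to the uncompleted ring, where the generators can be inspected. -/
theorem eq_zero_of_sub_dvd {ε : RingMax p C E →+* RingMax p C E} {x : RingMax p C E}
    (hx : ε x = 0) : ∃ (t : PreMax p C E) (y : RingMax p C E),
      x = (algebraMap _ _ t - ε (algebraMap _ _ t)) + p * y := by
  obtain ⟨t, ht⟩ := isCompletion.dense x 1
  rw [pow_one, Ideal.map_span, Set.image_singleton, map_natCast, Ideal.mem_span_singleton] at ht
  obtain ⟨y, hy⟩ := ht
  have h1 := congrArg ε hy
  rw [map_sub, hx, map_mul, map_natCast] at h1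
  exact ⟨t, y - ε y, by linear_combination hy - h1⟩

section

variable (hp : p.Prime) (hu : ∀ n : ℕ, p.Coprime n → IsUnit (n : A))
include hp hu

theorem mul_eq_zero (htf : ∀ x : A, (p : A) * x = 0 → x = 0)
    (hE : ∀ x : A, E * x = 0 → x = 0) (hpE : NZDMod (Ideal.span {E}) (p : A))
    (x : RingMax p C E) (hx : algebraMap A _ E * x = 0) : x = 0 :=
  isCompletion.mul_eq_zero (e := algebraMap A (PreMax p C E) E)
    (PreMax.mem_pow_of_algebraMap_mul_mem hp hu htf hE hpE) hx

variable {T : Type*} [CommRing T] [IsAdicComplete (Ideal.span {(p : T)}) T]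

theorem hom_ext (htf : ∀ x : T, (p : T) * x = 0 → x = 0) {h h' : RingMax p C E →+* T}
    (halg : ∀ a, h (algebraMap A _ a) = h' (algebraMap A _ a))
    (hz : ∀ c, h (RingMax.z p E c) = h' (RingMax.z p E c)) : h = h' := by
  refine isCompletion.hom_ext (Ideal.span {(p : T)}) ?_ (PreMax.hom_ext hp hu htf halg hz)
  rw [Ideal.span_singleton_le_iff_mem, Ideal.mem_comap, map_natCast]
  exact Ideal.mem_span_singleton_self _

theorem exists_hom (htf : ∀ x : T, (p : T) * x = 0 → x = 0) (g : A →+* T) {u : T}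
    (hE : p * u = g E) {w : C → T} (hw : ∀ c i, ((i.factorial : ℕ) : T) ∣ w c ^ i) :
    ∃ Ψ : RingMax p C E →+* T, (∀ a, Ψ (algebraMap A _ a) = g a) ∧
      ∀ c, Ψ (RingMax.z p E c) = w c := by
  obtain ⟨Ψ, h1, h2⟩ := PreMax.exists_hom hp hu htf g hE hw
  obtain ⟨l, hl⟩ := (isCompletion (p := p) (C := C) (E := E)).exists_lift
    (Ideal.span {(p : T)}) Ψ (by
      rw [Ideal.span_singleton_le_iff_mem, Ideal.mem_comap, map_natCast]
      exact Ideal.mem_span_singleton_self _)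
  have hl' : ∀ x, l (algebraMap _ _ x) = Ψ x := fun x => congrArg (fun f => f x) hl
  exact ⟨l, fun a => (hl' (algebraMap A _ a)).trans (h1 a),
    fun c => (hl' (PreMax.z p E c)).trans (h2 c)⟩

theorem exists_eval_zero : ∃ ε : RingMax p C E →+* RingMax p C E,
    (∀ a, ε (algebraMap A _ a) = algebraMap A _ a) ∧ ∀ c, ε (RingMax.z p E c) = 0 := by
  obtain ⟨e, he⟩ := exists_eDiv (p := p) (C := C) (E := E)
  refine exists_hom hp hu natCast_torsionFree (algebraMap A _) he (w := fun _ => 0) fun c i => ?_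
  rcases i with _ | i
  · simp
  · simp

/-- Positive divided powers satisfy `γ_i^p = p · (integer) · γ_{pi}`, and having a `p`-th power
divisible by `p` is stable under sums and multiples. On `A` and `E/p` the difference `t - ε(t)` is
zero. -/
theorem natCast_dvd_pow {ε : RingMax p C E →+* RingMax p C E}
    (hε : ∀ a, ε (algebraMap A _ a) = algebraMap A _ a) (hεz : ∀ c, ε (RingMax.z p E c) = 0)
    {x : RingMax p C E} (hx : ε x = 0) : (p : RingMax p C E) ∣ x ^ p := by
  have hadd : ∀ a b : RingMax p C E, (p : RingMax p C E) ∣ a ^ p → (p : RingMax p C E) ∣ b ^ p →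
      (p : RingMax p C E) ∣ (a + b) ^ p := fun a b ha hb => by
    rw [add_pow_eq_add_sum_Ioo hp]
    exact dvd_add (dvd_add ha hb) (dvd_mul_right _ _)
  have key : ∀ t : PreMax p C E, (p : RingMax p C E) ∣
      (algebraMap _ (RingMax p C E) t - ε (algebraMap _ _ t)) ^ p := by
    refine PreMax.induction ?_ ?_ ?_ ?_ ?_
    · intro a
      have : algebraMap (PreMax p C E) (RingMax p C E) (algebraMap A _ a) = algebraMap A _ a := rfl
      rw [this, hε, sub_self, zero_pow hp.ne_zero]
      exact dvd_zero _
    · intro t ht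
      have h1 : (p : RingMax p C E) * algebraMap _ (RingMax p C E) t = algebraMap A _ E := by
        rw [← map_natCast (algebraMap (PreMax p C E) (RingMax p C E)), ← map_mul, ht]
        rfl
      have h2 := congrArg ε h1
      rw [hε, map_mul, map_natCast] at h2
      have h3 : algebraMap _ (RingMax p C E) t - ε (algebraMap _ _ t) = 0 :=
        natCast_torsionFree _ (by rw [mul_sub, h1, h2, sub_self])
      rw [h3, zero_pow hp.ne_zero]
      exact dvd_zero _
    · intro t c i hi ht
      have h1 : ε (algebraMap _ _ t) = 0 := by
        refine natCast_mul_eq_zero_of_torsionFree hp natCast_torsionFree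
          (fun n => isUnit_natCast) (Nat.factorial_ne_zero i) ?_
        have h2 := congrArg (fun s => ε (algebraMap _ (RingMax p C E) s))
          (PreMax.factorial_mul_of_val_eq hp hu ht)
        simp only [map_mul, map_natCast, map_pow] at h2
        rw [h2]
        exact (congrArg (· ^ i) (hεz c)).trans (zero_pow hi)
      obtain ⟨s, hs⟩ := PreMax.exists_gam (p := p) (E := E) c (p * i)
      have h3 : t ^ p = p * (((Nat.uniformBell p i * (p - 1).factorial : ℕ) : PreMax p C E) * s) :=
        PreMax.val_injective (by
          rw [map_pow, ht, gam_pow_eq hp hu c hi, map_mul, map_mul, map_natCast, map_natCast, hs])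
      rw [h1, sub_zero, ← map_pow, h3, map_mul, map_natCast]
      exact dvd_mul_right _ _
    · intro s t hs ht
      rw [map_add, map_add, add_sub_add_comm]
      exact hadd _ _ hs ht
    · intro s t hs ht
      have : algebraMap _ (RingMax p C E) (s * t) - ε (algebraMap _ _ (s * t)) =
          (algebraMap _ _ s - ε (algebraMap _ _ s)) * algebraMap _ _ t +
            ε (algebraMap _ _ s) * (algebraMap _ _ t - ε (algebraMap _ _ t)) := by
        simp only [map_mul]
        ring
      rw [this]
      refine hadd _ _ ?_ ?_
      · rw [mul_pow]; exact Dvd.dvd.mul_right hs _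
      · rw [mul_pow]; exact Dvd.dvd.mul_left ht _
  obtain ⟨t, y, rfl⟩ := eq_zero_of_sub_dvd hx
  refine hadd _ _ (key t) ?_
  rw [mul_pow]
  exact Dvd.dvd.mul_right (dvd_pow_self _ hp.ne_zero) _

/-- Here `ψ(γ_i(z_c)) = (p^i / i!) w_c^i`, and `p^i / i!` is divisible by `p` for `i ≥ 1`. -/
theorem natCast_dvd_frob {ε ψ : RingMax p C E →+* RingMax p C E}
    (hε : ∀ a, ε (algebraMap A _ a) = algebraMap A _ a) (hεz : ∀ c, ε (RingMax.z p E c) = 0)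
    {w : C → RingMax p C E} (hψz : ∀ c, ψ (RingMax.z p E c) = p * w c)
    {x : RingMax p C E} (hx : ε x = 0) : (p : RingMax p C E) ∣ ψ x := by
  have key : ∀ t : PreMax p C E, (p : RingMax p C E) ∣
      ψ (algebraMap _ (RingMax p C E) t - ε (algebraMap _ _ t)) := by
    refine PreMax.induction ?_ ?_ ?_ ?_ ?_
    · intro a
      have : algebraMap (PreMax p C E) (RingMax p C E) (algebraMap A _ a) = algebraMap A _ a := rfl
      rw [this, hε, sub_self, map_zero]
      exact dvd_zero _
    · intro t ht
      have h1 : (p : RingMax p C E) * algebraMap _ (RingMax p C E) t = algebraMap A _ E := by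
        rw [← map_natCast (algebraMap (PreMax p C E) (RingMax p C E)), ← map_mul, ht]
        rfl
      have h2 := congrArg ε h1
      rw [hε, map_mul, map_natCast] at h2
      have h3 : algebraMap _ (RingMax p C E) t - ε (algebraMap _ _ t) = 0 :=
        natCast_torsionFree _ (by rw [mul_sub, h1, h2, sub_self])
      rw [h3, map_zero]
      exact dvd_zero _
    · intro t c i hi ht
      have hfac := PreMax.factorial_mul_of_val_eq hp hu ht
      have h1 : ε (algebraMap _ _ t) = 0 := by
        refine natCast_mul_eq_zero_of_torsionFree hp natCast_torsionFree
          (fun n => isUnit_natCast) (Nat.factorial_ne_zero i) ?_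
        have h2 := congrArg (fun s => ε (algebraMap _ (RingMax p C E) s)) hfac
        simp only [map_mul, map_natCast, map_pow] at h2
        rw [h2]
        exact (congrArg (· ^ i) (hεz c)).trans (zero_pow hi)
      rw [h1, sub_zero]
      obtain ⟨s, hs⟩ := exists_natCast_pow_eq_factorial_mul (T := RingMax p C E) hp
        (fun n => isUnit_natCast) i hi
      refine ⟨s * w c ^ i, sub_eq_zero.1 (natCast_mul_eq_zero_of_torsionFree hp natCast_torsionFree
          (fun n => isUnit_natCast) (Nat.factorial_ne_zero i) ?_)⟩
      have h2 := congrArg (fun s => ψ (algebraMap _ (RingMax p C E) s)) hfac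
      simp only [map_mul, map_natCast, map_pow] at h2
      have h3 : ψ (algebraMap _ _ (PreMax.z p E c)) = p * w c := hψz c
      rw [h3, mul_pow, hs] at h2
      linear_combination h2
    · intro s t hs ht
      rw [map_add, map_add, add_sub_add_comm, map_add]
      exact dvd_add hs ht
    · intro s t hs ht
      have : algebraMap _ (RingMax p C E) (s * t) - ε (algebraMap _ _ (s * t)) =
          (algebraMap _ _ s - ε (algebraMap _ _ s)) * algebraMap _ _ t +
            ε (algebraMap _ _ s) * (algebraMap _ _ t - ε (algebraMap _ _ t)) := by
        simp only [map_mul]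
        ring
      rw [this, map_add, map_mul, map_mul]
      exact dvd_add (Dvd.dvd.mul_right hs _) (Dvd.dvd.mul_left ht _)
  obtain ⟨t, y, rfl⟩ := eq_zero_of_sub_dvd hx
  rw [map_add, map_mul, map_natCast]
  exact dvd_add (key t) (dvd_mul_right _ _)

end

end RingMax

end PrismaticEnvelope

namespace PrismaticEnvelope

/-! ### The embedding of the completed envelope into `A_max` -/

/-- The hypotheses on a Frobenius `φ` of `A⟦X⟧`, extending the Frobenius `φA` of `A`, under which
the `δ`-envelope `A⟦X⟧{X/E}` embeds into `A_max`. -/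
structure SeriesHyp (p : ℕ) {A σ : Type*} [CommRing A] (φA : A →+* A) (E : A)
    (φ : MvPowerSeries σ A →+* MvPowerSeries σ A) : Prop where
  env : EnvHyp p φ (algebraMap A (MvPowerSeries σ A) E) MvPowerSeries.X
  torsionFree : ∀ x : A, (p : A) * x = 0 → x = 0
  isUnit : ∀ n : ℕ, p.Coprime n → IsUnit (n : A)
  mul_eq_zero : ∀ x : A, E * x = 0 → x = 0
  nzd_p : NZDMod (Ideal.span {E}) (p : A)
  distinguished : ∃ ε, IsUnit ε ∧ φA E = E ^ p + p * ε
  frob_C : ∀ a, φ (MvPowerSeries.C a) = MvPowerSeries.C (φA a)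
  frob_X : ∀ c, (p : MvPowerSeries σ A) ∣ φ (MvPowerSeries.X c) - MvPowerSeries.X c ^ p
  constantCoeff_frob_X : ∀ c, MvPowerSeries.constantCoeff (φ (MvPowerSeries.X c)) = 0

/-- If `p` divides the image of `E`, then `φⁿ⁺¹(E) = p v + E^p a` maps to `p` times a unit, since
the second term contributes a multiple of `p²`. -/
theorem EnvHyp.frob_mul_eq_zero {p : ℕ} {B C T : Type*} [CommRing B] [CommRing T] {φ : B →+* B}
    {E : B} {y : C → B} (H : EnvHyp p φ E y) (htf : ∀ x : T, (p : T) * x = 0 → x = 0)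
    [IsAdicComplete (Ideal.span {(p : T)}) T] (g : B →+* T) (hE : (p : T) ∣ g E) (n : ℕ) (x : T)
    (hx : g (φ^[n + 1] E) * x = 0) : x = 0 := by
  obtain ⟨v, a, hv, h⟩ := H.iterate_eq n
  obtain ⟨e, he⟩ := hE
  obtain ⟨v', hv'⟩ := hv.exists_left_inv
  have hp := H.prime
  have hpow : (p : T) ^ p = p * (p * p ^ (p - 2)) := by
    rw [← pow_succ', ← pow_succ', show p - 2 + 1 + 1 = p by have := hp.two_le; omega]
  have hv'' : g v' * g v = 1 := by rw [← map_mul, hv', map_one]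
  have h1 : g (φ^[n + 1] E) = p * (g v * (p * (p ^ (p - 2) * e ^ p * g a * g v') + 1)) := by
    rw [h, map_add, map_mul, map_mul, map_pow, map_natCast, he, mul_pow, hpow]
    linear_combination (-(p : T) * p * p ^ (p - 2) * e ^ p * g a) * hv''
  have h2 := Ideal.mem_jacobson_bot.1 (natCast_mem_jacobson_of_isAdicComplete (S := T) p)
    (p ^ (p - 2) * e ^ p * g a * g v')
  rw [h1, mul_assoc] at hx
  exact (((hv.map g).mul h2).mul_right_eq_zero).1 (htf _ hx)

namespace SeriesHyp

variable {p : ℕ} {A σ C : Type*} [Finite σ] [CommRing A] {φA : A →+* A} {E : A}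
  {φ : MvPowerSeries σ A →+* MvPowerSeries σ A}

theorem exists_frob_eq_mul (H : SeriesHyp p φA E φ) : ∃ u : RingMax p C E, IsUnit u ∧
    algebraMap A _ (φA E) = p * u := by
  obtain ⟨ε, hε, h⟩ := H.distinguished
  obtain ⟨e, he⟩ := RingMax.exists_eDiv (p := p) (C := C) (E := E)
  have hp := H.env.prime
  obtain ⟨ε', hε'⟩ := (hε.map (algebraMap A (RingMax p C E))).exists_left_inv
  have hpow : (p : RingMax p C E) ^ p = p * (p * p ^ (p - 2)) := by
    rw [← pow_succ', ← pow_succ', show p - 2 + 1 + 1 = p by have := hp.two_le; omega]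
  refine ⟨algebraMap A _ ε * (p * (p ^ (p - 2) * e ^ p * ε') + 1), (hε.map _).mul
    (Ideal.mem_jacobson_bot.1 (natCast_mem_jacobson_of_isAdicComplete p) _), ?_⟩
  rw [h, map_add, map_mul, map_pow, map_natCast, ← he, mul_pow, hpow]
  linear_combination (-(p : RingMax p C E) * p * p ^ (p - 2) * e ^ p) * hε'

/-- Since `E = p · (E/p)` in the target, the values `E z_c` are topologically nilpotent for the
`p`-adic topology. -/
theorem exists_eval (κ : σ → C) :
    ∃ β : MvPowerSeries σ A →+* RingMax p C E,
      (∀ a, β (MvPowerSeries.C a) = algebraMap A _ a) ∧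
      (∀ c, β (MvPowerSeries.X c) = algebraMap A _ E * RingMax.z p E (κ c)) ∧
      ∀ b, MvPowerSeries.constantCoeff b = 0 → (p : RingMax p C E) ∣ β b := by
  obtain ⟨e, he⟩ := RingMax.exists_eDiv (p := p) (C := C) (E := E)
  have hX : ∀ c, algebraMap A _ E * RingMax.z p E (κ c) ∈ Ideal.span {(p : RingMax p C E)} :=
    fun c => by
      rw [← he, mul_assoc]
      exact Ideal.mul_mem_right _ _ (Ideal.mem_span_singleton_self _)
  obtain ⟨β, hC, hβX⟩ := exists_mvPowerSeries_eval (Ideal.span {(p : RingMax p C E)})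
    (algebraMap A (RingMax p C E)) (fun c => algebraMap A _ E * RingMax.z p E (κ c)) hX
  refine ⟨β, hC, hβX, fun b hb => ?_⟩
  have := Fintype.ofFinite σ
  have h := span_C_sup_span_X (σ := σ) (0 : A) Finset.univ
  rw [Finset.coe_univ, Set.image_univ, map_zero, Ideal.span_singleton_zero, bot_sup_eq] at h
  have h1 : b ∈ Ideal.span (Set.range (MvPowerSeries.X : σ → MvPowerSeries σ A)) := by
    rw [h]
    intro d hd
    have hd0 : d = 0 := Finsupp.ext fun c => hd c trivial
    rw [hd0, MvPowerSeries.coeff_zero_eq_constantCoeff_apply, hb]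
    exact zero_mem _
  have h2 : Ideal.span (Set.range (MvPowerSeries.X : σ → MvPowerSeries σ A)) ≤
      (Ideal.span {(p : RingMax p C E)}).comap β := by
    rw [Ideal.span_le]
    rintro _ ⟨c, rfl⟩
    change β _ ∈ Ideal.span {(p : RingMax p C E)}
    rw [hβX]
    exact hX c
  exact Ideal.mem_span_singleton.1 (h2 h1)

/-- The Frobenius `ψ` of `A_max` must send `z_c` to `φ(X_c)/φ(E)`, where `φ(E) = p u` with `u` a
unit. It sends `E/p` to `u` and so need not lift the `p`-power map; `exists_deltaEnv_hom` is
therefore applied with `K` the kernel of `z ↦ 0`. -/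
theorem exists_hom_deltaEnv (H : SeriesHyp p φA E φ) (κ : σ ≃ C) :
    ∃ g : DeltaEnv p φ (algebraMap A (MvPowerSeries σ A) E) MvPowerSeries.X →+* RingMax p C E,
      (∀ a : A, g (algebraMap (MvPowerSeries σ A) _ (MvPowerSeries.C a)) = algebraMap A _ a) ∧
      ∀ c, g (DeltaEnv.z p φ _ _ c 0) = RingMax.z p E (κ c) := by
  have hp := H.env.prime
  obtain ⟨β, hβC, hβX, hβ⟩ := exists_eval (p := p) (E := E) κ
  obtain ⟨u, hu, hφE⟩ := H.exists_frob_eq_mul (C := C)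
  obtain ⟨u', hu'⟩ := hu.exists_right_inv
  obtain ⟨e, he⟩ := RingMax.exists_eDiv (p := p) (C := C) (E := E)
  obtain ⟨ε, hε, hεz⟩ := RingMax.exists_eval_zero (C := C) (E := E) hp H.isUnit
  have htf := RingMax.natCast_torsionFree (p := p) (C := C) (E := E)
  -- In `φ(X_c) = X_c^p + p b` both terms map to multiples of `p²`: the first because `p` divides
  -- `E`, the second because `b` has no constant term. One factor `p` is consumed by the division by
  -- `φ(E)`; the other makes `ψ(z_c)` a multiple of `p`, which then has divided powers.
  have hw : ∀ c, ∃ w : RingMax p C E, β (φ (MvPowerSeries.X c)) = p * (p * w) := by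
    intro c
    obtain ⟨b, hb⟩ := H.frob_X c
    have hb0 : MvPowerSeries.constantCoeff b = 0 := by
      refine H.torsionFree _ ?_
      have h1 := congrArg MvPowerSeries.constantCoeff hb
      rw [map_sub, H.constantCoeff_frob_X, map_pow, MvPowerSeries.constantCoeff_X,
        zero_pow hp.ne_zero, sub_zero, map_mul, map_natCast] at h1
      exact h1.symm
    obtain ⟨s, hs⟩ := hβ b hb0
    have hpow : (p : RingMax p C E) ^ p = p * (p * p ^ (p - 2)) := by
      rw [← pow_succ', ← pow_succ', show p - 2 + 1 + 1 = p by have := hp.two_le; omega]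
    refine ⟨p ^ (p - 2) * (e * RingMax.z p E (κ c)) ^ p + s, ?_⟩
    rw [sub_eq_iff_eq_add.1 hb, map_add, map_mul, map_natCast, map_pow, hβX, hs, ← he, mul_assoc,
      mul_pow, hpow]
    ring
  choose w hw using hw
  have hcancel : ∀ c, (p : RingMax p C E) * u * (p * (u' * w c)) = β (φ (MvPowerSeries.X c)) :=
    fun c => by
      rw [hw]
      linear_combination (p * p * w c) * hu'
  obtain ⟨ψ, hψ, hψz⟩ := RingMax.exists_hom hp H.isUnit htf
    ((algebraMap A (RingMax p C E)).comp φA) (u := u) (by rw [RingHom.comp_apply, hφE])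
    (w := fun c => p * (u' * w (κ.symm c))) (by
      intro c i
      rcases eq_or_ne i 0 with rfl | hi
      · simp
      obtain ⟨t, ht⟩ := exists_natCast_pow_eq_factorial_mul (T := RingMax p C E) hp
        (fun n => RingMax.isUnit_natCast) i hi
      rw [mul_pow, ht, mul_assoc]
      exact dvd_mul_right _ _)
  have hψβ : ∀ b, β (φ b) = ψ (β b) := by
    have : β.comp φ = ψ.comp β := by
      refine mvPowerSeries_hom_ext (Ideal.span {(p : RingMax p C E)}) (fun a => ?_) (fun c => ?_)
        fun c => ?_
      · rw [RingHom.comp_apply, RingHom.comp_apply, H.frob_C, hβC, hβC, hψ]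
        rfl
      · rw [RingHom.comp_apply, RingHom.comp_apply, hβX, map_mul, hψ, hψz, RingHom.comp_apply, hφE,
          Equiv.symm_apply_apply, hcancel]
      · rw [RingHom.comp_apply, hw]
        exact Ideal.mul_mem_right _ _ (Ideal.mem_span_singleton_self _)
    exact fun b => congrArg (fun f => f b) this
  have hεβ : ∀ b, ε (β b) = algebraMap A _ (MvPowerSeries.constantCoeff b) := by
    have : ε.comp β = (algebraMap A (RingMax p C E)).comp MvPowerSeries.constantCoeff := by
      refine mvPowerSeries_hom_ext (Ideal.span {(p : RingMax p C E)}) (fun a => ?_) (fun c => ?_)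
        fun c => ?_
      · rw [RingHom.comp_apply, RingHom.comp_apply, hβC, hε, MvPowerSeries.constantCoeff_C]
      · rw [RingHom.comp_apply, RingHom.comp_apply, hβX, map_mul, hεz, mul_zero,
          MvPowerSeries.constantCoeff_X, map_zero]
      · rw [RingHom.comp_apply, hβX, map_mul, hεz, mul_zero]
        exact zero_mem _
    exact fun b => congrArg (fun f => f b) this
  have hεw : ∀ c, ε (p * (u' * w c)) = 0 := by
    intro c
    have h1 := congrArg ε (hcancel c)
    rw [hεβ, H.constantCoeff_frob_X, map_zero, ← hφE, map_mul, hε, hφE, mul_assoc] at h1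
    have h2 := htf _ h1
    exact (hu.mul_right_eq_zero).1 h2
  -- This makes the kernel of `ε` stable under `ψ`; it suffices that `ε` kills `ψ(z_c)`.
  have hεψ : ∀ x, ε (ψ x) = ε (ψ (ε x)) := by
    have : ε.comp ψ = (ε.comp ψ).comp ε := by
      refine RingMax.hom_ext hp H.isUnit htf (fun a => ?_) fun c => ?_
      · rw [RingHom.comp_apply (ε.comp ψ), hε]
      · rw [RingHom.comp_apply (ε.comp ψ), hεz, map_zero, RingHom.comp_apply, hψz, hεw]
    exact fun x => congrArg (fun f => f x) this
  obtain ⟨g, hgB, hgz⟩ := exists_deltaEnv_hom (y := MvPowerSeries.X)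
    (E := algebraMap A (MvPowerSeries σ A) E) hp H.env.frobeniusLift htf (ψ := ψ)
    (RingHom.ker ε) (fun x hx => by
      rw [RingHom.mem_ker, map_mul, map_natCast] at hx
      exact htf _ hx) (fun x hx => by
      rw [RingHom.mem_ker] at hx ⊢
      rw [hεψ, hx, map_zero, map_zero])
    (fun x hx => RingMax.natCast_dvd_frob hp H.isUnit hε hεz hψz hx)
    (fun x hx => RingMax.natCast_dvd_pow hp H.isUnit hε hεz hx) hψβ
    (z := fun c => RingMax.z p E (κ c)) (fun c => hεz _) (fun c => by
      rw [hβX, MvPowerSeries.algebraMap_apply, Algebra.algebraMap_self, RingHom.id_apply, hβC])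
  exact ⟨g, fun a => by rw [hgB, hβC], hgz⟩

theorem map_le_comap {T : Type*} [CommRing T]
    (g : DeltaEnv p φ (algebraMap A (MvPowerSeries σ A) E) MvPowerSeries.X →+* T)
    (hg : (p : T) ∣ g (algebraMap (MvPowerSeries σ A) _ (algebraMap A (MvPowerSeries σ A) E))) :
    envIdeal p φ (algebraMap A (MvPowerSeries σ A) E) MvPowerSeries.X ≤
      (Ideal.span {(p : T)}).comap g := by
  rw [Ideal.span_le]
  rintro _ (rfl | rfl)
  · change g _ ∈ Ideal.span {(p : T)}
    rw [map_natCast]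
    exact Ideal.mem_span_singleton_self _
  · exact Ideal.mem_span_singleton.2 hg

/-- The homomorphism `ι` from the completed envelope to `A_max`. -/
theorem exists_algHom (H : SeriesHyp p φA E φ) (κ : σ ≃ C) :
    ∃ ι : ComplEnv p φ (algebraMap A (MvPowerSeries σ A) E) MvPowerSeries.X →ₐ[A] RingMax p C E,
      ∀ c, ι (ComplEnv.z p φ _ _ c 0) = RingMax.z p E (κ c) := by
  obtain ⟨g, hgC, hgz⟩ := H.exists_hom_deltaEnv κ
  obtain ⟨e, he⟩ := RingMax.exists_eDiv (p := p) (C := C) (E := E)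
  obtain ⟨ι, hι⟩ := EnvHyp.isCompletion_env.exists_lift (Ideal.span {(p : RingMax p C E)}) g
    (map_le_comap g ⟨e, (hgC E).trans he.symm⟩)
  have hι' : ∀ x, ι (algebraMap _ _ x) = g x := fun x => congrArg (fun f => f x) hι
  refine ⟨{ toRingHom := ι, commutes' := fun a => ?_ }, fun c => ?_⟩
  · exact (hι' (algebraMap (MvPowerSeries σ A) _ (MvPowerSeries.C a))).trans (hgC a)
  · exact (hι' (DeltaEnv.z p φ _ _ c 0)).trans (hgz c)

theorem hom_ext (H : SeriesHyp p φA E φ) {T : Type*} [CommRing T]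
    [IsAdicComplete (Ideal.span {(p : T)}) T] (htf : ∀ x : T, (p : T) * x = 0 → x = 0)
    {h h' : ComplEnv p φ (algebraMap A (MvPowerSeries σ A) E) MvPowerSeries.X →+* T}
    (hE : (p : T) ∣ h (algebraMap A _ E)) (hA : ∀ a, h (algebraMap A _ a) = h' (algebraMap A _ a))
    (hz : ∀ c, h (ComplEnv.z p φ _ _ c 0) = h' (ComplEnv.z p φ _ _ c 0)) : h = h' := by
  have hX : ∀ (j : ComplEnv p φ (algebraMap A (MvPowerSeries σ A) E) MvPowerSeries.X →+* T)
      (c : σ), j (algebraMap (MvPowerSeries σ A) _ (MvPowerSeries.X c)) =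
        j (algebraMap A _ E) * j (ComplEnv.z p φ _ _ c 0) := by
    intro j c
    have h1 : Ideal.Quotient.mk (deltaRel p φ (algebraMap A (MvPowerSeries σ A) E)
        MvPowerSeries.X) (rel p φ (algebraMap A (MvPowerSeries σ A) E)
        MvPowerSeries.X (c, 0)) = 0 := by
      rw [Ideal.Quotient.eq_zero_iff_mem]
      exact Ideal.subset_span ⟨(c, 0), rfl⟩
    rw [EnvHyp.rel_zero, map_sub, map_mul, sub_eq_zero] at h1
    have h2 := congrArg (fun x => j (algebraMap _ (ComplEnv p φ
      (algebraMap A (MvPowerSeries σ A) E) MvPowerSeries.X) x)) h1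
    simp only [map_mul] at h2
    exact h2.symm
  have hB : ∀ b, h (algebraMap (MvPowerSeries σ A) _ b) =
      h' (algebraMap (MvPowerSeries σ A) _ b) := by
    have := mvPowerSeries_hom_ext (Ideal.span {(p : T)})
      (h := h.comp (algebraMap (MvPowerSeries σ A) _))
      (h' := h'.comp (algebraMap (MvPowerSeries σ A) _)) hA
      (fun c => by
        rw [RingHom.comp_apply, RingHom.comp_apply, hX, hX, hA, hz])
      (fun c => by
        rw [RingHom.comp_apply, hX]
        exact Ideal.mul_mem_right _ _ (Ideal.mem_span_singleton.2 hE))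
    exact fun b => congrArg (fun f => f b) this
  refine EnvHyp.isCompletion_env.hom_ext (Ideal.span {(p : T)})
    (map_le_comap (h.comp (algebraMap _ _)) hE) (H.env.hom_ext hB hz fun n x hx => ?_)
  exact H.env.frob_mul_eq_zero htf (h.comp (algebraMap (MvPowerSeries σ A) _)) hE n x hx

theorem algHom_ext (H : SeriesHyp p φA E φ) (κ : σ → C)
    {ι ι' : ComplEnv p φ (algebraMap A (MvPowerSeries σ A) E) MvPowerSeries.X →ₐ[A] RingMax p C E}
    (hι : ∀ c, ι (ComplEnv.z p φ _ _ c 0) = RingMax.z p E (κ c))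
    (hι' : ∀ c, ι' (ComplEnv.z p φ _ _ c 0) = RingMax.z p E (κ c)) : ι = ι' := by
  obtain ⟨e, he⟩ := RingMax.exists_eDiv (p := p) (C := C) (E := E)
  have key : ι.toRingHom = ι'.toRingHom := H.hom_ext RingMax.natCast_torsionFree
    ⟨e, (ι.commutes E).trans he.symm⟩ (fun a => (ι.commutes a).trans (ι'.commutes a).symm)
    fun c => (hι c).trans (hι' c).symm
  exact AlgHom.ext fun x => congrArg (fun f => f x) key

end SeriesHyp

end PrismaticEnvelope

namespace PrismaticEnvelope

/-! ### The filtration of the completed envelope -/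

theorem PdPoly.exists_factorial_mul_eq {p : ℕ} {R C : Type*} [CommRing R] (hp : p.Prime)
    (hu : ∀ n : ℕ, p.Coprime n → IsUnit (n : R)) (c : C) (i : ℕ) :
    ∃ t : PdPoly p R C, (i.factorial : ℕ) * t = PdPoly.z p R c ^ i := by
  obtain ⟨t, ht⟩ := PdPoly.exists_val_eq (p := p) (S := R) (C := C)
    (Algebra.subset_adjoin ⟨(c, i), rfl⟩ : gam p R c i ∈ pdSubalgebra p R C)
  refine ⟨t, PdPoly.val_injective ?_⟩
  rw [map_mul, map_natCast, map_pow, PdPoly.val_z, ht]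
  exact factorial_mul_gam hp hu c i

instance ComplPdPoly.isAdicComplete {p : ℕ} {R C : Type*} [CommRing R] :
    IsAdicComplete (Ideal.span {(p : ComplPdPoly p R C)}) (ComplPdPoly p R C) := by
  have := (isCompletion_pdPoly (p := p) (R := R) (C' := C)).complete
  rwa [Ideal.map_span, Set.image_singleton, map_natCast] at this

theorem mem_filtration_iff {p : ℕ} {S T M : Type*} [CommRing S] [CommRing T] [CommRing M]
    [Algebra S T] [Algebra S M] {E : S} (htf : ∀ x : M, (p : M) * x = 0 → x = 0) {ι : T →ₐ[S] M}
    {x : T} {i : ℕ} : x ∈ filtration p E ι i ↔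
      ∃ (N : ℕ) (m : M), p ^ N * ι x = algebraMap S M E ^ i * m := by
  have hpow : ∀ N, IsUnit ((p : InvP p M) ^ N) := fun N =>
    (isUnit_natCast_self_invP p _).pow N
  have hmem : x ∈ filtration p E ι i ↔ algebraMap _ (InvP p M)
      (algebraMap S M E) ^ i ∣ algebraMap _ (InvP p M) (ι x) :=
    Ideal.mem_span_singleton
  rw [hmem]
  constructor
  · rintro ⟨t, ht⟩
    obtain ⟨N, m, hm⟩ := exists_natCast_pow_mul_eq t
    refine ⟨N, m, algebraMap_invP_injective htf ?_⟩
    simp only [map_mul, map_pow, map_natCast]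
    rw [ht, ← hm]
    ring
  · rintro ⟨N, m, h⟩
    obtain ⟨v, hv⟩ := (hpow N).exists_left_inv
    have h1 := congrArg (algebraMap _ (InvP p M)) h
    simp only [map_mul, map_pow, map_natCast] at h1
    exact ⟨v * algebraMap _ _ m, by linear_combination v * h1 -
      (algebraMap _ (InvP p M) (ι x)) * hv⟩

namespace SeriesHyp

variable {p : ℕ} {A σ C R : Type*} [Finite σ] [CommRing A] [CommRing R] {φA : A →+* A} {E : A}
  {φ : MvPowerSeries σ A →+* MvPowerSeries σ A} {q : A →+* R}

variable (H : SeriesHyp p φA E φ)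
  (G : ResidueHyp p φ φA (algebraMap A (MvPowerSeries σ A) E) MvPowerSeries.X
    MvPowerSeries.constantCoeff q) (κ : σ ≃ C)
  {ι : ComplEnv p φ (algebraMap A (MvPowerSeries σ A) E) MvPowerSeries.X →ₐ[A] RingMax p C E}
  (hι : ∀ c, ι (ComplEnv.z p φ _ _ c 0) = RingMax.z p E (κ c))
include H G hι

/-- An element of the completed envelope is divisible by `E` if its image in `A_max` becomes so
after inverting `p`. -/
theorem dvd_of_natCast_pow_mul_eq {x : ComplEnv p φ (algebraMap A (MvPowerSeries σ A) E)
      MvPowerSeries.X} {N : ℕ} {m : RingMax p C E} (h : p ^ N * ι x = algebraMap A _ E * m) :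
    ∃ x', x = algebraMap A _ E * x' := by
  have hp := H.env.prime
  obtain ⟨-, h', -, -, hker, hB, hz, -⟩ := G.exists_complEnvToPd H.env κ
  have hq : ∀ a, h' (algebraMap A _ a) = algebraMap R (ComplPdPoly p R C) (q a) := fun a =>
    (hB (MvPowerSeries.C a)).trans (by rw [MvPowerSeries.constantCoeff_C])
  have hqE' : algebraMap R (ComplPdPoly p R C) (q E) = 0 := by
    rw [← hq, hker]
    exact Ideal.mem_span_singleton_self _
  -- The map `ρ` sends `E/p` to `0`, which is consistent since `E` vanishes in `R`. Its composite
  -- with `ι` is the reduction modulo `E`.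
  obtain ⟨ρ, hρ, hρz⟩ := RingMax.exists_hom (C := C) (E := E) hp H.isUnit
    (ComplPdPoly.natCast_torsionFree (p := p) (R := R) (C' := C))
    ((algebraMap R (ComplPdPoly p R C)).comp q) (u := 0)
    (by rw [mul_zero, RingHom.comp_apply, hqE']) (w := fun c => ComplPdPoly.z p R c) (by
      intro c i
      obtain ⟨t, ht⟩ := PdPoly.exists_factorial_mul_eq hp G.isUnit c i
      refine ⟨algebraMap _ _ t, ?_⟩
      have := congrArg (algebraMap (PdPoly p R C) (ComplPdPoly p R C)) ht
      rw [map_mul, map_natCast, map_pow] at this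
      exact this.symm)
  have key : ρ.comp ι.toRingHom = h' := by
    have hA : ∀ a, ρ (ι (algebraMap A _ a)) = h' (algebraMap A _ a) := fun a => by
      rw [AlgHom.commutes, hρ, hq, RingHom.comp_apply]
    refine H.hom_ext ComplPdPoly.natCast_torsionFree ?_ hA fun c => ?_
    · exact ⟨0, (hA E).trans (by rw [hq, hqE', mul_zero])⟩
    · exact (congrArg ρ (hι c)).trans ((hρz _).trans (hz c).symm)
  have h1 : h' x = 0 := by
    have h2 := congrArg ρ h
    rw [map_mul, map_mul, map_pow, map_natCast, hρ, RingHom.comp_apply, hqE', zero_mul] at h2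
    have h3 : ρ (ι x) = h' x := congrArg (fun f => f x) key
    rw [h3] at h2
    clear h
    induction N with
    | zero => simpa using h2
    | succ N ih =>
      refine ih (ComplPdPoly.natCast_torsionFree _ ?_)
      rw [← h2]; ring
  exact Ideal.mem_span_singleton.1 ((hker x).1 h1)

/-- Induction on `i`: after `Eⁱ` is cancelled, `E` being regular in `A_max`, the quotient again
becomes divisible by `E` once `p` is inverted, so `dvd_of_natCast_pow_mul_eq` supplies one more
factor. -/
theorem filtration_eq (i : ℕ) : filtration p E ι i = Ideal.span {algebraMap A _ E ^ i} := by
  have hE : ∀ x : RingMax p C E, algebraMap A _ E * x = 0 → x = 0 :=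
    RingMax.mul_eq_zero H.env.prime H.isUnit H.torsionFree H.mul_eq_zero H.nzd_p
  have hEi : ∀ (i : ℕ) (x : RingMax p C E), algebraMap A _ E ^ i * x = 0 → x = 0 := by
    intro i
    induction i with
    | zero => intro x hx; simpa using hx
    | succ i ih => intro x hx; exact hE _ (ih _ (by rw [← hx]; ring))
  ext x
  rw [mem_filtration_iff RingMax.natCast_torsionFree, Ideal.mem_span_singleton]
  constructor
  · rintro ⟨N, m, h⟩
    induction i generalizing m with
    | zero => simp
    | succ i ih =>
      obtain ⟨x', rfl⟩ := ih (algebraMap A _ E * m) (by rw [h]; ring)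
      have h1 : p ^ N * ι x' = algebraMap A _ E * m := by
        refine sub_eq_zero.1 (hEi i _ ?_)
        rw [map_mul, map_pow, AlgHom.commutes] at h
        linear_combination h
      obtain ⟨x'', rfl⟩ := dvd_of_natCast_pow_mul_eq H G κ hι h1
      exact ⟨x'', by ring⟩
  · rintro ⟨x', rfl⟩
    exact ⟨0, ι x', by rw [map_mul, map_pow, AlgHom.commutes]; ring⟩

/-- The kernel lies in every step `(Eⁱ)` of the filtration, and these intersect in zero. -/
theorem algHom_injective : Function.Injective ι := by
  have := (EnvHyp.isCompletion_env (p := p) (φ := φ) (E := algebraMap A (MvPowerSeries σ A) E)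
    (y := MvPowerSeries.X)).complete
  rw [EnvHyp.map_envIdeal] at this
  rw [injective_iff_map_eq_zero]
  intro x hx
  refine IsAdicComplete.eq_zero_of_forall_mem (Ideal.span {(p : ComplEnv p φ
    (algebraMap A (MvPowerSeries σ A) E) MvPowerSeries.X), algebraMap (MvPowerSeries σ A) _
    (algebraMap A (MvPowerSeries σ A) E)}) fun n => ?_
  have h1 : x ∈ filtration p E ι n :=
    (mem_filtration_iff RingMax.natCast_torsionFree).2 ⟨0, 0, by rw [hx]; ring⟩
  rw [filtration_eq H G κ hι] at h1
  obtain ⟨x', rfl⟩ := Ideal.mem_span_singleton.1 h1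
  exact Ideal.mul_mem_right _ _ (Ideal.pow_mem_pow (Ideal.subset_span (Set.mem_insert_of_mem _
    (Set.mem_singleton _))) _)

end SeriesHyp

end PrismaticEnvelope

namespace PrismaticEnvelope

/-! ### Flatness of complete modules -/

section Flat

variable {A : Type*} [CommRing A]

theorem mem_smul_top_pi_iff {l : ℕ} (I : Ideal A) (v : Fin l → A) :
    v ∈ I • (⊤ : Submodule A (Fin l → A)) ↔ ∀ i, v i ∈ I := by
  constructor
  · intro h i
    have h1 := Submodule.mem_map_of_mem (f := LinearMap.proj i) h
    rw [Submodule.map_smul''] at h1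
    have h2 := Submodule.smul_mono le_rfl (le_top (a := Submodule.map (LinearMap.proj i) ⊤)) h1
    rwa [smul_eq_mul, Ideal.mul_top] at h2
  · intro h
    rw [pi_eq_sum_univ v]
    exact sum_mem fun i _ => Submodule.smul_mem_smul (h i) trivial

/-- The Artin–Rees lemma for a homomorphism out of a finite free module. -/
theorem exists_preimage_mem_pow [IsNoetherianRing A] (I : Ideal A) {s : ℕ} {P : Type*}
    [AddCommGroup P] [Module A P] [Module.Finite A P] (g : (Fin s → A) →ₗ[A] P) :
    ∃ c : ℕ, ∀ n, ∀ v ∈ I ^ n • (⊤ : Submodule A P), v ∈ LinearMap.range g →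
      ∃ d, (∀ j, d j ∈ I ^ (n - c)) ∧ g d = v := by
  obtain ⟨c, hc⟩ := I.exists_pow_inf_eq_pow_smul (LinearMap.range g)
  refine ⟨c, fun n v hv hvg => ?_⟩
  have h1 : v ∈ I ^ (n - c) • LinearMap.range g := by
    rcases le_or_gt c n with hn | hn
    · have h2 : v ∈ I ^ n • ⊤ ⊓ LinearMap.range g := ⟨hv, hvg⟩
      rw [hc n hn] at h2
      exact Submodule.smul_mono le_rfl inf_le_right h2
    · rw [Nat.sub_eq_zero_of_le hn.le, pow_zero, Ideal.one_eq_top, Submodule.top_smul]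
      exact hvg
  rw [LinearMap.range_eq_map, ← Submodule.map_smul''] at h1
  obtain ⟨d, hd, rfl⟩ := h1
  exact ⟨d, (mem_smul_top_pi_iff _ d).1 hd, rfl⟩

variable {N : Type*} [CommRing N] [Algebra A N]

theorem smul_mem_pow {I : Ideal A} {J : Ideal N} (hIJ : I ≤ J.comap (algebraMap A N)) {n : ℕ}
    {a : A} (ha : a ∈ I ^ n) (y : N) : a • y ∈ J ^ n := by
  rw [Algebra.smul_def]
  refine Ideal.mul_mem_right _ _ ?_
  have := Ideal.mem_map_of_mem (algebraMap A N) ha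
  rw [Ideal.map_pow] at this
  exact Ideal.pow_right_mono (Ideal.map_le_iff_le_comap.2 hIJ) n this

/-- One step of the successive approximation. Expanding the `z_i` along `x`, the coefficients at
each index form an approximate syzygy of `f`. Artin–Rees for `f` corrects it to an exact one, and
Artin–Rees for `g` lifts that with a loss `c` independent of `n`. -/
theorem exists_approx_relation [IsNoetherianRing A] {I : Ideal A} {J : Ideal N}
    (hIJ : I ≤ J.comap (algebraMap A N)) {Λ : Type*} {x : Λ → N}
    (hx : ∀ n y, ∃ a : Λ →₀ A, y - Finsupp.linearCombination A x a ∈ J ^ n)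
    (hx' : ∀ n (a : Λ →₀ A), Finsupp.linearCombination A x a ∈ J ^ n → ∀ i, a i ∈ I ^ n)
    {l s : ℕ} (f : (Fin l → A) →ₗ[A] A) (g : (Fin s → A) →ₗ[A] (Fin l → A))
    (hfg : LinearMap.ker f = LinearMap.range g) :
    ∃ c : ℕ, ∀ n, ∀ z : Fin l → N, (∀ i, z i ∈ J ^ n) → ∑ i, f (Pi.single i 1) • z i = 0 →
      ∃ y : Fin s → N, (∀ j, y j ∈ J ^ (n - c)) ∧
        ∀ i, z i - ∑ j, g (Pi.single j 1) i • y j ∈ J ^ (n + 1) := by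
  classical
  obtain ⟨c₁, hc₁⟩ := exists_preimage_mem_pow I f
  obtain ⟨c₂, hc₂⟩ := exists_preimage_mem_pow I g
  refine ⟨c₂, fun n z hz hfz => ?_⟩
  -- The extra precision `c₁` is what Artin–Rees for `f` costs; an error of order `n + 1` is left.
  choose a ha using fun i => hx (n + 1 + c₁) (z i)
  have ha' : ∀ i k, a i k ∈ I ^ n := fun i => hx' n (a i) (by
    rw [← sub_sub_cancel (z i) (Finsupp.linearCombination A x (a i))]
    exact sub_mem (hz i) (Ideal.pow_le_pow_right (by omega) (ha i)))
  have hf : ∀ v : Fin l → A, f v = ∑ i, v i * f (Pi.single i 1) := fun v => by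
    conv_lhs => rw [pi_eq_sum_univ' v, map_sum]
    simp only [map_smul, smul_eq_mul]
  have hg : ∀ v : Fin s → A, ∀ i, g v i = ∑ j, v j * g (Pi.single j 1) i := fun v i => by
    conv_lhs => rw [pi_eq_sum_univ' v, map_sum, Finset.sum_apply]
    simp only [map_smul, Pi.smul_apply, smul_eq_mul]
  have hfa : ∀ k, f (fun i => a i k) ∈ I ^ (n + 1 + c₁) := by
    have h1 := hx' (n + 1 + c₁) (∑ i, f (Pi.single i 1) • a i) (by
      rw [map_sum, ← sub_zero (∑ _, _), ← hfz, ← Finset.sum_sub_distrib]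
      refine sum_mem fun i _ => ?_
      rw [map_smul, ← smul_sub, Algebra.smul_def, ← neg_sub]
      exact Ideal.mul_mem_left _ _ (neg_mem (ha i)))
    intro k
    have h2 := h1 k
    rw [Finsupp.finsetSum_apply] at h2
    rw [hf]
    simpa [mul_comm] using h2
  choose b hb hfb using fun k => hc₁ (n + 1 + c₁) _
    (by rw [smul_eq_mul, Ideal.mul_top]; exact hfa k) (LinearMap.mem_range_self f _)
  rw [Nat.add_sub_cancel] at hb
  choose d hd hgd using fun k => hc₂ n ((fun i => a i k) - b k)
    ((mem_smul_top_pi_iff _ _).2 fun i => sub_mem (ha' i k)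
      (Ideal.pow_le_pow_right n.le_succ (hb k i)))
    (by rw [← hfg, LinearMap.mem_ker, map_sub, hfb, sub_self])
  set S : Finset Λ := Finset.univ.biUnion fun i => (a i).support
  refine ⟨fun j => ∑ k ∈ S, d k j • x k, fun j => sum_mem fun k _ => smul_mem_pow hIJ (hd k j) _,
    fun i => ?_⟩
  have h1 : Finsupp.linearCombination A x (a i) = ∑ k ∈ S, a i k • x k := by
    rw [Finsupp.linearCombination_apply]
    exact Finsupp.sum_of_support_subset _
      (Finset.subset_biUnion_of_mem (fun i => (a i).support) (Finset.mem_univ i)) _ (by simp)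
  have h2 : ∑ j, g (Pi.single j 1) i • ∑ k ∈ S, d k j • x k = ∑ k ∈ S, (a i k - b k i) • x k := by
    simp only [Finset.smul_sum, smul_smul]
    rw [Finset.sum_comm]
    refine Finset.sum_congr rfl fun k _ => ?_
    have h3 := congrFun (hgd k) i
    rw [hg] at h3
    rw [← Finset.sum_smul]
    congr 1
    rw [Pi.sub_apply] at h3
    rw [← h3]
    exact Finset.sum_congr rfl fun j _ => mul_comm _ _
  have h4 : z i - ∑ j, g (Pi.single j 1) i • ∑ k ∈ S, d k j • x k =
      (z i - Finsupp.linearCombination A x (a i)) + ∑ k ∈ S, b k i • x k := by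
    rw [h1, h2]
    simp only [sub_smul, Finset.sum_sub_distrib]
    ring
  rw [h4]
  exact add_mem (Ideal.pow_le_pow_right (by omega) (ha i))
    (sum_mem fun k _ => smul_mem_pow hIJ (hb k i) _)

/-- A complete module over a noetherian ring is flat if its reductions modulo the powers of an
ideal `I` have a common basis. -/
theorem flat_of_forall_linearCombination [IsNoetherianRing A] {I : Ideal A} (J : Ideal N)
    [IsAdicComplete J N] (hIJ : I ≤ J.comap (algebraMap A N)) {Λ : Type*} (x : Λ → N)
    (hx : ∀ n y, ∃ a : Λ →₀ A, y - Finsupp.linearCombination A x a ∈ J ^ n)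
    (hx' : ∀ n (a : Λ →₀ A), Finsupp.linearCombination A x a ∈ J ^ n → ∀ i, a i ∈ I ^ n) :
    Module.Flat A N := by
  refine Module.Flat.of_forall_isTrivialRelation fun {l f z} hfz => ?_
  set F : (Fin l → A) →ₗ[A] A := Fintype.linearCombination A f with hF
  have hFs : ∀ i, F (Pi.single i 1) = f i := fun i => by
    simp [hF, Fintype.linearCombination_apply_single]
  obtain ⟨s, v, hv⟩ := Submodule.fg_iff_exists_fin_generating_family.1
    (IsNoetherian.noetherian (LinearMap.ker F))
  set G : (Fin s → A) →ₗ[A] (Fin l → A) := Fintype.linearCombination A v with hG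
  have hFG : LinearMap.ker F = LinearMap.range G := by
    rw [← hv, Fintype.range_linearCombination]
  obtain ⟨c, hc⟩ := exists_approx_relation hIJ hx hx' F G hFG
  have hGk : ∀ j, ∑ i, f i * G (Pi.single j 1) i = 0 := by
    intro j
    have h1 : G (Pi.single j 1) ∈ LinearMap.ker F := hFG ▸ LinearMap.mem_range_self G _
    rw [LinearMap.mem_ker, hF, Fintype.linearCombination_apply] at h1
    rw [← h1]
    exact Finset.sum_congr rfl fun i _ => by rw [smul_eq_mul, mul_comm]
  have hrel : ∀ y : Fin s → N,
      ∑ i, F (Pi.single i 1) • (z i - ∑ j, G (Pi.single j 1) i • y j) = 0 := by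
    intro y
    simp only [hFs, smul_sub, Finset.sum_sub_distrib, hfz, zero_sub, neg_eq_zero, Finset.smul_sum,
      smul_smul]
    rw [Finset.sum_comm]
    refine Finset.sum_eq_zero fun j _ => ?_
    rw [← Finset.sum_smul, hGk, zero_smul]
  -- The hypothesis on `y` stands inside the existential, so that choosing gives a total function
  -- that can be iterated.
  have hstep : ∀ n (y : Fin s → N), ∃ y' : Fin s → N,
      (∀ i, z i - ∑ j, G (Pi.single j 1) i • y j ∈ J ^ n) →
      (∀ i, z i - ∑ j, G (Pi.single j 1) i • y' j ∈ J ^ (n + 1)) ∧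
        ∀ j, y' j - y j ∈ J ^ (n - c) := by
    intro n y
    by_cases h : ∀ i, z i - ∑ j, G (Pi.single j 1) i • y j ∈ J ^ n
    · obtain ⟨w, hw, hw'⟩ := hc n _ h (hrel y)
      refine ⟨fun j => y j + w j, fun _ => ⟨fun i => ?_, fun j => ?_⟩⟩
      · have := hw' i
        rw [sub_sub, ← Finset.sum_add_distrib] at this
        simpa only [smul_add] using this
      · rw [add_sub_cancel_left]
        exact hw j
    · exact ⟨y, fun h' => absurd h' h⟩
  choose step hstep using hstep
  let W : ℕ → Fin s → N := fun n => Nat.rec 0 (fun n w => step n w) n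
  have hW : ∀ n i, z i - ∑ j, G (Pi.single j 1) i • W n j ∈ J ^ n := by
    intro n
    induction n with
    | zero => simp
    | succ n ih => exact (hstep n (W n) ih).1
  have hW' : ∀ n j, W (n + 1) j - W n j ∈ J ^ (n - c) := fun n => (hstep n (W n) (hW n)).2
  -- The increments lie in `J ^ (n - c)`, so shifting by `c` gives a Cauchy sequence at full rate.
  choose Y hY using fun j => IsAdicComplete.exists_limit J (fun n => W (n + c) j) fun n => by
    have := hW' (n + c) j
    rwa [Nat.add_sub_cancel, Nat.add_right_comm] at this
  refine ⟨s, fun i j => G (Pi.single j 1) i, Y, fun i => ?_, hGk⟩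
  refine sub_eq_zero.1 (IsAdicComplete.eq_zero_of_forall_mem J fun n => ?_)
  have h1 : z i - ∑ j, G (Pi.single j 1) i • Y j =
      (z i - ∑ j, G (Pi.single j 1) i • W (n + c) j) -
        ∑ j, G (Pi.single j 1) i • (Y j - W (n + c) j) := by
    simp only [smul_sub, Finset.sum_sub_distrib]
    ring
  rw [h1]
  refine sub_mem (Ideal.pow_le_pow_right (Nat.le_add_right n c) (hW (n + c) i))
    (sum_mem fun j _ => ?_)
  rw [Algebra.smul_def]
  exact Ideal.mul_mem_left _ _ (hY j n)

end Flat

end PrismaticEnvelope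

namespace PrismaticEnvelope

/-! ### Flatness of the completed envelope -/

section Basis

open MvPolynomial

/-- The divided power polynomial ring is free on the divided power monomials. -/
theorem PdPoly.exists_basis {p : ℕ} {R C : Type*} [CommRing R] (hp : p.Prime)
    (hu : ∀ n : ℕ, p.Coprime n → IsUnit (n : R)) (htf : ∀ x : R, (p : R) * x = 0 → x = 0) :
    Nonempty (Module.Basis (C →₀ ℕ) R (PdPoly p R C)) := by
  classical
  have hfac : ∀ e : C →₀ ℕ, (fac e : InvP p R) * Ring.inverse (fac e : InvP p R) = 1 := fun e =>
    natCast_mul_inverse_factorial hp hu (fac_ne_zero e)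
  have hγ : ∀ e : C →₀ ℕ, monomial e (Ring.inverse (fac e : InvP p R)) ∈ pdSubalgebra p R C := by
    intro e
    rw [pdSubalgebra_eq_pdOver hp hu]
    intro e'
    rw [coeff_monomial]
    split_ifs with h
    · rw [← h, hfac]
      exact one_mem _
    · rw [mul_zero]
      exact zero_mem _
  choose γ hγ using fun e => PdPoly.exists_val_eq (hγ e)
  have hsum : ∀ r : (C →₀ ℕ) →₀ R, ∀ e, (fac e : InvP p R) *
      coeff e (PdPoly.val p R C (Finsupp.linearCombination R γ r)) = algebraMap R _ (r e) := by
    intro r e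
    rw [Finsupp.linearCombination_apply, Finsupp.sum, map_sum, coeff_sum]
    simp only [map_smul, hγ, coeff_smul, coeff_monomial]
    rw [Finset.sum_eq_single e]
    · rw [if_pos rfl, Algebra.smul_def, mul_left_comm, hfac, mul_one]
    · intro e' _ he'
      rw [if_neg he', smul_zero]
    · intro he
      rw [Finsupp.notMem_support_iff.1 he, zero_smul]
  refine ⟨Module.Basis.mk (v := γ) ?_ ?_⟩
  · rw [linearIndependent_iff]
    intro r hr
    ext e
    apply algebraMap_invP_injective htf
    rw [← hsum, hr, map_zero, coeff_zero, mul_zero, Finsupp.zero_apply, map_zero]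
  · intro t _
    have ht := PdPoly.val_mem t
    rw [pdSubalgebra_eq_pdOver hp hu] at ht
    choose r hr using fun e => Algebra.mem_bot.1 (ht e)
    rw [← Finsupp.range_linearCombination]
    refine ⟨Finsupp.onFinset (PdPoly.val p R C t).support r fun e he => ?_,
      PdPoly.val_injective ?_⟩
    · rw [mem_support_iff]
      intro h0
      apply he
      apply algebraMap_invP_injective htf
      rw [hr, h0, mul_zero, map_zero]
    · ext e
      refine (isUnit_natCast_invP hp hu (fac_ne_zero e)).mul_left_cancel ?_
      rw [hsum, Finsupp.onFinset_apply, hr]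

end Basis

/-- The flatness of a complete algebra `N` over a noetherian ring `A`, for which `N / E` is the
completed divided power polynomial ring over `A / E`. -/
theorem flat_of_complPdPoly {p : ℕ} {A N R C : Type*} [CommRing A] [CommRing N] [CommRing R]
    [Algebra A N] [IsNoetherianRing A] (hp : p.Prime) {E : A} {q : A →+* R}
    (hu : ∀ n : ℕ, p.Coprime n → IsUnit (n : R)) (htf : ∀ x : R, (p : R) * x = 0 → x = 0)
    (hq : Function.Surjective q) (hqE : ∀ a, q a = 0 → a ∈ Ideal.span {E})
    [IsAdicComplete (Ideal.span {(p : N), algebraMap A N E}) N]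
    (hE : ∀ x : N, algebraMap A N E * x = 0 → x = 0)
    (hpE : NZDMod (Ideal.span {algebraMap A N E}) (p : N)) {h : N →+* ComplPdPoly p R C}
    (hs : Function.Surjective h) (hker : ∀ x, h x = 0 ↔ x ∈ Ideal.span {algebraMap A N E})
    (hh : ∀ a, h (algebraMap A N a) = algebraMap R _ (q a)) : Module.Flat A N := by
  obtain ⟨b⟩ := PdPoly.exists_basis (C := C) hp hu htf
  choose x hx using fun e => hs (algebraMap (PdPoly p R C) _ (b e))
  have hL : ∀ a : (C →₀ ℕ) →₀ A, h (Finsupp.linearCombination A x a) =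
      algebraMap (PdPoly p R C) _
        (Finsupp.linearCombination R b (a.mapRange q (map_zero q))) := by
    intro a
    rw [Finsupp.linearCombination_apply, Finsupp.linearCombination_apply,
      Finsupp.sum_mapRange_index (by simp), Finsupp.sum, Finsupp.sum, map_sum, map_sum]
    refine Finset.sum_congr rfl fun e _ => ?_
    rw [Algebra.smul_def, Algebra.smul_def, map_mul, map_mul, hh, hx]
    rfl
  have hmapp : (Ideal.span {(p : PdPoly p R C)}).map (algebraMap _ (ComplPdPoly p R C)) =
      Ideal.span {(p : ComplPdPoly p R C)} := by
    rw [Ideal.map_span, Set.image_singleton, map_natCast]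
  set J := Ideal.span {(p : N), algebraMap A N E} with hJ
  have hpJ : (p : N) ∈ J := Ideal.subset_span (by simp)
  have hEJ : algebraMap A N E ∈ J := Ideal.subset_span (by simp)
  have hspanJ : Ideal.span {algebraMap A N E} ≤ J := by
    rwa [Ideal.span_singleton_le_iff_mem]
  have hJmap : J = (Ideal.span {(p : A), E}).map (algebraMap A N) := by
    rw [Ideal.map_span, Set.image_pair, map_natCast]
  have hJh : J.map h ≤ Ideal.span {(p : ComplPdPoly p R C)} := by
    rw [hJ, Ideal.map_span, Set.image_pair, map_natCast,
      (hker _).2 (Ideal.mem_span_singleton_self _), Ideal.span_pair_comm, Ideal.span_insert_zero]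
  refine flat_of_forall_linearCombination (I := Ideal.span {(p : A), E}) J ?_ x ?_ ?_
  · rw [← Ideal.map_le_iff_le_comap, hJmap]
  · have h1 : ∀ y, ∃ a, y - Finsupp.linearCombination A x a ∈ J := by
      intro y
      obtain ⟨t, ht⟩ := isCompletion_pdPoly.dense (h y) 1
      rw [hmapp, pow_one] at ht
      obtain ⟨d, hd⟩ := Ideal.mem_span_singleton.1 ht
      obtain ⟨w, rfl⟩ := hs d
      obtain ⟨a, ha⟩ := Finsupp.mapRange_surjective q (map_zero q) hq (b.repr t)
      refine ⟨a, ?_⟩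
      have h2 : y - Finsupp.linearCombination A x a - p * w ∈ Ideal.span {algebraMap A N E} := by
        rw [← hker, map_sub, map_sub, hL, ha, b.linearCombination_repr, map_mul, map_natCast, hd,
          sub_self]
      rw [← sub_add_cancel (y - Finsupp.linearCombination A x a) (p * w)]
      exact add_mem (hspanJ h2) (Ideal.mul_mem_right _ _ hpJ)
    have h2 : ∀ n, ∀ y ∈ J ^ n, ∃ a, y - Finsupp.linearCombination A x a ∈ J ^ (n + 1) := by
      intro n y hy
      rw [hJmap, ← Ideal.map_pow] at hy
      -- The ideal `Jⁿ` is generated by elements of `A`, over which combinations of `x` are linear.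
      -- The arbitrary multiplier `w` absorbs the coefficients from `N` in the induction over the
      -- span.
      suffices ∀ w, ∃ a, w * y - Finsupp.linearCombination A x a ∈ J ^ (n + 1) by
        simpa using this 1
      induction hy using Submodule.span_induction with
      | mem y hy =>
        obtain ⟨i, hi, rfl⟩ := hy
        intro w
        obtain ⟨a, ha⟩ := h1 w
        refine ⟨i • a, ?_⟩
        rw [map_smul, Algebra.smul_def, mul_comm w, ← mul_sub, pow_succ]
        refine Ideal.mul_mem_mul ?_ ha
        rw [hJmap, ← Ideal.map_pow]
        exact Ideal.mem_map_of_mem _ hi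
      | zero => exact fun w => ⟨0, by simp⟩
      | add y z _ _ hy hz =>
        intro w
        obtain ⟨a, ha⟩ := hy w
        obtain ⟨a', ha'⟩ := hz w
        refine ⟨a + a', ?_⟩
        rw [map_add, mul_add, add_sub_add_comm]
        exact add_mem ha ha'
      | smul r y _ hy =>
        intro w
        obtain ⟨a, ha⟩ := hy (w * r)
        exact ⟨a, by rwa [smul_eq_mul, ← mul_assoc]⟩
    intro n y
    induction n with
    | zero => exact ⟨0, by simp⟩
    | succ n ih =>
      obtain ⟨a, ha⟩ := ih
      obtain ⟨a', ha'⟩ := h2 n _ ha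
      exact ⟨a + a', by rwa [map_add, ← sub_sub]⟩
  · intro n
    induction n with
    | zero => intro a _ i; simp
    | succ n ih =>
      intro a ha
      have h1 := Ideal.mem_map_of_mem h ha
      rw [Ideal.map_pow, hL] at h1
      have h2 := Ideal.pow_right_mono hJh (n + 1) h1
      rw [← hmapp] at h2
      have h3 := isCompletion_pdPoly.mem_of_map_mem _ _ h2
      rw [Ideal.span_singleton_pow] at h3
      obtain ⟨t, ht⟩ := Ideal.mem_span_singleton.1 h3
      obtain ⟨c, hc⟩ := Finsupp.mapRange_surjective q (map_zero q) hq (b.repr t)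
      -- Comparing coordinates in the divided power basis gives `a = p^(n+1) c + E a'`. Then `E ∑ a'
      -- x` lies in `J^(n+1)`, so `∑ a' x` lies in `Jⁿ`, and the induction applies to `a'`.
      have h4 : ∀ e, q (a e) = p ^ (n + 1) * q (c e) := by
        intro e
        have h5 := congrArg (fun t => b.repr t e) ht
        have h6 : (p : PdPoly p R C) ^ (n + 1) * t = ((p : R) ^ (n + 1)) • t := by
          rw [Algebra.smul_def, map_pow, map_natCast]
        simp only [h6, map_smul, Module.Basis.repr_linearCombination] at h5
        rw [← hc] at h5
        simpa using h5
      have h5 : ∀ e, ∃ d, a e - p ^ (n + 1) * c e = E * d := by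
        intro e
        refine Ideal.mem_span_singleton.1 (hqE _ ?_)
        rw [map_sub, map_mul, map_pow, map_natCast, h4, sub_self]
      choose d hd using h5
      classical
      -- Off the two supports the chosen `d e` is only known to satisfy `E d = 0`; it is replaced by
      -- `0` to keep the support finite.
      let a' : (C →₀ ℕ) →₀ A := Finsupp.onFinset (a.support ∪ c.support)
        (fun e => if e ∈ a.support ∪ c.support then d e else 0) fun e he => by
          by_contra h
          exact he (if_neg h)
      have ha' : ∀ e, a e = p ^ (n + 1) * c e + E * a' e := by
        intro e
        by_cases he : e ∈ a.support ∪ c.support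
        · have : a' e = d e := if_pos he
          rw [this, ← hd]
          ring
        · have : a' e = 0 := if_neg he
          rw [Finset.mem_union, not_or, Finsupp.notMem_support_iff, Finsupp.notMem_support_iff] at he
          rw [this, he.1, he.2]
          simp
      have ha'' : a = ((p : A) ^ (n + 1)) • c + E • a' := by
        ext e
        rw [ha', Finsupp.add_apply, Finsupp.smul_apply, Finsupp.smul_apply, smul_eq_mul,
          smul_eq_mul]
      have h6 : algebraMap A N E * Finsupp.linearCombination A x a' ∈ J ^ (n + 1) := by
        have h7 : algebraMap A N E * Finsupp.linearCombination A x a' =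
            Finsupp.linearCombination A x a -
              p ^ (n + 1) * Finsupp.linearCombination A x c := by
          conv_rhs => rw [ha'']
          rw [map_add, map_smul, map_smul, Algebra.smul_def, Algebra.smul_def, map_pow,
            map_natCast]
          ring
        rw [h7]
        exact sub_mem ha (Ideal.mul_mem_right _ _ (Ideal.pow_mem_pow hpJ _))
      have h7 := ih a' (mem_pow_of_mul_mem_pow_succ hE hpE n _ h6)
      intro e
      rw [ha', pow_succ']
      refine add_mem (Ideal.mul_mem_right _ _ ?_) (Ideal.mul_mem_mul
        (Ideal.subset_span (by simp)) (h7 e))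
      rw [pow_succ']
      exact Ideal.mul_mem_mul (Ideal.subset_span (by simp))
        (Ideal.pow_mem_pow (Ideal.subset_span (by simp)) _)

theorem flat_complEnv {p : ℕ} {A σ R : Type*} [CommRing A] [IsNoetherianRing A] [CommRing R]
    {φA : A →+* A} {E : A} {φ : MvPowerSeries σ A →+* MvPowerSeries σ A} {q : A →+* R}
    (H : EnvHyp p φ (algebraMap A (MvPowerSeries σ A) E) MvPowerSeries.X)
    (G : ResidueHyp p φ φA (algebraMap A (MvPowerSeries σ A) E) MvPowerSeries.X
      MvPowerSeries.constantCoeff q) (hq : ∀ a, q a = 0 → a ∈ Ideal.span {E}) :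
    Module.Flat A (ComplEnv p φ (algebraMap A (MvPowerSeries σ A) E) MvPowerSeries.X) := by
  obtain ⟨-, h, -, hs, hker, hB, -⟩ := G.exists_complEnvToPd H (Equiv.refl _)
  have h1 := (EnvHyp.isCompletion_env (p := p) (φ := φ) (E := algebraMap A (MvPowerSeries σ A) E)
    (y := MvPowerSeries.X)).complete
  rw [EnvHyp.map_envIdeal] at h1
  have hE : algebraMap (MvPowerSeries σ A) (ComplEnv p φ (algebraMap A (MvPowerSeries σ A) E)
    MvPowerSeries.X) (algebraMap A (MvPowerSeries σ A) E) = algebraMap A _ E := rfl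
  have hE0 := H.compl_mul_eq_zero
  have hpE := G.compl_nzdMod_p H
  rw [hE] at h1 hE0 hpE
  simp only [hE] at hker
  exact flat_of_complPdPoly H.prime G.isUnit G.torsionFree G.surjective hq hE0 hpE hs hker
    fun a => (hB (MvPowerSeries.C a)).trans (by rw [MvPowerSeries.constantCoeff_C])

end PrismaticEnvelope

open scoped TensorProduct

namespace PrismaticEnvelope

/-! ### Reduction modulo `E` and the embedding into `A_max` -/

theorem exists_quotient_equiv {S T : Type*} [CommRing S] [CommRing T] {I : Ideal S} {g : S →+* T}
    (hs : Function.Surjective g) (hg : ∀ x, g x = 0 ↔ x ∈ I) :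
    ∃ e : (S ⧸ I) ≃+* T, ∀ x, e (Ideal.Quotient.mk I x) = g x := by
  have hI : I = RingHom.ker g := by
    ext x
    rw [RingHom.mem_ker, hg]
  exact ⟨(Ideal.quotEquivOfEq hI).trans (RingHom.quotientKerEquivOfSurjective hs), fun x => rfl⟩

section

variable {p : ℕ} {A σ C R : Type*} [CommRing A] [CommRing R] {φA : A →+* A} {E : A}
  {φ : MvPowerSeries σ A →+* MvPowerSeries σ A} {q : A →+* R}

theorem ResidueHyp.exists_equiv
    (G : ResidueHyp p φ φA (algebraMap A (MvPowerSeries σ A) E) MvPowerSeries.X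
      MvPowerSeries.constantCoeff q)
    (H : EnvHyp p φ (algebraMap A (MvPowerSeries σ A) E) MvPowerSeries.X) (κ : σ ≃ C) :
    (∃ e : (DeltaEnv p φ (algebraMap A (MvPowerSeries σ A) E) MvPowerSeries.X ⧸
        Ideal.span {algebraMap A (DeltaEnv p φ (algebraMap A (MvPowerSeries σ A) E)
          MvPowerSeries.X) E}) ≃+* PdPoly p R C,
      (∀ a : A, e (Ideal.Quotient.mk _ (algebraMap A _ a)) = algebraMap R _ (q a)) ∧
      ∀ c, e (Ideal.Quotient.mk _ (DeltaEnv.z p φ _ _ c 0)) = PdPoly.z p R (κ c)) ∧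
    ∃ e : (ComplEnv p φ (algebraMap A (MvPowerSeries σ A) E) MvPowerSeries.X ⧸
        Ideal.span {algebraMap A (ComplEnv p φ (algebraMap A (MvPowerSeries σ A) E)
          MvPowerSeries.X) E}) ≃+* ComplPdPoly p R C,
      (∀ a : A, e (Ideal.Quotient.mk _ (algebraMap A _ a)) = algebraMap R _ (q a)) ∧
      ∀ c, e (Ideal.Quotient.mk _ (ComplEnv.z p φ _ _ c 0)) = ComplPdPoly.z p R (κ c) := by
  obtain ⟨g, h, ⟨hgs, hgker, hgB, hgz⟩, hhs, hhker, hhB, hhz, -⟩ := G.exists_complEnvToPd H κ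
  obtain ⟨e, he⟩ := exists_quotient_equiv hgs hgker
  obtain ⟨e', he'⟩ := exists_quotient_equiv hhs hhker
  exact ⟨⟨e, fun a => (he _).trans ((hgB (MvPowerSeries.C a)).trans
      (by rw [MvPowerSeries.constantCoeff_C])), fun c => (he _).trans (hgz c)⟩,
    ⟨e', fun a => (he' _).trans ((hhB (MvPowerSeries.C a)).trans
      (by rw [MvPowerSeries.constantCoeff_C])), fun c => (he' _).trans (hhz c)⟩⟩

theorem SeriesHyp.exists_embedding [Finite σ] (H : SeriesHyp p φA E φ)
    (G : ResidueHyp p φ φA (algebraMap A (MvPowerSeries σ A) E) MvPowerSeries.X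
      MvPowerSeries.constantCoeff q) (κ : σ ≃ C) :
    ∃ ι : ComplEnv p φ (algebraMap A (MvPowerSeries σ A) E) MvPowerSeries.X →ₐ[A] RingMax p C E,
      (∀ c, ι (ComplEnv.z p φ _ _ c 0) = RingMax.z p E (κ c)) ∧
      (∀ ι' : ComplEnv p φ (algebraMap A (MvPowerSeries σ A) E) MvPowerSeries.X →ₐ[A]
        RingMax p C E, (∀ c, ι' (ComplEnv.z p φ _ _ c 0) = RingMax.z p E (κ c)) → ι' = ι) ∧
      Function.Injective ι ∧
      ∀ i : ℕ, filtration p E ι i = Ideal.span {algebraMap A _ E ^ i} := by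
  obtain ⟨ι, hι⟩ := H.exists_algHom κ
  exact ⟨ι, hι, fun ι' hι' => H.algHom_ext κ hι' hι, H.algHom_injective G κ hι,
    H.filtration_eq G κ hι⟩

end

/-! ### The self-products of `R₀⟦u⟧` -/

section

variable {p : ℕ} [Fact p.Prime] {k : Type*} [Field k] [CharP k p] [PerfectRing k p]
  {R₀ : Type*} [CommRing R₀] [IsDomain R₀] [Algebra (WittVector p k) R₀]
  [IsAdicComplete (Ideal.span {(p : R₀)}) R₀] {φ : R₀ →+* R₀} {m : ℕ}
  {f : Tate p k m →ₐ[WittVector p k] R₀} {φt : Tate p k m →+* Tate p k m}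
  {E : Polynomial (WittVector p k)} {r : ℕ} {R : Type*} [CommRing R] {q : PowerSeries R₀ →+* R}

theorem seriesHyp_aProd (htf : ∀ x : R₀, (p : R₀) * x = 0 → x = 0)
    (hφ : IsFrobeniusLift p φ) (hφt : IsFrobeniusLift p φt) (hEmonic : E.Monic)
    (hEeis : E.IsEisensteinAt (Ideal.span {(p : WittVector p k)})) (hdeg : 0 < E.natDegree)
    (hq : ∀ x, q x = 0 ↔ x ∈ Ideal.span {eisA p R₀ E})
    (hR : ∀ x : R, (p : R) * x = 0 → x = 0) :
    SeriesHyp p (frobA p φ) (eisA p R₀ E) (frobProd (r := r) p f φ φt) where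
  env := envHyp_aProd htf hφ hφt hEmonic hEeis hdeg hq hR
  torsionFree := mvPowerSeries_natCast_torsionFree htf
  isUnit := fun n hn => isUnit_natCast_of_coprime p hn
  mul_eq_zero := eisA_mul_eq_zero hEmonic
  nzd_p := fun x hx => by
    rw [← hq] at hx ⊢
    rw [map_mul, map_natCast] at hx
    exact hR _ hx
  distinguished := exists_frobA_eisA htf hφ hEeis hdeg
  frob_C := frobProd_C
  frob_X := fun c => by
    rw [frobProd_X]
    exact natCast_dvd_frobVar_sub hφt c
  constantCoeff_frob_X := fun c => by rw [frobProd_X, constantCoeff_frobVar]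

variable (H : EnvHyp p (frobProd (r := r) p f φ φt)
    (algebraMap (PowerSeries R₀) (AProd R₀ m r) (eisA p R₀ E)) MvPowerSeries.X)
  (G : ResidueHyp p (frobProd (r := r) p f φ φt) (frobA p φ)
    (algebraMap (PowerSeries R₀) (AProd R₀ m r) (eisA p R₀ E)) MvPowerSeries.X
    MvPowerSeries.constantCoeff q)
include H G

theorem AEnv.isBoundedPrism : AEnv.IsBoundedPrism p f φ φt E r := G.exists_isBoundedPrism H

theorem AEnv.flat [IsNoetherianRing R₀] (hq : ∀ x, q x = 0 ↔ x ∈ Ideal.span {eisA p R₀ E}) :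
    Module.Flat (PowerSeries R₀) (AEnv p f φ φt E r) :=
  have : IsNoetherianRing (PowerSeries R₀) := inferInstance
  flat_complEnv H G fun a => (hq a).1

end


end PrismaticEnvelope

/-! ### The theorem for `A^(2)` and `A^(3)` -/

open PrismaticEnvelope in
theorem proposition2p5
    (p : ℕ) [Fact p.Prime]
    -- the perfect residue field `k`, the ring of integers `OK`, a uniformizer `ϖ`, and its
    -- Eisenstein polynomial `E`
    (k : Type u) [Field k] [CharP k p] [PerfectRing k p]
    (OK : Type v) [CommRing OK] [IsDomain OK] [IsDiscreteValuationRing OK] [CharZero OK]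
    [IsAdicComplete (IsLocalRing.maximalIdeal OK) OK] [Algebra (WittVector p k) OK]
    (hres : Function.Surjective
      (algebraMap (WittVector p k) (IsLocalRing.ResidueField OK)))
    (ϖ : OK) (hϖ : Irreducible ϖ)
    (E : Polynomial (WittVector p k)) (hEmonic : E.Monic)
    (hEeis : E.IsEisensteinAt (Ideal.span {(p : WittVector p k)}))
    (hEroot : Polynomial.aeval ϖ E = 0)
    -- the base rings `R₀` and `R = R₀ ⊗ OK`
    (R₀ : Type w) [CommRing R₀] [IsDomain R₀] [CharZero R₀] [Algebra (WittVector p k) R₀]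
    [IsAdicComplete (Ideal.span {(p : R₀)}) R₀]
    [IsDomain (R₀ ⧸ Ideal.span {(p : R₀)})]
    [IsDomain (R₀ ⊗[WittVector p k] OK)]
    [IsAdicComplete (Ideal.span {(p : R₀ ⊗[WittVector p k] OK)}) (R₀ ⊗[WittVector p k] OK)]
    (φ : R₀ →+* R₀) (hφ : IsFrobeniusLift p φ)
    -- the formally étale, Frobenius equivariant map `W(k)⟨t₁, …, t_m⟩ → R₀`
    (m : ℕ) (f : Tate p k m →ₐ[WittVector p k] R₀)
    (hf : IsPadicFormallyEtale p (f : Tate p k m →+* R₀))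
    (φt : Tate p k m →+* Tate p k m) (hφt : IsFrobeniusLift p φt)
    (hcomm : ∀ x, f (φt x) = φ (f x)) :
    -- `Ã^(2) / E ≅ R[γ_i(z_j)]`
    (∃ e : (ATilde p f φ φt E 1 ⧸ Ideal.span
          {algebraMap (PowerSeries R₀) (ATilde p f φ φt E 1) (eisA p R₀ E)}) ≃+*
        PdPoly p (R₀ ⊗[WittVector p k] OK) (Option (Fin m)),
      (∀ a : R₀, e (Ideal.Quotient.mk _ (algebraMap (PowerSeries R₀) _ (PowerSeries.C a))) =
        algebraMap (R₀ ⊗[WittVector p k] OK) _ (a ⊗ₜ 1)) ∧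
      e (Ideal.Quotient.mk _ (algebraMap (PowerSeries R₀) _ PowerSeries.X)) =
        algebraMap (R₀ ⊗[WittVector p k] OK) _ (1 ⊗ₜ ϖ) ∧
      ∀ c, e (Ideal.Quotient.mk _ (ATilde.z p f φ φt E 1 (0, c) 0)) = PdPoly.z p _ c) ∧
    -- `A^(2) / E ≅ D_z`
    (∃ e : (AEnv p f φ φt E 1 ⧸ Ideal.span
          {algebraMap (PowerSeries R₀) (AEnv p f φ φt E 1) (eisA p R₀ E)}) ≃+*
        ComplPdPoly p (R₀ ⊗[WittVector p k] OK) (Option (Fin m)),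
      (∀ a : R₀, e (Ideal.Quotient.mk _ (algebraMap (PowerSeries R₀) _ (PowerSeries.C a))) =
        algebraMap (R₀ ⊗[WittVector p k] OK) _ (a ⊗ₜ 1)) ∧
      e (Ideal.Quotient.mk _ (algebraMap (PowerSeries R₀) _ PowerSeries.X)) =
        algebraMap (R₀ ⊗[WittVector p k] OK) _ (1 ⊗ₜ ϖ) ∧
      ∀ c, e (Ideal.Quotient.mk _ (AEnv.z p f φ φt E 1 (0, c) 0)) = ComplPdPoly.z p _ c) ∧
    -- the `A`-algebra map `ι : A^(2) → A_max^(2)` with `z_j ↦ z_j` exists, is unique and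
    -- injective, and `Filⁱ A^(2) = Eⁱ A^(2)`
    (∃ ι : AEnv p f φ φt E 1 →ₐ[PowerSeries R₀] RingMax p (Option (Fin m)) (eisA p R₀ E),
      (∀ c, ι (AEnv.z p f φ φt E 1 (0, c) 0) = RingMax.z p (eisA p R₀ E) c) ∧
      (∀ ι' : AEnv p f φ φt E 1 →ₐ[PowerSeries R₀] RingMax p (Option (Fin m)) (eisA p R₀ E),
        (∀ c, ι' (AEnv.z p f φ φt E 1 (0, c) 0) = RingMax.z p (eisA p R₀ E) c) → ι' = ι) ∧
      Function.Injective ι ∧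
      ∀ i : ℕ, filtration p (eisA p R₀ E) ι i = Ideal.span
        {algebraMap (PowerSeries R₀) (AEnv p f φ φt E 1) (eisA p R₀ E) ^ i}) ∧
    -- `A^(2)` and `A^(3)` are bounded prisms, and flat over `A` (for `R₀` noetherian)
    AEnv.IsBoundedPrism p f φ φt E 1 ∧
    AEnv.IsBoundedPrism p f φ φt E 2 ∧
    (IsNoetherianRing R₀ →
      Module.Flat (PowerSeries R₀) (AEnv p f φ φt E 1) ∧
      Module.Flat (PowerSeries R₀) (AEnv p f φ φt E 2)) := by
  have htf : ∀ x : R₀, (p : R₀) * x = 0 → x = 0 := fun x hx =>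
    (mul_eq_zero.1 hx).resolve_left (Nat.cast_ne_zero.2 (Fact.out : p.Prime).ne_zero)
  obtain ⟨hadj, hroot⟩ := exists_isAdjoinRootMonic hres hϖ hEmonic hEeis hEroot
  have hdeg := natDegree_pos_of_aeval_eq_zero hEmonic hEroot
  choose q hqs hq hqC hqX using exists_powerSeries_to_tensor (R₀ := R₀) hEeis hadj hroot
  have hR := tensor_natCast_torsionFree (R₀ := R₀) hadj htf
  have hS : ∀ r, SeriesHyp p (frobA p φ) (eisA p R₀ E) (frobProd (r := r) p f φ φt) := fun r =>
    seriesHyp_aProd htf hφ hφt hEmonic hEeis hdeg hq hR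
  have hG : ∀ r, ResidueHyp p (frobProd (r := r) p f φ φt) (frobA p φ)
      (algebraMap (PowerSeries R₀) (AProd R₀ m r) (eisA p R₀ E)) MvPowerSeries.X
      MvPowerSeries.constantCoeff q := fun r => residueHyp_aProd hqs hq hR
  -- With a single additional factor the first index carries no information, so the variables are
  -- indexed by `Option (Fin m)` alone.
  choose κ hκ using (⟨Equiv.uniqueProd _ _, fun c => rfl⟩ :
    ∃ κ : Fin 1 × Option (Fin m) ≃ Option (Fin m), ∀ c, κ (0, c) = c)
  have hκ' : ∀ c, (0, κ c) = c := fun c => κ.injective (hκ _)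
  choose e he hez using ((hG 1).exists_equiv (hS 1).env κ).1
  choose e' he' hez' using ((hG 1).exists_equiv (hS 1).env κ).2
  choose ι hι huniq hinj hfil using (hS 1).exists_embedding (hG 1) κ
  have hz : ∀ ι' : AEnv p f φ φt E 1 →ₐ[PowerSeries R₀] RingMax p (Option (Fin m)) (eisA p R₀ E),
      (∀ c, ι' (AEnv.z p f φ φt E 1 (0, c) 0) = RingMax.z p (eisA p R₀ E) c) →
      ∀ c, ι' (AEnv.z p f φ φt E 1 c 0) = RingMax.z p (eisA p R₀ E) (κ c) := fun ι' hι' c => by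
    rw [← hι', hκ']
  refine ⟨⟨e, fun a => (he _).trans (by rw [hqC]), (he _).trans (by rw [hqX]),
      fun c => (hez (0, c)).trans (by rw [hκ])⟩,
    ⟨e', fun a => (he' _).trans (by rw [hqC]), (he' _).trans (by rw [hqX]),
      fun c => (hez' (0, c)).trans (by rw [hκ])⟩,
    ⟨ι, fun c => (hι (0, c)).trans (by rw [hκ]), fun ι' hι' => huniq ι' (hz ι' hι'), hinj, hfil⟩,
    AEnv.isBoundedPrism (hS 1).env (hG 1), AEnv.isBoundedPrism (hS 2).env (hG 2),
    fun _ => ⟨AEnv.flat (hS 1).env (hG 1) hq, AEnv.flat (hS 2).env (hG 2) hq⟩⟩
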